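/- Let $S$ be a scheme, let $\mathcal A$ be a sheaf of abelian groups on the étale site of the category $(\mathrm{Sch}/S)$ of $S$-schemes (for example the pullback to $(\mathrm{Sch}/S)$ of a sheaf of abelian groups on the small étale site of $S$), and let $\mathcal Div=[\mathbb A^1/\mathbb G_m]$ be the symmetric monoidal stack whose fiber over $V$ is the groupoid of pairs $(L,s)$ of a line bundle on $V$ and a global section, with the tensor product and the unit $\mathbb 1=(\mathcal O_V,1)$. For an $S$-scheme $T$ write $|_T$ for the restriction to $(\mathrm{Sch}/T)$. *2-cocycles.* A 2-cocycle $f:\mathcal A\times\mathcal A\to\mathcal Div$ is a morphism of fibered categories over $(\mathrm{Sch}/S)$ together with natural isomorphisms $$u_\lambda:f(0,\lambda)\cong\mathbb 1,\qquad s_{\lambda,\lambda'}:f(\lambda,\lambda')\cong f(\lambda',\lambda),$$ $$a_{\lambda,\lambda',\lambda''}:f(\lambda',\lambda'')\otimes f(\lambda,\lambda'+\lambda'')\cong f(\lambda,\lambda')\otimes f(\lambda+\lambda',\lambda'')$$ such that, with the associativity and symmetry constraints of $\otimes$ suppressed, 1. $u_0\circ s_{0,0}=u_0$; 2. $s_{\lambda',\lambda}\circ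 s_{\lambda,\lambda'}=\mathrm{id}$; 3. $((u_\lambda\circ s_{\lambda,0})\otimes\mathrm{id})\circ a_{\lambda,0,\lambda''}=u_{\lambda''}\otimes\mathrm{id}$ on $f(0,\lambda'')\otimes f(\lambda,\lambda'')$; 4. (pentagon) the two isomorphisms $$f(\lambda'',\lambda''')\otimes f(\lambda',\lambda''+\lambda''')\otimes f(\lambda,\lambda'+\lambda''+\lambda''')\to f(\lambda',\lambda'')\otimes f(\lambda,\lambda'+\lambda'')\otimes f(\lambda+\lambda'+\lambda'',\lambda''')$$ given by $a_{\lambda',\lambda'',\lambda'''}$ followed by $a_{\lambda,\lambda'+\lambda'',\lambda'''}$, and by $a_{\lambda,\lambda',\lambda''+\lambda'''}$ followed by $a_{\lambda+\lambda',\lambda'',\lambda'''}$ and $a_{\lambda,\lambda',\lambda''}^{-1}$, coincide; 5. (hexagon) $a_{\lambda',\lambda,\lambda''}^{-1}\circ(s_{\lambda,\lambda'}\otimes\mathrm{id})\circ a_{\lambda,\lambda',\lambda''}=(s_{\lambda'',\lambda}\otimes\mathrm{id})\circ a_{\lambda',\lambda'',\lambda}^{-1}\circ(\mathrm{id}\otimes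 s_{\lambda,\lambda'+\lambda''})$. *The universal extension.* For an abelian group $A$ let $P_A$ be the quotient of the free commutative monoid $\mathbb N^{A\times A}$ on symbols $e_{\lambda,\lambda'}$ by the congruence relation generated by $e_{\lambda,\lambda'}\sim e_{\lambda',\lambda}$, $e_{0,\lambda}\sim0$ and $e_{\lambda,\lambda'}+e_{\lambda+\lambda',\lambda''}\sim e_{\lambda',\lambda''}+e_{\lambda'+\lambda'',\lambda}$. Let $\mathcal P_{\mathcal A}$ be the étale sheafification of $U\mapsto P_{\mathcal A(U)}$, let $\mathcal Q_{\mathcal A}=\mathcal P_{\mathcal A}\times\mathcal A$ with the addition $(p,\lambda)+(p',\lambda')=(p+p'+e_{\lambda,\lambda'},\lambda+\lambda')$, and let $j:\mathcal P_{\mathcal A}\to\mathcal Q_{\mathcal A}$ be the inclusion $p\mapsto(p,0)$. Every symmetric monoidal functor $\mathcal L:\mathcal P_{\mathcal A}\to\mathcal Div$ gives the data $\Theta(\mathcal L)$ of a 2-cocycle: $(\lambda,\lambda')\mapsto\mathcal L(e_{\lambda,\lambda'})$, with $u$, $s$, $a$ induced by the equalities $e_{0,\lambda}=0$, $e_{\lambda,\lambda'}=e_{\lambda',\lambda}$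 and $e_{\lambda',\lambda''}+e_{\lambda,\lambda'+\lambda''}=e_{\lambda,\lambda'}+e_{\lambda+\lambda',\lambda''}$ in $\mathcal P_{\mathcal A}$. *The category $S_{\mathcal A,f}$.* Its objects are triples $(T,\zeta,\kappa)$ where $h:T\to S$ is an $S$-scheme, $\zeta:\mathcal A|_T\to\mathcal Div|_T$ is a 1-cochain (a morphism of fibered categories with a natural isomorphism $\zeta(0)\cong\mathbb 1$), and $\kappa_{\lambda,\lambda'}:\zeta(\lambda)\otimes\zeta(\lambda')\cong h^*f(\lambda,\lambda')\otimes\zeta(\lambda+\lambda')$ is a natural isomorphism which commutes with $u$, $s$ and $a$, i.e. $(u_\lambda\otimes\mathrm{id})\circ\kappa_{0,\lambda}$ is the isomorphism induced by $\zeta(0)\cong\mathbb 1$, $(s_{\lambda,\lambda'}\otimes\mathrm{id})\circ\kappa_{\lambda,\lambda'}$ is $\kappa_{\lambda',\lambda}$ up to the symmetry of $\otimes$, and $a_{\lambda,\lambda',\lambda''}\otimes\mathrm{id}$ takes the composite of $\kappa_{\lambda',\lambda''}$ and $\kappa_{\lambda,\lambda'+\lambda''}$ to the composite of $\kappa_{\lambda,\lambda'}$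 and $\kappa_{\lambda+\lambda',\lambda''}$ (isomorphisms from $\zeta(\lambda)\otimes\zeta(\lambda')\otimes\zeta(\lambda'')$). A morphism $(T',\zeta',\kappa')\to(T,\zeta,\kappa)$ is a pair $(\varphi,\eta)$ of an $S$-morphism $\varphi:T'\to T$ and a natural isomorphism $\eta:\varphi^*\zeta\to\zeta'$ with $\kappa'\circ(\eta\otimes\eta)=(\mathrm{id}\otimes\eta)\circ\varphi^*\kappa$. *The root stack $S_{\mathcal P_{\mathcal A},\mathcal Q_{\mathcal A},\mathcal L}$.* Its objects are triples $(T,\mathcal E,\alpha)$ of an $S$-scheme $T$, a symmetric monoidal functor $\mathcal E:\mathcal Q_{\mathcal A}|_T\to\mathcal Div|_T$ and an isomorphism of symmetric monoidal functors $\alpha:\mathcal L|_T\to\mathcal E\circ j|_T$. A morphism $(T',\mathcal E',\alpha')\to(T,\mathcal E,\alpha)$ is a pair $(\varphi,\theta)$ of an $S$-morphism $\varphi:T'\to T$ and an isomorphism of symmetric monoidal functors $\theta:\varphi^*\mathcal E\to\mathcal E'$ compatible with $\alpha$ and $\alpha'$. **Proposition.** Let $f:\mathcal A\times\mathcal A\to\mathcal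 Div$ be a 2-cocycle and let $\mathcal L_f:\mathcal P_{\mathcal A}\to\mathcal Div$ be a symmetric monoidal functor inducing $f$, i.e. given with an isomorphism $\psi:f\cong\Theta(\mathcal L_f)$ commuting with $u$, $s$ and $a$. Then $S_{\mathcal A,f}$ and $S_{\mathcal P_{\mathcal A},\mathcal Q_{\mathcal A},\mathcal L_f}$ are fibered categories over $(\mathrm{Sch}/S)$, and there is a canonical equivalence of fibered categories $$S_{\mathcal A,f}\simeq S_{\mathcal P_{\mathcal A},\mathcal Q_{\mathcal A},\mathcal L_f}.$$ Canonical means that, up to natural isomorphism, it sends $(T,\zeta,\kappa)$ to $(T,\mathcal E,\alpha)$ with $\mathcal E(p,\lambda)=\mathcal L_f(p)\otimes\zeta(\lambda)$, with comparison isomorphisms $$\mathcal L_f(p)\otimes\zeta(\lambda)\otimes\mathcal L_f(p')\otimes\zeta(\lambda')\to\mathcal L_f(p+p')\otimes f(\lambda,\lambda')\otimes\zeta(\lambda+\lambda')\to\mathcal L_f(p+p'+e_{\lambda,\lambda'})\otimes\zeta(\lambda+\lambda')$$ induced by the monoidal structure of $\mathcal L_f$, by $\kappa$ and by $\psi$,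 with $\alpha:\mathcal L_f(p)\cong\mathcal L_f(p)\otimes\zeta(0)$ induced by $\zeta(0)\cong\mathbb 1$, and that it sends $(\varphi,\eta)$ to $(\varphi,\mathrm{id}\otimes\eta)$. -/

import Mathlib

open CategoryTheory MonoidalCategory Opposite AlgebraicGeometry

universe u v₁ u₁ v₂ u₂

namespace StackyCover

/-- An invertible object `X` of a symmetric monoidal category together with a section `𝟙 ⟶ X`.
With `D` the category of `O`-modules on a scheme this is a line bundle with a global section. -/
structure PointedInvertible (D : Type u₁) [Category.{v₁} D] [MonoidalCategory D] where
  obj : D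
  invertible : ∃ Y : D, Nonempty (obj ⊗ Y ≅ 𝟙_ D)
  sec : 𝟙_ D ⟶ obj

namespace PointedInvertible
variable {D : Type u₁} [Category.{v₁} D] [MonoidalCategory D]

/-- Morphisms are the isomorphisms which respect the sections. -/
@[ext]
structure Hom (X Y : PointedInvertible D) where
  iso : X.obj ≅ Y.obj
  w : X.sec ≫ iso.hom = Y.sec

@[simps]
instance : Category (PointedInvertible D) where
  Hom := Hom
  id X := ⟨Iso.refl _, by simp⟩
  comp f g := ⟨f.iso ≪≫ g.iso, by
    rw [Iso.trans_hom, ← Category.assoc, f.w, g.w]⟩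

@[ext]
lemma hom_ext {X Y : PointedInvertible D} {f g : X ⟶ Y} (h : f.iso.hom = g.iso.hom) : f = g :=
  Hom.ext (Iso.ext h)

@[simps]
def inverse {X Y : PointedInvertible D} (f : X ⟶ Y) : Y ⟶ X := ⟨f.iso.symm, by simp [← f.w]⟩

instance : Groupoid (PointedInvertible D) where
  inv f := inverse f
  inv_comp f := by ext; simp
  comp_inv f := by ext; simp

@[simps hom inv]
def isoMk {X Y : PointedInvertible D} (f : X ⟶ Y) : X ≅ Y where
  hom := f
  inv := inverse f
  hom_inv_id := by ext; simp
  inv_hom_id := by ext; simp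

@[simps]
def forget (D : Type u₁) [Category.{v₁} D] [MonoidalCategory D] : PointedInvertible D ⥤ D where
  obj X := X.obj
  map f := f.iso.hom

instance : (forget D).Faithful where
  map_injective h := hom_ext h

/-- The unit `(𝟙, id)`, that is `(O, 1)`. -/
@[simps]
def unit (D : Type u₁) [Category.{v₁} D] [MonoidalCategory D] : PointedInvertible D where
  obj := 𝟙_ D
  invertible := ⟨𝟙_ D, ⟨λ_ _⟩⟩
  sec := 𝟙 _

lemma unit_tensor_assoc {X Y Z : D} (a : 𝟙_ D ⟶ X) (b : 𝟙_ D ⟶ Y) (c : 𝟙_ D ⟶ Z) :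
    ((λ_ (𝟙_ D)).inv ≫ (((λ_ (𝟙_ D)).inv ≫ (a ⊗ₘ b)) ⊗ₘ c)) ≫ (α_ X Y Z).hom =
      (λ_ (𝟙_ D)).inv ≫ (a ⊗ₘ ((λ_ (𝟙_ D)).inv ≫ (b ⊗ₘ c))) := by
  simp only [MonoidalCategory.tensorHom_def]
  monoidal

variable [SymmetricCategory D]

/-- The tensor product `(X ⊗ Y, s ⊗ t)`. -/
@[simps]
def tensor (X Y : PointedInvertible D) : PointedInvertible D where
  obj := X.obj ⊗ Y.obj
  invertible := by
    obtain ⟨A, ⟨a⟩⟩ := X.invertible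
    obtain ⟨B, ⟨b⟩⟩ := Y.invertible
    exact ⟨A ⊗ B, ⟨⟨tensorμ X.obj Y.obj A B, tensorδ X.obj Y.obj A B,
      tensorμ_tensorδ _ _ _ _, tensorδ_tensorμ _ _ _ _⟩ ≪≫ (a ⊗ᵢ b) ≪≫ λ_ _⟩⟩
  sec := (λ_ (𝟙_ D)).inv ≫ (X.sec ⊗ₘ Y.sec)

/-- The tensor product of two morphisms. -/
def tensorMap {X₁ Y₁ X₂ Y₂ : PointedInvertible D} (f : X₁ ⟶ Y₁) (g : X₂ ⟶ Y₂) :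
    tensor X₁ X₂ ⟶ tensor Y₁ Y₂ :=
  ⟨f.iso ⊗ᵢ g.iso, by
    change ((λ_ (𝟙_ D)).inv ≫ (X₁.sec ⊗ₘ X₂.sec)) ≫ (f.iso.hom ⊗ₘ g.iso.hom) =
      (λ_ (𝟙_ D)).inv ≫ (Y₁.sec ⊗ₘ Y₂.sec)
    rw [Category.assoc, MonoidalCategory.tensorHom_comp_tensorHom, f.w, g.w]⟩

instance : MonoidalCategoryStruct (PointedInvertible D) where
  tensorObj := tensor
  tensorUnit := unit D
  tensorHom := tensorMap
  whiskerLeft X _ _ g := tensorMap (𝟙 X) g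
  whiskerRight f Y := tensorMap f (𝟙 Y)
  associator X Y Z := isoMk ⟨α_ _ _ _, unit_tensor_assoc _ _ _⟩
  leftUnitor X := isoMk ⟨λ_ X.obj, by
    change ((λ_ (𝟙_ D)).inv ≫ (𝟙 (𝟙_ D) ⊗ₘ X.sec)) ≫ (λ_ X.obj).hom = X.sec
    rw [MonoidalCategory.id_tensorHom, Category.assoc,
      MonoidalCategory.leftUnitor_naturality, Iso.inv_hom_id_assoc]⟩
  rightUnitor X := isoMk ⟨ρ_ X.obj, by
    change ((λ_ (𝟙_ D)).inv ≫ (X.sec ⊗ₘ 𝟙 (𝟙_ D))) ≫ (ρ_ X.obj).hom = X.sec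
    rw [MonoidalCategory.tensorHom_id, Category.assoc,
      MonoidalCategory.rightUnitor_naturality, unitors_inv_equal, Iso.inv_hom_id_assoc]⟩

@[simp] lemma tensorHom_hom {X₁ Y₁ X₂ Y₂ : PointedInvertible D} (f : X₁ ⟶ Y₁) (g : X₂ ⟶ Y₂) :
    (f ⊗ₘ g).iso.hom = f.iso.hom ⊗ₘ g.iso.hom := rfl

instance : MonoidalCategory (PointedInvertible D) :=
  MonoidalCategory.ofTensorHom
    (id_tensorHom_id := fun X Y => hom_ext (MonoidalCategory.id_tensorHom_id X.obj Y.obj))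
    (tensorHom_comp_tensorHom := fun f g h k => hom_ext
      (MonoidalCategory.tensorHom_comp_tensorHom f.iso.hom g.iso.hom h.iso.hom k.iso.hom))
    (associator_naturality := fun f g h => hom_ext
      (MonoidalCategory.associator_naturality f.iso.hom g.iso.hom h.iso.hom))
    (leftUnitor_naturality := fun f => hom_ext
      ((congrArg (· ≫ _) (MonoidalCategory.id_tensorHom _ _)).trans
        (MonoidalCategory.leftUnitor_naturality f.iso.hom)))
    (rightUnitor_naturality := fun f => hom_ext
      ((congrArg (· ≫ _) (MonoidalCategory.tensorHom_id _ _)).trans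
        (MonoidalCategory.rightUnitor_naturality f.iso.hom)))
    (pentagon := fun W X Y Z => hom_ext (by
      have := MonoidalCategory.pentagon W.obj X.obj Y.obj Z.obj
      rw [← MonoidalCategory.tensorHom_id, ← MonoidalCategory.id_tensorHom] at this
      exact this))
    (triangle := fun X Y => hom_ext (by
      have := MonoidalCategory.triangle X.obj Y.obj
      rw [← MonoidalCategory.tensorHom_id, ← MonoidalCategory.id_tensorHom] at this
      exact this))

def braidingIso (X Y : PointedInvertible D) : X ⊗ Y ≅ Y ⊗ X :=
  isoMk ⟨β_ X.obj Y.obj, by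
    change ((λ_ (𝟙_ D)).inv ≫ (X.sec ⊗ₘ Y.sec)) ≫ (β_ X.obj Y.obj).hom =
      (λ_ (𝟙_ D)).inv ≫ (Y.sec ⊗ₘ X.sec)
    rw [Category.assoc, BraidedCategory.braiding_naturality, braiding_tensorUnit_left]
    simp [unitors_inv_equal, unitors_equal]⟩

lemma whiskerLeft_hom (X : PointedInvertible D) {Y Z : PointedInvertible D} (f : Y ⟶ Z) :
    (X ◁ f).iso.hom = X.obj ◁ f.iso.hom := MonoidalCategory.id_tensorHom _ _

lemma whiskerRight_hom {X Y : PointedInvertible D} (f : X ⟶ Y) (Z : PointedInvertible D) :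
    (f ▷ Z).iso.hom = f.iso.hom ▷ Z.obj := MonoidalCategory.tensorHom_id _ _

instance : SymmetricCategory (PointedInvertible D) where
  braiding := braidingIso
  braiding_naturality_right X Y Z f := hom_ext (by
    have := BraidedCategory.braiding_naturality_right X.obj f.iso.hom
    rw [← whiskerLeft_hom, ← whiskerRight_hom] at this; exact this)
  braiding_naturality_left f Z := hom_ext (by
    have := BraidedCategory.braiding_naturality_left f.iso.hom Z.obj
    rw [← whiskerLeft_hom, ← whiskerRight_hom] at this; exact this)
  hexagon_forward X Y Z := hom_ext (by
    have := BraidedCategory.hexagon_forward X.obj Y.obj Z.obj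
    rw [← MonoidalCategory.tensorHom_id, ← MonoidalCategory.id_tensorHom] at this
    exact this)
  hexagon_reverse X Y Z := hom_ext (by
    have := BraidedCategory.hexagon_reverse X.obj Y.obj Z.obj
    rw [← MonoidalCategory.tensorHom_id, ← MonoidalCategory.id_tensorHom] at this
    exact this)
  symmetry X Y := hom_ext (SymmetricCategory.symmetry X.obj Y.obj)

variable {D' : Type u₂} [Category.{v₂} D'] [MonoidalCategory D'] [SymmetricCategory D']

open Functor.LaxMonoidal Functor.OplaxMonoidal Functor.Monoidal

/-- The functor induced by a strong monoidal functor. -/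
@[simps]
def map (G : D ⥤ D') [G.Monoidal] : PointedInvertible D ⥤ PointedInvertible D' where
  obj X :=
    { obj := G.obj X.obj
      invertible := by
        obtain ⟨Y, ⟨e⟩⟩ := X.invertible
        exact ⟨G.obj Y, ⟨μIso G _ _ ≪≫ G.mapIso e ≪≫ (εIso G).symm⟩⟩
      sec := ε G ≫ G.map X.sec }
  map f := ⟨G.mapIso f.iso, by simp [← f.w]⟩

lemma unit_map_tensor (G : D ⥤ D') [G.Monoidal] {X Y : D} (a : 𝟙_ D ⟶ X) (b : 𝟙_ D ⟶ Y) :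
    ((λ_ (𝟙_ D')).inv ≫ ((ε G ≫ G.map a) ⊗ₘ (ε G ≫ G.map b))) ≫ μ G X Y =
      ε G ≫ G.map ((λ_ (𝟙_ D)).inv ≫ (a ⊗ₘ b)) := by
  rw [← MonoidalCategory.tensorHom_comp_tensorHom, Category.assoc, Category.assoc,
    Functor.LaxMonoidal.μ_natural, MonoidalCategory.tensorHom_def]
  simp [unitors_inv_equal]

instance (G : D ⥤ D') [G.Monoidal] : (map G).Monoidal :=
  Functor.CoreMonoidal.toMonoidal
    { εIso := isoMk ⟨εIso G, by
        change 𝟙 (𝟙_ D') ≫ ε G = ε G ≫ G.map (𝟙 (𝟙_ D))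
        simp⟩
      μIso := fun X Y => isoMk ⟨μIso G X.obj Y.obj, unit_map_tensor G X.sec Y.sec⟩
      μIso_hom_natural_left := fun f Z => hom_ext (by
        have := μ_natural_left G f.iso.hom Z.obj
        rw [← MonoidalCategory.tensorHom_id, ← MonoidalCategory.tensorHom_id] at this
        exact (congrArg (· ≫ _) (congrArg₂ (· ⊗ₘ ·) (by rfl) (by rfl))).trans this)
      μIso_hom_natural_right := fun Z f => hom_ext (by
        have := μ_natural_right G Z.obj f.iso.hom
        rw [← MonoidalCategory.id_tensorHom, ← MonoidalCategory.id_tensorHom] at this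
        exact (congrArg (· ≫ _) (congrArg₂ (· ⊗ₘ ·) (by rfl) (by rfl))).trans this)
      associativity := fun X Y Z => hom_ext (by
        have := Functor.LaxMonoidal.associativity G X.obj Y.obj Z.obj
        rw [← MonoidalCategory.tensorHom_id, ← MonoidalCategory.id_tensorHom] at this
        exact this)
      left_unitality := fun X => hom_ext (by
        have := Functor.LaxMonoidal.left_unitality G X.obj
        rw [← MonoidalCategory.tensorHom_id] at this
        exact this)
      right_unitality := fun X => hom_ext (by
        have := Functor.LaxMonoidal.right_unitality G X.obj
        rw [← MonoidalCategory.id_tensorHom] at this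
        exact this) }

end PointedInvertible

section LineBundles

/-- The category of affine schemes `Spec R ⟶ V` over `V` (points of `V` with values in rings). -/
abbrev AffineOver (V : Scheme.{u}) : Type (u + 1) := CostructuredArrow Scheme.Spec.{u} V

/-- The structure presheaf `(Spec R ⟶ V) ↦ R`. -/
noncomputable def structurePresheaf (V : Scheme.{u}) : (AffineOver V)ᵒᵖ ⥤ CommRingCat.{u} :=
  (CostructuredArrow.proj Scheme.Spec V).leftOp

/-- `O`-modules on `V` from the point of view of the functor of points: an `R`-module `M(x)` for every
`x : Spec R ⟶ V`, with compatible semilinear restriction maps. A quasi-coherent sheaf on `V` is such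
an `M` for which all base change maps `R' ⊗[R] M(x) ⟶ M(x')` are isomorphisms. If `M ⊗ N ≅ O`, then
every `M(x)` is an invertible module and all base change maps are isomorphisms, so the `⊗`-invertible
objects are exactly the line bundles on `V`, and the maps from `O` are their global sections. -/
abbrev OMod (V : Scheme.{u}) :=
  PresheafOfModules.{u} (structurePresheaf V ⋙ forget₂ CommRingCat RingCat)

/-- Pullback of `O`-modules along `g`: `(g^* M)(x) = M(x ≫ g)`. -/
noncomputable def OMod.pull {V' V : Scheme.{u}} (g : V' ⟶ V) : OMod V ⥤ OMod V' :=
  PresheafOfModules.pushforward₀OfCommRingCat (CostructuredArrow.map g) (structurePresheaf V)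

noncomputable instance {V' V : Scheme.{u}} (g : V' ⟶ V) : (OMod.pull g).Monoidal :=
  inferInstanceAs (PresheafOfModules.pushforward₀OfCommRingCat
    (CostructuredArrow.map g) (structurePresheaf V)).Monoidal

noncomputable def OMod.isoOfPresheafIso {V : Scheme.{u}} {M N : OMod V}
    (e : M.presheaf ≅ N.presheaf)
    (he : ∀ (X : (AffineOver V)ᵒᵖ) (r : (structurePresheaf V ⋙ forget₂ CommRingCat RingCat).obj X)
      (m : M.obj X), e.hom.app X (r • m) = r • e.hom.app X m) : M ≅ N where
  hom := PresheafOfModules.homMk e.hom he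
  inv := PresheafOfModules.homMk e.inv (fun X r m => by
    have h1 (n : N.obj X) : e.hom.app X (e.inv.app X n) = n :=
      ConcreteCategory.congr_hom (e.inv_hom_id_app X) n
    have h2 (n : M.obj X) : e.inv.app X (e.hom.app X n) = n :=
      ConcreteCategory.congr_hom (e.hom_inv_id_app X) n
    have h3 := he X r (e.inv.app X m)
    rw [h1] at h3
    exact (congrArg (e.inv.app X) h3).symm.trans (h2 _))
  hom_inv_id := by
    apply (PresheafOfModules.toPresheaf _).map_injective
    exact e.hom_inv_id
  inv_hom_id := by
    apply (PresheafOfModules.toPresheaf _).map_injective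
    exact e.inv_hom_id

noncomputable def AffineOver.mapId (V : Scheme.{u}) : CostructuredArrow.map (S := Scheme.Spec) (𝟙 V) ≅ 𝟭 (AffineOver V) :=
  NatIso.ofComponents (fun X => CostructuredArrow.isoMk (Iso.refl X.left) (by simp)) (by intros; ext; simp)

noncomputable def AffineOver.mapComp {V'' V' V : Scheme.{u}} (g' : V'' ⟶ V') (g : V' ⟶ V)  :
    CostructuredArrow.map (S := Scheme.Spec) (g' ≫ g) ≅ CostructuredArrow.map g' ⋙ CostructuredArrow.map g :=
  NatIso.ofComponents (fun X => CostructuredArrow.isoMk (Iso.refl X.left) (by simp)) (by intros; ext; simp)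

/-- The canonical isomorphism `id^* ≅ id`. -/
noncomputable def OMod.pullId (V : Scheme.{u}) : OMod.pull (𝟙 V) ≅ 𝟭 (OMod V) :=
  NatIso.ofComponents (fun M => OMod.isoOfPresheafIso
    (Functor.isoWhiskerRight (NatIso.op (AffineOver.mapId V).symm) M.presheaf) (by
    intro X r m
    exact M.map_smul ((AffineOver.mapId V).inv.app X.unop).op r m)) (by 
    intro M N f
    apply (PresheafOfModules.toPresheaf _).map_injective
    ext X m
    exact (PresheafOfModules.naturality_apply f ((AffineOver.mapId V).inv.app X.unop).op m).symm)

/-- The canonical isomorphism `(g' ≫ g)^* ≅ g'^* ∘ g^*`. -/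
noncomputable def OMod.pullComp {V'' V' V : Scheme.{u}} (g' : V'' ⟶ V') (g : V' ⟶ V)  :
   OMod.pull (g' ≫ g) ≅ OMod.pull g ⋙ OMod.pull g' :=
  NatIso.ofComponents (fun M => OMod.isoOfPresheafIso
    (Functor.isoWhiskerRight (NatIso.op (AffineOver.mapComp g' g).symm) M.presheaf) (by
    intro X r m
    exact M.map_smul ((AffineOver.mapComp g' g).inv.app X.unop).op r m)) (by 
    intro M N f
    apply (PresheafOfModules.toPresheaf _).map_injective
    ext X m
    exact (PresheafOfModules.naturality_apply f ((AffineOver.mapComp g' g).inv.app X.unop).op m).symm)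

open Functor.LaxMonoidal

lemma OMod.pullId_unit (V : Scheme.{u}) :
    ε (OMod.pull (𝟙 V)) ≫ (OMod.pullId V).hom.app (𝟙_ (OMod V)) = 𝟙 (𝟙_ (OMod V)) := by
  apply (PresheafOfModules.toPresheaf _).map_injective
  ext X m
  rfl

lemma OMod.pullComp_unit {V'' V' V : Scheme.{u}} (g' : V'' ⟶ V') (g : V' ⟶ V) :
    ε (OMod.pull (g' ≫ g)) ≫ (OMod.pullComp g' g).hom.app (𝟙_ (OMod V)) =
      ε (OMod.pull g') ≫ (OMod.pull g').map (ε (OMod.pull g)) := by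
  apply (PresheafOfModules.toPresheaf _).map_injective
  ext X m
  rfl

/-- The symmetric monoidal groupoid `Div(V) = [𝔸¹/𝔾ₘ](V)` of line bundles on `V` with a global
section. -/
abbrev DivCat (V : Scheme.{u}) := PointedInvertible (OMod V)

/-- The pullback functor of `Div`. -/
noncomputable abbrev DivCat.pull {V' V : Scheme.{u}} (g : V' ⟶ V) : DivCat V ⥤ DivCat V' :=
  PointedInvertible.map (OMod.pull g)

noncomputable def DivCat.pullId (V : Scheme.{u}) : DivCat.pull (𝟙 V) ≅ 𝟭 (DivCat V) :=
  NatIso.ofComponents (fun L => PointedInvertible.isoMk ⟨(OMod.pullId V).app L.obj, by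
    change (ε (OMod.pull (𝟙 V)) ≫ (OMod.pull (𝟙 V)).map L.sec) ≫ (OMod.pullId V).hom.app L.obj = _
    rw [Category.assoc, (OMod.pullId V).hom.naturality, ← Category.assoc, OMod.pullId_unit,
      Category.id_comp]
    rfl⟩)
    (fun f => PointedInvertible.hom_ext ((OMod.pullId V).hom.naturality f.iso.hom))

noncomputable def DivCat.pullComp {V'' V' V : Scheme.{u}} (g' : V'' ⟶ V') (g : V' ⟶ V) :
    DivCat.pull (g' ≫ g) ≅ DivCat.pull g ⋙ DivCat.pull g' :=
  NatIso.ofComponents (fun L => PointedInvertible.isoMk ⟨(OMod.pullComp g' g).app L.obj, by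
    change (ε (OMod.pull (g' ≫ g)) ≫ (OMod.pull (g' ≫ g)).map L.sec) ≫
        (OMod.pullComp g' g).hom.app L.obj =
      ε (OMod.pull g') ≫ (OMod.pull g').map (ε (OMod.pull g) ≫ (OMod.pull g).map L.sec)
    rw [Category.assoc, (OMod.pullComp g' g).hom.naturality, ← Category.assoc,
      OMod.pullComp_unit, Functor.map_comp, Category.assoc]
    rfl⟩)
    (fun f => PointedInvertible.hom_ext ((OMod.pullComp g' g).hom.naturality f.iso.hom))

end LineBundles

section UniversalExtension

/-- The relations `e(x,y) ∼ e(y,x)`, `e(0,x) ∼ 0` and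
`e(x,y) + e(x+y,z) ∼ e(y,z) + e(y+z,x)` on the free commutative monoid `ℕ^(A × A)`. -/
inductive UniversalRel (A : Type u) [AddCommGroup A] : (A × A →₀ ℕ) → (A × A →₀ ℕ) → Prop
  | symm (x y : A) : UniversalRel A (Finsupp.single (x, y) 1) (Finsupp.single (y, x) 1)
  | zero (x : A) : UniversalRel A (Finsupp.single (0, x) 1) 0
  | assoc (x y z : A) : UniversalRel A
      (Finsupp.single (x, y) 1 + Finsupp.single (x + y, z) 1)
      (Finsupp.single (y, z) 1 + Finsupp.single (y + z, x) 1)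

/-- The monoid `P_A = ℕ^(A × A) / R_A`. -/
abbrev UniversalMonoid (A : Type u) [AddCommGroup A] : Type u :=
  (addConGen (UniversalRel A)).Quotient

namespace UniversalMonoid

variable {A B C : Type u} [AddCommGroup A] [AddCommGroup B] [AddCommGroup C]

/-- The universal 2-cocycle `e : A × A → P_A`. -/
noncomputable def e (x y : A) : UniversalMonoid A :=
  (addConGen (UniversalRel A)).mk' (Finsupp.single (x, y) 1)

lemma e_symm (x y : A) : e x y = e y x :=
  (AddCon.eq _).2 (AddConGen.Rel.of _ _ (.symm x y))

lemma e_zero (x : A) : e 0 x = 0 :=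
  (AddCon.eq _).2 (AddConGen.Rel.of _ _ (.zero x))

lemma e_assoc (x y z : A) : e x y + e (x + y) z = e y z + e (y + z) x :=
  (AddCon.eq _).2 (AddConGen.Rel.of _ _ (.assoc x y z))

/-- Functoriality of `P_A` in `A`. -/
noncomputable def map (φ : A →+ B) : UniversalMonoid A →+ UniversalMonoid B :=
  (addConGen (UniversalRel A)).lift
    ((addConGen (UniversalRel B)).mk'.comp (Finsupp.mapDomain.addMonoidHom (Prod.map φ φ)))
    (AddCon.addConGen_le.2 (by
      intro a b h
      rw [AddCon.ker_rel]
      have key (p : A × A) : ((addConGen (UniversalRel B)).mk'.comp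
          (Finsupp.mapDomain.addMonoidHom (Prod.map φ φ))) (Finsupp.single p 1) =
            e (φ p.1) (φ p.2) :=
        congrArg _ (Finsupp.mapDomain_single ..)
      induction h with
      | symm x y => rw [key, key]; exact e_symm _ _
      | zero x => rw [key, map_zero, map_zero]; exact e_zero _
      | assoc x y z =>
        rw [map_add, map_add, key, key, key, key]
        simpa using e_assoc (φ x) (φ y) (φ z)))

@[simp]
lemma map_e (φ : A →+ B) (x y : A) : map φ (e x y) = e (φ x) (φ y) := by
  change (addConGen (UniversalRel B)).mk' (Finsupp.mapDomain _ _) = _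
  rw [Finsupp.mapDomain_single]
  rfl

lemma hom_ext {M : Type*} [AddCommMonoid M] {f g : UniversalMonoid A →+ M}
    (h : ∀ x y, f (e x y) = g (e x y)) : f = g := by
  apply AddCon.hom_ext
  apply Finsupp.addHom_ext'
  rintro ⟨x, y⟩
  ext
  exact h x y

lemma map_id : map (AddMonoidHom.id A) = AddMonoidHom.id _ := hom_ext (by simp)

lemma map_comp (ψ : B →+ C) (φ : A →+ B) : map (ψ.comp φ) = (map ψ).comp (map φ) :=
  hom_ext (by simp)

end UniversalMonoid

/-- The set `P × A`, to be equipped with the addition twisted by `c : A × A → P`: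
`(p, x) + (q, y) = (p + q + c(x, y), x + y)`. -/
@[ext]
structure Extension {P A : Type u} [AddCommMonoid P] [AddCommGroup A] (c : A → A → P) where
  fst : P
  snd : A

/-- Commutative 2-cocycles of a group `A` with values in a commutative monoid `P`. -/
class IsTwoCocycle {P A : Type u} [AddCommMonoid P] [AddCommGroup A] (c : A → A → P) : Prop where
  symm (x y : A) : c x y = c y x
  zero (x : A) : c 0 x = 0
  assoc (x y z : A) : c x y + c (x + y) z = c y z + c x (y + z)

namespace Extension

variable {P A : Type u} [AddCommMonoid P] [AddCommGroup A] {c : A → A → P}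

instance : Zero (Extension c) := ⟨⟨0, 0⟩⟩
instance : Add (Extension c) := ⟨fun a b => ⟨a.fst + b.fst + c a.snd b.snd, a.snd + b.snd⟩⟩

lemma zero_def : (0 : Extension c) = ⟨0, 0⟩ := rfl
lemma add_def (a b : Extension c) :
    a + b = ⟨a.fst + b.fst + c a.snd b.snd, a.snd + b.snd⟩ := rfl

instance [h : IsTwoCocycle c] : AddCommMonoid (Extension c) where
  add_assoc a b d := by
    simp only [add_def, mk.injEq]
    refine ⟨?_, add_assoc _ _ _⟩
    calc _ = a.fst + b.fst + d.fst + (c a.snd b.snd + c (a.snd + b.snd) d.snd) := by abel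
      _ = _ := by rw [h.assoc]; abel
  zero_add a := by simp [add_def, zero_def, h.zero]
  add_zero a := by simp [add_def, zero_def, h.symm a.snd 0, h.zero]
  add_comm a b := by
    simp only [add_def, mk.injEq]
    exact ⟨by rw [h.symm a.snd, add_comm a.fst], add_comm _ _⟩
  nsmul := nsmulRec

end Extension

end UniversalExtension

section Sheaves

variable {S : Scheme.{u}}

open Limits in
instance (K : Type u) [SmallCategory K] [IsFiltered K] : HasColimitsOfShape K AddCommMonCat.{u} where
  has_colimit F := ⟨⟨⟨_, AddCommMonCat.FilteredColimits.colimitCoconeIsColimit F⟩⟩⟩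

/-- The (big) étale topology on the category of `S`-schemes. -/
abbrev etaleTop (S : Scheme.{u}) : GrothendieckTopology (Over S) := Scheme.etaleTopology.over S

/-- Presheaves of abelian groups on the category of `S`-schemes. -/
abbrev AbPresheaf (S : Scheme.{u}) := (Over S)ᵒᵖ ⥤ AddCommGrpCat.{u + 1}

/-- Presheaves of commutative monoids on the category of `S`-schemes. -/
abbrev MonPresheaf (S : Scheme.{u}) := (Over S)ᵒᵖ ⥤ AddCommMonCat.{u + 1}

/-- The presheaf of sets `A × A`. -/
abbrev pairs (A : AbPresheaf S) : (Over S)ᵒᵖ ⥤ Type (u + 1) where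
  obj V := A.obj V × A.obj V
  map g := TypeCat.ofHom (Prod.map (A.map g) (A.map g))

lemma pairs_map (A : AbPresheaf S) {V V' : (Over S)ᵒᵖ} (g : V ⟶ V') {x y : A.obj V}
    {x' y' : A.obj V'} (hx : A.map g x = x') (hy : A.map g y = y') :
    (pairs A).map g (x, y) = (x', y') := Prod.ext hx hy

lemma map_zero_eq (A : AbPresheaf S) {V V' : (Over S)ᵒᵖ} (g : V ⟶ V') : A.map g 0 = 0 :=
  map_zero (A.map g).hom

lemma map_add_eq (A : AbPresheaf S) {V V' : (Over S)ᵒᵖ} (g : V ⟶ V') {x y z : A.obj V}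
    {x' y' z' : A.obj V'} (hx : A.map g x = x') (hy : A.map g y = y') (hz : A.map g z = z')
    (h : x + y = z) : x' + y' = z' := by
  rw [← hx, ← hy, ← hz, ← h]; exact (map_add (A.map g).hom x y).symm

/-- The presheaf of monoids `V ↦ P_{A(V)}`. -/
noncomputable def universalPresheaf (A : AbPresheaf S) : MonPresheaf S where
  obj V := AddCommMonCat.of (UniversalMonoid (A.obj V))
  map g := AddCommMonCat.ofHom (UniversalMonoid.map (A.map g).hom)
  map_id V := by
    ext1; simp [UniversalMonoid.map_id]
  map_comp f g := by
    ext1; simp [UniversalMonoid.map_comp]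

/-- The sheaf of monoids `P_A`: the étale sheafification of `V ↦ P_{A(V)}`. -/
noncomputable def universalSheaf (A : AbPresheaf S) : MonPresheaf S :=
  sheafify (etaleTop S) (universalPresheaf A)

/-- The universal 2-cocycle `e : A × A → P_A` of sheaves. -/
noncomputable def universalCocycle (A : AbPresheaf S) {V : Over S} (x y : A.obj (op V)) :
    (universalSheaf A).obj (op V) :=
  (toSheafify (etaleTop S) (universalPresheaf A)).app (op V) (UniversalMonoid.e x y)

lemma universalCocycle_map (A : AbPresheaf S) {V V' : Over S} (g : V' ⟶ V) {x y : A.obj (op V)}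
    {x' y' : A.obj (op V')} (hx : A.map g.op x = x') (hy : A.map g.op y = y') :
    (universalSheaf A).map g.op (universalCocycle A x y) = universalCocycle A x' y' := by
  have h := ConcreteCategory.congr_hom
    ((toSheafify (etaleTop S) (universalPresheaf A)).naturality g.op) (UniversalMonoid.e x y)
  refine Eq.trans h.symm ?_
  rw [← hx, ← hy]
  exact congrArg _ (UniversalMonoid.map_e (A.map g.op).hom x y)

instance (A : AbPresheaf S) (V : Over S) : IsTwoCocycle (universalCocycle A (V := V)) where
  symm x y := congrArg _ (UniversalMonoid.e_symm x y)
  zero x := by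
    have h := congrArg ((toSheafify (etaleTop S) (universalPresheaf A)).app (op V)).hom
      (UniversalMonoid.e_zero x)
    exact h.trans (map_zero _)
  assoc x y z := by
    have h := congrArg ((toSheafify (etaleTop S) (universalPresheaf A)).app (op V)).hom
      (UniversalMonoid.e_assoc x y z)
    rw [UniversalMonoid.e_symm (y + z) x] at h
    exact (map_add _ _ _).symm.trans (h.trans (map_add _ _ _))

/-- The sheaf of monoids `Q_A = P_A ×_e A`. -/
noncomputable def universalExtension (A : AbPresheaf S) : MonPresheaf S where
  obj V := AddCommMonCat.of (Extension (universalCocycle A (V := V.unop)))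
  map {V V'} g := AddCommMonCat.ofHom
    { toFun := fun q => ⟨(universalSheaf A).map g q.fst, A.map g q.snd⟩
      map_zero' := Extension.ext (map_zero ((universalSheaf A).map g).hom)
        (map_zero (A.map g).hom)
      map_add' := fun a b => Extension.ext (by
          rw [Extension.add_def, Extension.add_def]
          refine (map_add ((universalSheaf A).map g).hom _ _).trans ?_
          exact congrArg₂ _ (map_add ((universalSheaf A).map g).hom _ _)
            (universalCocycle_map A g.unop rfl rfl))
        (map_add (A.map g).hom _ _) }
  map_id V := by
    ext q
    · exact congrArg (fun k => k q.fst) ((universalSheaf A).map_id V)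
    · exact congrArg (fun k => k.hom q.snd) (A.map_id V)
  map_comp f g := by
    ext q
    · exact ConcreteCategory.congr_hom ((universalSheaf A).map_comp f g) q.fst
    · exact ConcreteCategory.congr_hom (A.map_comp f g) q.snd

/-- The inclusion `P_A ⟶ Q_A`, `p ↦ (p, 0)`. -/
noncomputable def universalInclusion (A : AbPresheaf S) :
    universalSheaf A ⟶ universalExtension A where
  app V := AddCommMonCat.ofHom
    { toFun := fun p => ⟨p, 0⟩
      map_zero' := rfl
      map_add' := fun p q => Extension.ext (by
          rw [Extension.add_def]
          exact ((congrArg (p + q + ·) (IsTwoCocycle.zero (c := universalCocycle A (V := V.unop)) 0)).trans (add_zero _)).symm)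
        (add_zero 0).symm }
  naturality V V' g := by
    ext p
    exact Extension.ext rfl (map_zero (A.map g).hom).symm

end Sheaves

section Families

variable {S : Scheme.{u}}

open Functor.LaxMonoidal Functor.OplaxMonoidal

/-- The tensor product of two morphisms lying over `g`. -/
noncomputable def tensorRes {V' V : Scheme.{u}} {g : V' ⟶ V} {L M : DivCat V} {L' M' : DivCat V'}
    (a : (DivCat.pull g).obj L ⟶ L') (b : (DivCat.pull g).obj M ⟶ M') :
    (DivCat.pull g).obj (L ⊗ M) ⟶ L' ⊗ M' :=
  δ (DivCat.pull g) L M ≫ (a ⊗ₘ b)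

/-- The canonical morphism `g^* 𝟙 ⟶ 𝟙`. -/
noncomputable def unitRes {V' V : Scheme.{u}} (g : V' ⟶ V) :
    (DivCat.pull g).obj (𝟙_ (DivCat V)) ⟶ 𝟙_ (DivCat V') :=
  η (DivCat.pull g)

/-- `S` as a scheme over itself. -/
def base (S : Scheme.{u}) : Over S := Over.mk (𝟙 S)

/-- The structure morphism of an `S`-scheme. -/
def toBase (V : Over S) : V ⟶ base S := Over.homMk V.hom

lemma comp_toBase {V' V : Over S} (g : V' ⟶ V) : g ≫ toBase V = toBase V' := by
  apply Over.OverMorphism.ext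
  exact Over.w g

/-- A morphism of fibered categories `X|_T ⟶ Div|_T`, for `X` a presheaf of sets on `Sch/S`. It consists
of an object `E(v, x)` of `Div(V)` for all `v : V ⟶ T` and `x ∈ X(V)`, and isomorphisms
`g^* E(v, x) ≅ E(g ≫ v, x|_{V'})` for all `g : V' ⟶ V`, subject to the cocycle condition.
Equalities in the indices are arguments, in order to avoid transports. -/
structure Family (T : Over S) (X : (Over S)ᵒᵖ ⥤ Type (u + 1)) where
  obj {V : Over S} (v : V ⟶ T) (x : X.obj (op V)) : DivCat V.left
  res {V' V : Over S} (g : V' ⟶ V) {v : V ⟶ T} {v' : V' ⟶ T} (hv : g ≫ v = v')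
    {x : X.obj (op V)} {x' : X.obj (op V')} (hx : X.map g.op x = x') :
    (DivCat.pull g.left).obj (obj v x) ⟶ obj v' x'
  res_id {V : Over S} (v : V ⟶ T) (x : X.obj (op V)) (hx : X.map (𝟙 V).op x = x) :
    res (𝟙 V) (Category.id_comp v) hx = (DivCat.pullId V.left).hom.app (obj v x)
  res_comp {V'' V' V : Over S} (g' : V'' ⟶ V') (g : V' ⟶ V) {v : V ⟶ T} {v' : V' ⟶ T}
    {v'' : V'' ⟶ T} (hv : g ≫ v = v') (hv' : g' ≫ v' = v'') (hv'' : (g' ≫ g) ≫ v = v'')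
    {x : X.obj (op V)} {x' : X.obj (op V')} {x'' : X.obj (op V'')} (hx : X.map g.op x = x')
    (hx' : X.map g'.op x' = x'') (hx'' : X.map (g' ≫ g).op x = x'') :
    res (g' ≫ g) hv'' hx'' =
      (DivCat.pullComp g'.left g.left).hom.app (obj v x) ≫
        (DivCat.pull g'.left).map (res g hv hx) ≫ res g' hv' hx'

/-- For `φ : T' ⟶ T`, a natural isomorphism `φ^* E ⟶ E'`, where `(φ^* E)(v, x) = E(v ≫ φ, x)`. (All
morphisms of `Div(V)` are isomorphisms.) -/
@[ext]
structure Family.Hom {T' T : Over S} {X : (Over S)ᵒᵖ ⥤ Type (u + 1)} (φ : T' ⟶ T)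
    (E : Family T X) (E' : Family T' X) where
  app {V : Over S} {v : V ⟶ T'} {w : V ⟶ T} (h : v ≫ φ = w) (x : X.obj (op V)) :
    E.obj w x ⟶ E'.obj v x
  naturality {V' V : Over S} (g : V' ⟶ V) {v : V ⟶ T'} {w : V ⟶ T} {v' : V' ⟶ T'} {w' : V' ⟶ T}
    (h : v ≫ φ = w) (h' : v' ≫ φ = w') (hv : g ≫ v = v') (hw : g ≫ w = w')
    {x : X.obj (op V)} {x' : X.obj (op V')} (hx : X.map g.op x = x') :
    (DivCat.pull g.left).map (app h x) ≫ E'.res g hv hx = E.res g hw hx ≫ app h' x'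

/-- The identification `E(v, x) = E(v, y)` for `x = y`. -/
noncomputable def Family.cast {T : Over S} {X : (Over S)ᵒᵖ ⥤ Type (u + 1)} (E : Family T X) {V : Over S}
    (v : V ⟶ T) {x y : X.obj (op V)} (h : x = y) : E.obj v x ⟶ E.obj v y :=
  eqToHom (congrArg (E.obj v) h)

namespace Family.Hom

variable {X : (Over S)ᵒᵖ ⥤ Type (u + 1)}

/-- The identity of `E`, as a morphism over the identity of `T`. -/
noncomputable def id {T : Over S} (E : Family T X) : Hom (𝟙 T) E E where
  app {V v w} h x := eqToHom (by rw [← h, Category.comp_id])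
  naturality g v w v' w' h h' hv hw x x' hx := by
    obtain rfl : v = w := by rw [← h, Category.comp_id]
    obtain rfl : v' = w' := by rw [← h', Category.comp_id]
    simp

/-- Composition: `ψ^* φ^* E ⟶ ψ^* E' ⟶ E''`. -/
noncomputable def comp {T'' T' T : Over S} {ψ : T'' ⟶ T'} {φ : T' ⟶ T} {E : Family T X} {E' : Family T' X}
    {E'' : Family T'' X} (b : Hom ψ E' E'') (a : Hom φ E E') : Hom (ψ ≫ φ) E E'' where
  app {V v w} h x := a.app (v := v ≫ ψ) (by rw [Category.assoc, h]) x ≫ b.app rfl x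
  naturality g v w v' w' h h' hv hw x x' hx := by
    rw [Functor.map_comp, Category.assoc,
      b.naturality g rfl rfl hv (by rw [← Category.assoc, hv]) hx, ← Category.assoc,
      a.naturality g _ _ (by rw [← Category.assoc, hv]) hw hx, Category.assoc]

lemma app_congr {T' T : Over S} {φ : T' ⟶ T} {E : Family T X} {E' : Family T' X} (a : Hom φ E E')
    {V : Over S} {v₁ v₂ : V ⟶ T'} {w : V ⟶ T} (h₁ : v₁ ≫ φ = w) (h₂ : v₂ ≫ φ = w)
    (e : v₁ = v₂) (x : X.obj (op V)) :
    a.app h₁ x ≫ eqToHom (by rw [e]) = a.app h₂ x := by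
  subst e; simp

lemma app_congr_left {T' T : Over S} {φ : T' ⟶ T} {E : Family T X} {E' : Family T' X} (a : Hom φ E E')
    {V : Over S} {v : V ⟶ T'} {w₁ w₂ : V ⟶ T} (h₁ : v ≫ φ = w₁) (h₂ : v ≫ φ = w₂)
    (e : w₂ = w₁) (x : X.obj (op V)) :
    eqToHom (by rw [e]) ≫ a.app h₁ x = a.app h₂ x := by
  subst e; simp

lemma comp_app_assoc {T₃ T₂ T₁ T₀ : Over S} {χ : T₃ ⟶ T₂} {ψ : T₂ ⟶ T₁} {φ : T₁ ⟶ T₀}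
    {E₀ : Family T₀ X} {E₁ : Family T₁ X} {E₂ : Family T₂ X} {E₃ : Family T₃ X}
    (c : Hom χ E₂ E₃) (b : Hom ψ E₁ E₂) (a : Hom φ E₀ E₁) {V : Over S} {v : V ⟶ T₃} {w : V ⟶ T₀}
    (h : v ≫ (χ ≫ ψ) ≫ φ = w) (h' : v ≫ χ ≫ ψ ≫ φ = w) (x : X.obj (op V)) :
    ((c.comp b).comp a).app h x = (c.comp (b.comp a)).app h' x := by
  have e : (v ≫ χ) ≫ ψ = v ≫ χ ≫ ψ := Category.assoc _ _ _
  have key : ∀ (k : V ⟶ T₁) (e : k = v ≫ χ ≫ ψ) (h₁ : k ≫ φ = w)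
      (h₂ : (v ≫ χ) ≫ ψ = k) (h₃ : (v ≫ χ ≫ ψ) ≫ φ = w) (h₄ : (v ≫ χ) ≫ ψ = v ≫ χ ≫ ψ),
      a.app h₃ x ≫ b.app h₄ x = a.app h₁ x ≫ b.app h₂ x := by
    rintro k rfl h₁ h₂ h₃ h₄
    rfl
  change a.app _ x ≫ b.app _ x ≫ c.app _ x = (a.app _ x ≫ b.app _ x) ≫ c.app _ x
  rw [← Category.assoc]
  exact congrArg (· ≫ c.app rfl x) (key _ e _ rfl _ _)

end Family.Hom

/-- A symmetric monoidal functor `P|_T ⟶ Div|_T`, for a presheaf of commutative monoids `P`. -/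
structure SymMonFunctor (T : Over S) (P : MonPresheaf S) extends Family T (P ⋙ forget _) where
  ε {V : Over S} (v : V ⟶ T) : 𝟙_ (DivCat V.left) ⟶ obj v (0 : P.obj (op V))
  μ {V : Over S} (v : V ⟶ T) {p q r : P.obj (op V)} (h : p + q = r) :
    obj v p ⊗ obj v q ⟶ obj v r
  ε_res {V' V : Over S} (g : V' ⟶ V) {v : V ⟶ T} {v' : V' ⟶ T} (hv : g ≫ v = v') :
    (DivCat.pull g.left).map (ε v) ≫ res g hv (map_zero (P.map g.op).hom) = unitRes g.left ≫ ε v'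
  μ_res {V' V : Over S} (g : V' ⟶ V) {v : V ⟶ T} {v' : V' ⟶ T} (hv : g ≫ v = v')
    {p q r : P.obj (op V)} {p' q' r' : P.obj (op V')} (hp : P.map g.op p = p')
    (hq : P.map g.op q = q') (hr : P.map g.op r = r') (h : p + q = r) (h' : p' + q' = r') :
    (DivCat.pull g.left).map (μ v h) ≫ res g hv hr = tensorRes (res g hv hp) (res g hv hq) ≫ μ v' h'
  assoc {V : Over S} (v : V ⟶ T) {p q r pq qr t : P.obj (op V)} (hpq : p + q = pq)
    (hqr : q + r = qr) (h : pq + r = t) (h' : p + qr = t) :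
    μ v hpq ▷ obj v r ≫ μ v h = (α_ _ _ _).hom ≫ obj v p ◁ μ v hqr ≫ μ v h'
  left_unit {V : Over S} (v : V ⟶ T) (p : P.obj (op V)) :
    ε v ▷ obj v p ≫ μ v (zero_add p) = (λ_ _).hom
  right_unit {V : Over S} (v : V ⟶ T) (p : P.obj (op V)) :
    obj v p ◁ ε v ≫ μ v (add_zero p) = (ρ_ _).hom
  symm {V : Over S} (v : V ⟶ T) {p q r : P.obj (op V)} (h : p + q = r) (h' : q + p = r) :
    (β_ _ _).hom ≫ μ v h' = μ v h

/-- A 1-cochain of `A|_T` with values in `Div|_T`: a morphism `ζ : A|_T ⟶ Div|_T` of fibered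
categories with a natural isomorphism `ζ(0) ≅ 𝟙`. -/
structure OneCochain (T : Over S) (A : AbPresheaf S) extends Family T (A ⋙ forget _) where
  zero {V : Over S} (v : V ⟶ T) : obj v (0 : A.obj (op V)) ⟶ 𝟙_ (DivCat V.left)
  zero_res {V' V : Over S} (g : V' ⟶ V) {v : V ⟶ T} {v' : V' ⟶ T} (hv : g ≫ v = v') :
    (DivCat.pull g.left).map (zero v) ≫ unitRes g.left = res g hv (map_zero_eq A g.op) ≫ zero v'

/-- The data of a 2-cocycle of `A|_T` with values in `Div|_T`: a morphism of fibered categories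
`f : A × A ⟶ Div` and isomorphisms `u : f(0,x) ≅ 𝟙`, `s : f(x,y) ≅ f(y,x)` and
`a : f(y,z) ⊗ f(x,y+z) ≅ f(x,y) ⊗ f(x+y,z)`. -/
structure CocycleData (T : Over S) (A : AbPresheaf S) extends Family T (pairs A) where
  u {V : Over S} (v : V ⟶ T) (x : A.obj (op V)) : obj v ((0 : A.obj (op V)), x) ⟶ 𝟙_ (DivCat V.left)
  s {V : Over S} (v : V ⟶ T) (x y : A.obj (op V)) : obj v (x, y) ⟶ obj v (y, x)
  a {V : Over S} (v : V ⟶ T) (x y z : A.obj (op V)) {xy yz : A.obj (op V)} (hxy : x + y = xy)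
    (hyz : y + z = yz) :
    obj v (y, z) ⊗ obj v (x, yz) ⟶ obj v (x, y) ⊗ obj v (xy, z)

/-- A 2-cocycle of `A|_T` with values in `Div|_T`: the isomorphisms `u`, `s`, `a` are natural and
satisfy coherence conditions analogous to those of a symmetric monoidal category. -/
structure TwoCocycle (T : Over S) (A : AbPresheaf S) extends CocycleData T A where
  u_res {V' V : Over S} (g : V' ⟶ V) {v : V ⟶ T} {v' : V' ⟶ T} (hv : g ≫ v = v')
    {x : A.obj (op V)} {x' : A.obj (op V')} (hx : A.map g.op x = x') :
    (DivCat.pull g.left).map (u v x) ≫ unitRes g.left =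
      res g hv (pairs_map A g.op (map_zero_eq A g.op) hx) ≫ u v' x'
  s_res {V' V : Over S} (g : V' ⟶ V) {v : V ⟶ T} {v' : V' ⟶ T} (hv : g ≫ v = v')
    {x y : A.obj (op V)} {x' y' : A.obj (op V')} (hx : A.map g.op x = x')
    (hy : A.map g.op y = y') :
    (DivCat.pull g.left).map (s v x y) ≫ res g hv (pairs_map A g.op hy hx) =
      res g hv (pairs_map A g.op hx hy) ≫ s v' x' y'
  a_res {V' V : Over S} (g : V' ⟶ V) {v : V ⟶ T} {v' : V' ⟶ T} (hv : g ≫ v = v')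
    {x y z xy yz : A.obj (op V)} {x' y' z' xy' yz' : A.obj (op V')} (hx : A.map g.op x = x')
    (hy : A.map g.op y = y') (hz : A.map g.op z = z') (hxy : A.map g.op xy = xy')
    (hyz : A.map g.op yz = yz') (h₁ : x + y = xy) (h₂ : y + z = yz) (h₁' : x' + y' = xy')
    (h₂' : y' + z' = yz') :
    (DivCat.pull g.left).map (a v x y z h₁ h₂) ≫
        tensorRes (res g hv (pairs_map A g.op hx hy)) (res g hv (pairs_map A g.op hxy hz)) =
      tensorRes (res g hv (pairs_map A g.op hy hz)) (res g hv (pairs_map A g.op hx hyz)) ≫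
        a v' x' y' z' h₁' h₂'
  s_zero {V : Over S} (v : V ⟶ T) : s v 0 0 ≫ u v 0 = u v 0
  s_s {V : Over S} (v : V ⟶ T) (x y : A.obj (op V)) : s v x y ≫ s v y x = 𝟙 _
  triangle {V : Over S} (v : V ⟶ T) (x z : A.obj (op V)) :
    a v x 0 z (add_zero x) (zero_add z) ≫ (s v x 0 ≫ u v x) ▷ obj v (x, z) =
      u v z ▷ obj v (x, z)
  pentagon {V : Over S} (v : V ⟶ T) (x y z w : A.obj (op V)) {xy yz zw xyz yzw : A.obj (op V)}
    (hxy : x + y = xy) (hyz : y + z = yz) (hzw : z + w = zw) (h₁ : xy + z = xyz)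
    (h₂ : x + yz = xyz) (h₃ : y + zw = yzw) (h₄ : yz + w = yzw) :
    a v y z w hyz hzw ▷ obj v (x, yzw) ≫ (α_ _ _ _).hom ≫
        obj v (y, z) ◁ a v x yz w h₂ h₄ ≫ (α_ _ _ _).inv =
      ((α_ _ _ _).hom ≫ obj v (z, w) ◁ a v x y zw hxy h₃ ≫ (α_ _ _ _).inv ≫
          (β_ _ _).hom ▷ obj v (xy, zw)) ≫
        ((α_ _ _ _).hom ≫ obj v (x, y) ◁ a v xy z w h₁ hzw ≫ (α_ _ _ _).inv) ≫
        inv (a v x y z hxy hyz) ▷ obj v (xyz, w)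
  hexagon {V : Over S} (v : V ⟶ T) (x y z : A.obj (op V)) {xy yz xz : A.obj (op V)}
    (hxy : x + y = xy) (hyx : y + x = xy) (hyz : y + z = yz) (hxz : x + z = xz)
    (hzx : z + x = xz) :
    a v x y z hxy hyz ≫ s v x y ▷ obj v (xy, z) ≫ inv (a v y x z hyx hxz) =
      obj v (y, z) ◁ s v x yz ≫ inv (a v y z x hyz hzx) ≫ s v z x ▷ obj v (y, xz)

/-- A natural isomorphism `f ⟶ f'` which commutes with `u`, `s` and `a`. -/
structure CocycleData.Hom {T : Over S} {A : AbPresheaf S} (f f' : CocycleData T A) where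
  app {V : Over S} (v : V ⟶ T) (x y : A.obj (op V)) : f.obj v (x, y) ⟶ f'.obj v (x, y)
  naturality {V' V : Over S} (g : V' ⟶ V) {v : V ⟶ T} {v' : V' ⟶ T} (hv : g ≫ v = v')
    {x y : A.obj (op V)} {x' y' : A.obj (op V')} (hx : A.map g.op x = x')
    (hy : A.map g.op y = y') :
    (DivCat.pull g.left).map (app v x y) ≫ f'.res g hv (pairs_map A g.op hx hy) =
      f.res g hv (pairs_map A g.op hx hy) ≫ app v' x' y'
  u {V : Over S} (v : V ⟶ T) (x : A.obj (op V)) : app v 0 x ≫ f'.u v x = f.u v x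
  s {V : Over S} (v : V ⟶ T) (x y : A.obj (op V)) :
    app v x y ≫ f'.s v x y = f.s v x y ≫ app v y x
  a {V : Over S} (v : V ⟶ T) (x y z : A.obj (op V)) {xy yz : A.obj (op V)} (hxy : x + y = xy)
    (hyz : y + z = yz) :
    (app v y z ⊗ₘ app v x yz) ≫ f'.a v x y z hxy hyz =
      f.a v x y z hxy hyz ≫ (app v x y ⊗ₘ app v xy z)

/-- The 2-cocycle `L ∘ e` defined by a symmetric monoidal functor `L : P_A ⟶ Div`: it is
`f(x,y) = L(e(x,y))`, where `u`, `s`, `a` are induced by the relations `e(0,x) = 0`, `e(x,y) = e(y,x)`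
and `e(y,z) + e(x,y+z) = e(x,y) + e(x+y,z)` in `P_A`. -/
noncomputable def SymMonFunctor.toCocycleData {T : Over S} {A : AbPresheaf S}
    (L : SymMonFunctor T (universalSheaf A)) : CocycleData T A where
  obj v xy := L.obj v (universalCocycle A xy.1 xy.2)
  res {V' V} g {v v'} hv {xy xy'} hx := L.res g hv
    (universalCocycle_map A g (congrArg Prod.fst hx) (congrArg Prod.snd hx))
  res_id v _ _ := L.res_id v _ _
  res_comp := by intros; exact L.res_comp ..
  u v x := L.cast v (IsTwoCocycle.zero (c := universalCocycle A) x) ≫ inv (L.ε v)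
  s v x y := L.cast v (IsTwoCocycle.symm (c := universalCocycle A) x y)
  a {V} v x y z xy yz hxy hyz :=
    L.μ v (p := universalCocycle A y z) (q := universalCocycle A x yz) rfl ≫
      inv (L.μ v (p := universalCocycle A x y) (q := universalCocycle A xy z) (by
        rw [← hxy, ← hyz]
        exact IsTwoCocycle.assoc (c := universalCocycle A) x y z))

end Families

section FiberedCategories

variable {S : Scheme.{u}}

/-- The objects `(T, ζ, κ)` of `S_{A,f}`: an `S`-scheme `T`, a 1-cochain `ζ` of `A|_T` and a natural
isomorphism `κ : ζ(x) ⊗ ζ(y) ≅ f(x,y) ⊗ ζ(x+y)` which commutes with the isomorphisms `u`, `s`, `a`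
of the 2-cocycle `f`. The restriction of `f` to `T` is `f` evaluated at structure morphisms to `S`. -/
structure CochainWithBoundary {A : AbPresheaf S} (f : TwoCocycle (base S) A) where
  T : Over S
  ζ : OneCochain T A
  κ {V : Over S} (v : V ⟶ T) (x y : A.obj (op V)) {xy : A.obj (op V)} (h : x + y = xy) :
    ζ.obj v x ⊗ ζ.obj v y ⟶ f.obj (toBase V) (x, y) ⊗ ζ.obj v xy
  κ_res {V' V : Over S} (g : V' ⟶ V) {v : V ⟶ T} {v' : V' ⟶ T} (hv : g ≫ v = v')
    {x y xy : A.obj (op V)} {x' y' xy' : A.obj (op V')} (hx : A.map g.op x = x')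
    (hy : A.map g.op y = y') (hxy : A.map g.op xy = xy') (h : x + y = xy) (h' : x' + y' = xy') :
    (DivCat.pull g.left).map (κ v x y h) ≫
        tensorRes (f.res g (comp_toBase g) (pairs_map A g.op hx hy)) (ζ.res g hv hxy) =
      tensorRes (ζ.res g hv hx) (ζ.res g hv hy) ≫ κ v' x' y' h'
  κ_u {V : Over S} (v : V ⟶ T) (x : A.obj (op V)) :
    κ v 0 x (zero_add x) ≫ f.u (toBase V) x ▷ ζ.obj v x = ζ.zero v ▷ ζ.obj v x
  κ_s {V : Over S} (v : V ⟶ T) (x y : A.obj (op V)) {xy : A.obj (op V)} (h : x + y = xy)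
    (h' : y + x = xy) :
    κ v x y h ≫ f.s (toBase V) x y ▷ ζ.obj v xy = (β_ _ _).hom ≫ κ v y x h'
  κ_a {V : Over S} (v : V ⟶ T) (x y z : A.obj (op V)) {xy yz xyz : A.obj (op V)}
    (hxy : x + y = xy) (hyz : y + z = yz) (h : xy + z = xyz) (h' : x + yz = xyz) :
    κ v x y hxy ▷ ζ.obj v z ≫ (α_ _ _ _).hom ≫
        f.obj (toBase V) (x, y) ◁ κ v xy z h ≫ (α_ _ _ _).inv =
      (α_ _ _ _).hom ≫ ζ.obj v x ◁ κ v y z hyz ≫ (α_ _ _ _).inv ≫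
        (β_ _ _).hom ▷ ζ.obj v yz ≫ (α_ _ _ _).hom ≫
        f.obj (toBase V) (y, z) ◁ κ v x yz h' ≫ (α_ _ _ _).inv ≫
        f.a (toBase V) x y z hxy hyz ▷ ζ.obj v xyz

namespace CochainWithBoundary

variable {A : AbPresheaf S} {f : TwoCocycle (base S) A}

/-- Morphisms `(T', ζ', κ') ⟶ (T, ζ, κ)`: a morphism of `S`-schemes `φ : T' ⟶ T` and a natural
isomorphism `η : φ^* ζ ⟶ ζ'` compatible with `κ` and `κ'`. -/
structure Hom (X' X : CochainWithBoundary f) where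
  φ : X'.T ⟶ X.T
  η : Family.Hom φ X.ζ.toFamily X'.ζ.toFamily
  κ_η {V : Over S} {v : V ⟶ X'.T} {w : V ⟶ X.T} (h : v ≫ φ = w) (x y : A.obj (op V))
    {xy : A.obj (op V)} (hxy : x + y = xy) :
    X.κ w x y hxy ≫ f.obj (toBase V) (x, y) ◁ η.app h xy =
      (η.app h x ⊗ₘ η.app h y) ≫ X'.κ v x y hxy

lemma Hom.ext_app {X' X : CochainWithBoundary f} {a b : Hom X' X} (hφ : a.φ = b.φ)
    (h : ∀ {V : Over S} {v : V ⟶ X'.T} {w : V ⟶ X.T} (ha : v ≫ a.φ = w) (hb : v ≫ b.φ = w)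
      (x : A.obj (op V)), a.η.app ha x = b.η.app hb x) : a = b := by
  obtain ⟨φ, η, _⟩ := a
  obtain ⟨φ', η', _⟩ := b
  obtain rfl : φ = φ' := hφ
  obtain rfl : η = η' := by
    ext V v w hv x : 6
    exact h hv hv x
  rfl

noncomputable def Hom.id (X : CochainWithBoundary f) : Hom X X where
  φ := 𝟙 _
  η := Family.Hom.id _
  κ_η := by
    intro V v w h x y xy hxy
    obtain rfl : v = w := by rw [← h, Category.comp_id]
    simp [Family.Hom.id]

noncomputable def Hom.comp {X'' X' X : CochainWithBoundary f} (b : Hom X'' X') (a : Hom X' X) :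
    Hom X'' X where
  φ := b.φ ≫ a.φ
  η := b.η.comp a.η
  κ_η := by
    intro V v w h x y xy hxy
    simp only [Family.Hom.comp]
    rw [MonoidalCategory.whiskerLeft_comp, ← Category.assoc, a.κ_η, Category.assoc, b.κ_η,
      MonoidalCategory.tensorHom_comp_tensorHom_assoc]

noncomputable instance : Category (CochainWithBoundary f) where
  Hom := Hom
  id := Hom.id
  comp := Hom.comp
  id_comp a := Hom.ext_app (Category.id_comp _) (fun _ _ _ =>
    a.η.app_congr _ _ (Category.comp_id _) _)
  comp_id a := Hom.ext_app (Category.comp_id _) (fun _ hb _ =>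
    a.η.app_congr_left _ _ hb.symm _)
  assoc {X₃ X₂ X₁ X₀} c b a := by
    refine Hom.ext_app (a := Hom.comp (Hom.comp c b) a) (b := Hom.comp c (Hom.comp b a))
      (Category.assoc c.φ b.φ a.φ) ?_
    intro V v w ha hb x
    exact Family.Hom.comp_app_assoc (Hom.η c) (Hom.η b) (Hom.η a) ha hb x

/-- The projection `(T, ζ, κ) ↦ T`. -/
noncomputable def projection (f : TwoCocycle (base S) A) : CochainWithBoundary f ⥤ Over S where
  obj X := X.T
  map a := Hom.φ a

/-- The category `S_{A,f}` over `Sch/S`. -/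
noncomputable def basedCategory (f : TwoCocycle (base S) A) : BasedCategory (Over S) where
  obj := CochainWithBoundary f
  p := projection f

end CochainWithBoundary

/-- The objects `(T, E, α)` of the root stack of `j : P ⟶ Q` and `L : P ⟶ Div`: an `S`-scheme `T`, a
symmetric monoidal functor `E : Q|_T ⟶ Div|_T`, and an isomorphism of symmetric monoidal functors
`α : L|_T ≅ E ∘ j|_T`. -/
structure RootObject {P Q : MonPresheaf S} (j : P ⟶ Q) (L : SymMonFunctor (base S) P) where
  T : Over S
  E : SymMonFunctor T Q
  α {V : Over S} (v : V ⟶ T) (p : P.obj (op V)) :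
    L.obj (toBase V) p ⟶ E.obj v (j.app (op V) p)
  α_res {V' V : Over S} (g : V' ⟶ V) {v : V ⟶ T} {v' : V' ⟶ T} (hv : g ≫ v = v')
    {p : P.obj (op V)} {p' : P.obj (op V')} (hp : P.map g.op p = p')
    (hq : Q.map g.op (j.app (op V) p) = j.app (op V') p') :
    (DivCat.pull g.left).map (α v p) ≫ E.res g hv hq = L.res g (comp_toBase g) hp ≫ α v' p'
  α_ε {V : Over S} (v : V ⟶ T) :
    L.ε (toBase V) ≫ α v 0 = E.ε v ≫ E.cast v (map_zero (j.app (op V)).hom).symm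
  α_μ {V : Over S} (v : V ⟶ T) {p q r : P.obj (op V)} (h : p + q = r)
    (h' : j.app (op V) p + j.app (op V) q = j.app (op V) r) :
    L.μ (toBase V) h ≫ α v r = (α v p ⊗ₘ α v q) ≫ E.μ v h'

namespace RootObject

variable {P Q : MonPresheaf S} {j : P ⟶ Q} {L : SymMonFunctor (base S) P}

/-- Morphisms `(T', E', α') ⟶ (T, E, α)`: a morphism of `S`-schemes `φ : T' ⟶ T` and an isomorphism of
symmetric monoidal functors `φ^* E ⟶ E'` compatible with `α` and `α'`. -/
structure Hom (X' X : RootObject j L) where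
  φ : X'.T ⟶ X.T
  θ : Family.Hom φ X.E.toFamily X'.E.toFamily
  θ_ε {V : Over S} {v : V ⟶ X'.T} {w : V ⟶ X.T} (h : v ≫ φ = w) :
    X.E.ε w ≫ θ.app h (0 : Q.obj (op V)) = X'.E.ε v
  θ_μ {V : Over S} {v : V ⟶ X'.T} {w : V ⟶ X.T} (h : v ≫ φ = w) {p q r : Q.obj (op V)}
    (hr : p + q = r) :
    X.E.μ w hr ≫ θ.app h r = (θ.app h p ⊗ₘ θ.app h q) ≫ X'.E.μ v hr
  θ_α {V : Over S} {v : V ⟶ X'.T} {w : V ⟶ X.T} (h : v ≫ φ = w) (p : P.obj (op V)) :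
    X.α w p ≫ θ.app h (j.app (op V) p) = X'.α v p

lemma Hom.ext_app {X' X : RootObject j L} {a b : Hom X' X} (hφ : a.φ = b.φ)
    (h : ∀ {V : Over S} {v : V ⟶ X'.T} {w : V ⟶ X.T} (ha : v ≫ a.φ = w) (hb : v ≫ b.φ = w)
      (q : Q.obj (op V)), a.θ.app ha q = b.θ.app hb q) : a = b := by
  obtain ⟨φ, θ, _, _, _⟩ := a
  obtain ⟨φ', θ', _, _, _⟩ := b
  obtain rfl : φ = φ' := hφ
  obtain rfl : θ = θ' := by
    ext V v w hv x : 6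
    exact h hv hv x
  rfl

noncomputable def Hom.id (X : RootObject j L) : Hom X X where
  φ := 𝟙 _
  θ := Family.Hom.id _
  θ_ε := by
    intro V v w h
    obtain rfl : v = w := by rw [← h, Category.comp_id]
    simp [Family.Hom.id]
  θ_μ := by
    intro V v w h p q r hr
    obtain rfl : v = w := by rw [← h, Category.comp_id]
    simp [Family.Hom.id]
  θ_α := by
    intro V v w h p
    obtain rfl : v = w := by rw [← h, Category.comp_id]
    simp [Family.Hom.id]

noncomputable def Hom.comp {X'' X' X : RootObject j L} (b : Hom X'' X') (a : Hom X' X) :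
    Hom X'' X where
  φ := b.φ ≫ a.φ
  θ := b.θ.comp a.θ
  θ_ε := by
    intro V v w h
    simp only [Family.Hom.comp]
    rw [← Category.assoc, a.θ_ε, b.θ_ε]
  θ_μ := by
    intro V v w h p q r hr
    simp only [Family.Hom.comp]
    rw [← Category.assoc, a.θ_μ, Category.assoc, b.θ_μ,
      MonoidalCategory.tensorHom_comp_tensorHom_assoc]
  θ_α := by
    intro V v w h p
    simp only [Family.Hom.comp]
    rw [← Category.assoc, a.θ_α, b.θ_α]

noncomputable instance : Category (RootObject j L) where
  Hom := Hom
  id := Hom.id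
  comp := Hom.comp
  id_comp a := Hom.ext_app (Category.id_comp _) (fun _ _ _ =>
    a.θ.app_congr _ _ (Category.comp_id _) _)
  comp_id a := Hom.ext_app (Category.comp_id _) (fun _ hb _ =>
    a.θ.app_congr_left _ _ hb.symm _)
  assoc {X₃ X₂ X₁ X₀} c b a := by
    refine Hom.ext_app (a := Hom.comp (Hom.comp c b) a) (b := Hom.comp c (Hom.comp b a))
      (Category.assoc c.φ b.φ a.φ) ?_
    intro V v w ha hb x
    exact Family.Hom.comp_app_assoc (Hom.θ c) (Hom.θ b) (Hom.θ a) ha hb x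

/-- The projection `(T, E, α) ↦ T`. -/
noncomputable def projection (j : P ⟶ Q) (L : SymMonFunctor (base S) P) :
    RootObject j L ⥤ Over S where
  obj X := X.T
  map a := Hom.φ a

/-- The root stack `S_{P,Q,L}`, as a category over `Sch/S`. -/
noncomputable def basedCategory (j : P ⟶ Q) (L : SymMonFunctor (base S) P) :
    BasedCategory (Over S) where
  obj := RootObject j L
  p := projection j L

end RootObject

end FiberedCategories

section Comparison

variable {S : Scheme.{u}}

lemma universalExtension_map (A : AbPresheaf S) {V' V : Over S} (g : V' ⟶ V)
    {p : (universalSheaf A).obj (op V)} {p' : (universalSheaf A).obj (op V')}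
    {x : A.obj (op V)} {x' : A.obj (op V')} (hp : (universalSheaf A).map g.op p = p')
    (hx : A.map g.op x = x') :
    (universalExtension A).map g.op (⟨p, x⟩ : Extension (universalCocycle A (V := V))) =
      (⟨p', x'⟩ : Extension (universalCocycle A (V := V'))) :=
  Extension.ext hp hx

lemma universalExtension_add (A : AbPresheaf S) {V : Over S}
    {p q r t : (universalSheaf A).obj (op V)} {x y z : A.obj (op V)} (hr : p + q = r)
    (ht : r + universalCocycle A x y = t) (hz : x + y = z) :
    (⟨p, x⟩ + ⟨q, y⟩ : Extension (universalCocycle A (V := V))) = ⟨t, z⟩ := by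
  subst hr ht hz; rfl

/-- The root stack of `P_A ⟶ Q_A` and `L : P_A ⟶ Div`. -/
noncomputable abbrev universalRootStack (A : AbPresheaf S)
    (L : SymMonFunctor (base S) (universalSheaf A)) : BasedCategory (Over S) :=
  RootObject.basedCategory (universalInclusion A) L

/-- A functor `F` from `S_{A,f}` to the root stack of `P_A ⟶ Q_A` and `L` is the canonical one: there are
natural isomorphisms `L(p) ⊗ ζ(x) ≅ E(p, x)`, where `F(T, ζ, κ) = (T, E, α)`, under which
the comparison isomorphisms of `E` are given by
`L(p) ⊗ ζ(x) ⊗ L(q) ⊗ ζ(y) ≅ L(p + q) ⊗ f(x,y) ⊗ ζ(x + y) ≅ L(p + q + e(x,y)) ⊗ ζ(x + y)`,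
the isomorphism `α` is `L(p) ≅ L(p) ⊗ ζ(0)`, and `F(φ, η)` is `id ⊗ η`.
The morphism `w : V ⟶ T_{F(X)}` corresponds to `v : V ⟶ T_X` under the equality `T_{F(X)} = T_X`. -/
structure CanonicalComparison {A : AbPresheaf S} (f : TwoCocycle (base S) A)
    (L : SymMonFunctor (base S) (universalSheaf A))
    (ψ : CocycleData.Hom f.toCocycleData L.toCocycleData)
    (F : BasedFunctor (CochainWithBoundary.basedCategory f) (universalRootStack A L)) where
  app (X : CochainWithBoundary f) {V : Over S} {v : V ⟶ X.T} {w : V ⟶ RootObject.T (F.obj X)}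
    (h : w ≫ eqToHom (F.w_obj X) = v) (p : (universalSheaf A).obj (op V)) (x : A.obj (op V)) :
    L.obj (toBase V) p ⊗ X.ζ.obj v x ⟶
      (RootObject.E (F.obj X)).obj w (⟨p, x⟩ : Extension (universalCocycle A (V := V)))
  res (X : CochainWithBoundary f) {V' V : Over S} (g : V' ⟶ V) {v : V ⟶ X.T} {v' : V' ⟶ X.T}
    {w : V ⟶ RootObject.T (F.obj X)} {w' : V' ⟶ RootObject.T (F.obj X)}
    (h : w ≫ eqToHom (F.w_obj X) = v) (h' : w' ≫ eqToHom (F.w_obj X) = v')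
    (hv : g ≫ v = v') (hw : g ≫ w = w')
    {p : (universalSheaf A).obj (op V)} {p' : (universalSheaf A).obj (op V')}
    {x : A.obj (op V)} {x' : A.obj (op V')} (hp : (universalSheaf A).map g.op p = p')
    (hx : A.map g.op x = x') :
    (DivCat.pull g.left).map (app X h p x) ≫
        (RootObject.E (F.obj X)).res g hw (universalExtension_map A g hp hx) =
      tensorRes (L.res g (comp_toBase g) hp) (X.ζ.res g hv hx) ≫ app X h' p' x'
  μ (X : CochainWithBoundary f) {V : Over S} {v : V ⟶ X.T} {w : V ⟶ RootObject.T (F.obj X)}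
    (h : w ≫ eqToHom (F.w_obj X) = v) {p q r t : (universalSheaf A).obj (op V)}
    {x y z : A.obj (op V)} (hr : p + q = r) (ht : r + universalCocycle A x y = t)
    (hz : x + y = z) :
    (app X h p x ⊗ₘ app X h q y) ≫
        (RootObject.E (F.obj X)).μ w (universalExtension_add A hr ht hz) =
      tensorμ (L.obj (toBase V) p) (X.ζ.obj v x) (L.obj (toBase V) q) (X.ζ.obj v y) ≫
        (L.μ (toBase V) hr ⊗ₘ (X.κ v x y hz ≫ ψ.app (toBase V) x y ▷ X.ζ.obj v z)) ≫
        (α_ _ _ _).inv ≫ L.μ (toBase V) ht ▷ X.ζ.obj v z ≫ app X h t z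
  α (X : CochainWithBoundary f) {V : Over S} {v : V ⟶ X.T} {w : V ⟶ RootObject.T (F.obj X)}
    (h : w ≫ eqToHom (F.w_obj X) = v) (p : (universalSheaf A).obj (op V)) :
    app X h p 0 =
      L.obj (toBase V) p ◁ X.ζ.zero v ≫ (ρ_ _).hom ≫ RootObject.α (F.obj X) w p
  map {X' X : CochainWithBoundary f} (m : X' ⟶ X) {V : Over S} {v' : V ⟶ X'.T} {v : V ⟶ X.T}
    {w' : V ⟶ RootObject.T (F.obj X')} {w : V ⟶ RootObject.T (F.obj X)}
    (h' : w' ≫ eqToHom (F.w_obj X') = v') (h : w ≫ eqToHom (F.w_obj X) = v)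
    (hv : v' ≫ CochainWithBoundary.Hom.φ m = v) (hw : w' ≫ RootObject.Hom.φ (F.map m) = w)
    (p : (universalSheaf A).obj (op V)) (x : A.obj (op V)) :
    app X h p x ≫ (RootObject.Hom.θ (F.map m)).app hw
        (⟨p, x⟩ : Extension (universalCocycle A (V := V))) =
      L.obj (toBase V) p ◁ (CochainWithBoundary.Hom.η m).app hv x ≫ app X' h' p x

end Comparison

end StackyCover

open StackyCover

/-!
The monoidal functor `L` is given on the sheaf `P_A` itself, so the comparison needs no descent: it
is an identity between symmetric monoidal structures in each groupoid `Div(V)`, natural in `V`.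

Fix `V`. A symmetric monoidal functor from a discrete monoid is a graded commutative monoid
(`GradedCommMon`). Composing `κ` with `ψ` turns a cochain into a multiplication
`Z(x) ⊗ Z(y) ⟶ L(c(x,y)) ⊗ Z(x+y)`, where `c` is the universal 2-cocycle, and the conditions on `κ`
with respect to `u`, `s` and `a` become the unit, commutative and associative laws of a
`TwistedCommMon`; this translation is an equivalence (`GradedCommMon.one_mul_iff`,
`GradedCommMon.mul_comm_iff`, `GradedCommMon.mul_assoc_iff`).

Such a `Z` defines the commutative monoid `L(p) ⊗ Z(x)` graded by the extension of `A` by `P` with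
cocycle `c` (`TwistedCommMon.ext`), together with the inclusion of the coefficients `L`. Conversely
let `E` be graded by the extension, with a morphism from `L` to its restriction to `P`. Then `L`
acts on `E` (`CoeffHom.scal`), the isomorphisms `L(c(x,y)) ⊗ E(0, x+y) ≅ E(c(x,y), x+y)` make the
objects `E(0, x)` a twisted commutative monoid (`CoeffHom.twisted`), and the action
`L(p) ⊗ E(0, x) ≅ E(p, x)` is multiplicative (`CoeffHom.counit_μ`). This gives
essential surjectivity. For full faithfulness, a multiplicative family of morphisms
`L(p) ⊗ Z(x) ⟶ L(p) ⊗ Z'(x)` which respects the coefficients is `L`-linear, hence of the form `id ⊗ η`, with `η` read off at `p = 0`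
(`TwistedCommMon.eq_whiskerLeft_descend`, `TwistedCommMon.descend_mul`). A morphism of cochains
respects `ζ(0) ≅ 𝟙` automatically, because tensoring with an invertible object is faithful
(`CochainWithBoundary.Hom.η_zero`).

The compatibility of all these constructions with restriction along `V' ⟶ V` is expressed by
commutative squares over the pullback functor (`ResSquare`). They can be composed and tensored
because that functor is a braided monoidal functor and the isomorphisms between iterated pullbacks
are monoidal. Both categories are fibered since their objects can be pulled back and, all morphisms
of `Div(V)` being invertible, all their morphisms are cartesian. A fully faithful functor over the
base which is essentially surjective on fibers is an equivalence (`exists_equivalence_hom_eq`).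
-/

namespace StackyCover

/-! ### Coherence in symmetric monoidal categories -/

section Coherence

variable {C : Type u₁} [Category.{v₁} C] [MonoidalCategory C] [SymmetricCategory C]

lemma tensorμ_unit_second (X Y Z : C) :
    (ρ_ X).inv ▷ (Y ⊗ Z) ≫ tensorμ X (𝟙_ C) Y Z ≫ (X ⊗ Y) ◁ (λ_ Z).hom = (α_ X Y Z).inv := by
  simp only [tensorμ, braiding_tensorUnit_left]
  monoidal

lemma tensorμ_unit_first_third (X Y : C) :
    ((λ_ X).inv ⊗ₘ (λ_ Y).inv) ≫ tensorμ (𝟙_ C) X (𝟙_ C) Y ≫ (λ_ (𝟙_ C)).hom ▷ (X ⊗ Y) =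
      (λ_ (X ⊗ Y)).inv := by
  simp only [tensorμ, braiding_tensorUnit_right]
  monoidal

lemma tensorμ_braiding (X Y Z W : C) :
    (β_ (X ⊗ Y) (Z ⊗ W)).hom ≫ tensorμ Z W X Y =
      tensorμ X Y Z W ≫ ((β_ X Z).hom ⊗ₘ (β_ Y W).hom) := by
  have h : (β_ W X).hom = (β_ X W).inv := SymmetricCategory.braiding_swap_eq_inv_braiding _ _
  have h' : (β_ Y Z).hom = (β_ Z Y).inv := SymmetricCategory.braiding_swap_eq_inv_braiding _ _
  simp only [tensorμ, h, h', BraidedCategory.braiding_tensor_left_hom,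
    BraidedCategory.braiding_tensor_right_hom]
  calc
    _ = 𝟙 _ ⊗≫ X ◁ (β_ Z Y).inv ▷ W ⊗≫ (β_ X Z).hom ▷ (Y ⊗ W) ⊗≫ Z ◁ X ◁ (β_ Y W).hom ⊗≫
        Z ◁ ((β_ X W).hom ≫ (β_ X W).inv) ▷ Y ⊗≫ 𝟙 _ := by monoidal
    _ = _ := by rw [Iso.hom_inv_id, MonoidalCategory.tensorHom_def]; monoidal

/-- Interchange of the last two factors of a triple tensor product. -/
def swapRight (X Y Z : C) : (X ⊗ Y) ⊗ Z ⟶ (X ⊗ Z) ⊗ Y :=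
  (α_ X Y Z).hom ≫ X ◁ (β_ Y Z).hom ≫ (α_ X Z Y).inv

/-- Interchange of the first two factors of a triple tensor product. -/
def swapLeft (X Y Z : C) : X ⊗ (Y ⊗ Z) ⟶ Y ⊗ (X ⊗ Z) :=
  (α_ X Y Z).inv ≫ (β_ X Y).hom ▷ Z ≫ (α_ Y X Z).hom

lemma swapLeft_natural_middle (X : C) {Y Y' : C} (f : Y ⟶ Y') (Z : C) :
    X ◁ f ▷ Z ≫ swapLeft X Y' Z = swapLeft X Y Z ≫ f ▷ (X ⊗ Z) := by
  unfold swapLeft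
  rw [associator_inv_naturality_middle_assoc, ← comp_whiskerRight_assoc,
    BraidedCategory.braiding_naturality_right, comp_whiskerRight_assoc,
    associator_naturality_left, Category.assoc, Category.assoc]

lemma tensorμ_assoc_left (X Y Z R W : C) :
    (α_ X Y Z).inv ▷ (R ⊗ W) ≫ tensorμ (X ⊗ Y) Z R W =
      tensorμ X (Y ⊗ Z) R W ≫ (X ⊗ R) ◁ (α_ Y Z W).hom ≫ (α_ (X ⊗ R) Y (Z ⊗ W)).inv ≫
        swapRight X R Y ▷ (Z ⊗ W) := by
  have h : (β_ R Y).hom = (β_ Y R).inv := SymmetricCategory.braiding_swap_eq_inv_braiding _ _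
  simp only [tensorμ, swapRight, h, BraidedCategory.braiding_tensor_left_hom]
  calc
    _ = 𝟙 _ ⊗≫ (X ⊗ Y) ◁ (β_ Z R).hom ▷ W ⊗≫ X ◁ ((β_ Y R).hom ≫ (β_ Y R).inv) ▷ (Z ⊗ W) ⊗≫
        𝟙 _ := by
      rw [Iso.hom_inv_id]; monoidal
    _ = _ := by monoidal

lemma tensorμ_assoc_right (P X R Y Z : C) :
    (P ⊗ X) ◁ (α_ R Y Z).inv ≫ tensorμ P X (R ⊗ Y) Z =
      tensorμ P X R (Y ⊗ Z) ≫ (P ⊗ R) ◁ swapLeft X Y Z ≫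
        (α_ (P ⊗ R) Y (X ⊗ Z)).inv ≫ (α_ P R Y).hom ▷ (X ⊗ Z) := by
  simp only [tensorμ, swapLeft, BraidedCategory.braiding_tensor_right_hom]
  monoidal

end Coherence

lemma comp_inv_whiskerRight {C : Type u₁} [Category.{v₁} C] [MonoidalCategory C]
    [IsGroupoid C] {X F G W : C} (m : X ⟶ G ⊗ W) (ψ : F ⟶ G) :
    (m ≫ inv ψ ▷ W) ≫ ψ ▷ W = m := by
  rw [Category.assoc, ← comp_whiskerRight, IsIso.inv_hom_id, id_whiskerRight, Category.comp_id]

/-- Tensoring with an invertible object is faithful. -/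
lemma eq_of_whiskerRight_eq {D : Type u₁} [Category.{v₁} D] [MonoidalCategory D] {X Y Z W : D}
    (e : Z ⊗ W ≅ 𝟙_ D) {f g : X ⟶ Y} (h : f ▷ Z = g ▷ Z) : f = g := by
  have h₁ : f ▷ (Z ⊗ W) = g ▷ (Z ⊗ W) := by simp [whiskerRight_tensor, h]
  have h₂ : f ▷ 𝟙_ D = g ▷ 𝟙_ D := by
    rw [← cancel_epi (X ◁ e.hom), whisker_exchange, whisker_exchange, h₁]
  simpa using h₂

lemma PointedInvertible.eq_of_whiskerRight_eq {D : Type u₁} [Category.{v₁} D]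
    [MonoidalCategory D] [SymmetricCategory D] {X Y : PointedInvertible D}
    (Z : PointedInvertible D) {f g : X ⟶ Y} (h : f ▷ Z = g ▷ Z) : f = g := by
  obtain ⟨W, ⟨e⟩⟩ := Z.invertible
  refine hom_ext (StackyCover.eq_of_whiskerRight_eq e ?_)
  rw [← whiskerRight_hom, ← whiskerRight_hom, h]

/-! ### Graded commutative monoids -/

/-- A commutative monoid in `C` graded by the commutative monoid `M`, that is, a lax symmetric
monoidal functor from `M`, as a discrete category, to `C`. Equalities in `M` are arguments, in order
to avoid transports. -/
structure GradedCommMon (M : Type u₂) [AddCommMonoid M] (C : Type u₁) [Category.{v₁} C]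
    [MonoidalCategory C] [SymmetricCategory C] where
  obj : M → C
  ε : 𝟙_ C ⟶ obj 0
  μ {p q r : M} (h : p + q = r) : obj p ⊗ obj q ⟶ obj r
  assoc {p q r pq qr t : M} (hpq : p + q = pq) (hqr : q + r = qr) (h : pq + r = t)
    (h' : p + qr = t) :
    μ hpq ▷ obj r ≫ μ h = (α_ _ _ _).hom ≫ obj p ◁ μ hqr ≫ μ h'
  left_unit (p : M) : ε ▷ obj p ≫ μ (zero_add p) = (λ_ _).hom
  symm {p q r : M} (h : p + q = r) (h' : q + p = r) : (β_ _ _).hom ≫ μ h' = μ h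

namespace GradedCommMon

variable {M : Type u₂} [AddCommMonoid M] {C : Type u₁} [Category.{v₁} C]
    [MonoidalCategory C] [SymmetricCategory C] (L : GradedCommMon M C)

lemma right_unit (p : M) : L.obj p ◁ L.ε ≫ L.μ (add_zero p) = (ρ_ _).hom := by
  rw [← L.symm (add_zero p) (zero_add p), BraidedCategory.braiding_naturality_right_assoc,
    L.left_unit, braiding_leftUnitor]

/-- The identification of `L(p)` and `L(q)` for `p = q`. -/
def cast {p q : M} (h : p = q) : L.obj p ⟶ L.obj q := eqToHom (congrArg L.obj h)

@[simp]
lemma cast_rfl (p : M) : L.cast (rfl : p = p) = 𝟙 _ := rfl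

/-- The unit `𝟙 ⟶ L(p)` for `p = 0`. -/
def unit {p : M} (h : 0 = p) : 𝟙_ C ⟶ L.obj p := L.ε ≫ L.cast h

lemma unit_μ {p q : M} (h : 0 = q) (h' : q + p = p) :
    L.unit h ▷ L.obj p ≫ L.μ h' = (λ_ _).hom := by
  subst h; simp [unit, L.left_unit]

lemma μ_unit {p q : M} (h : 0 = q) (h' : p + q = p) :
    L.obj p ◁ L.unit h ≫ L.μ h' = (ρ_ _).hom := by
  subst h; simp [unit, L.right_unit]

lemma swapRight_μ {p q r pq pr t : M} (hpq : p + q = pq) (hpr : p + r = pr) (h : pq + r = t)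
    (h' : pr + q = t) :
    swapRight (L.obj p) (L.obj q) (L.obj r) ≫ L.μ hpr ▷ L.obj q ≫ L.μ h' =
      L.μ hpq ▷ L.obj r ≫ L.μ h := by
  have e : p + (q + r) = t := by rw [← add_assoc, hpq, h]
  rw [L.assoc hpq rfl h e, L.assoc hpr (add_comm r q) h' e]
  simp only [swapRight, Category.assoc, Iso.inv_hom_id_assoc]
  rw [← MonoidalCategory.whiskerLeft_comp_assoc, L.symm rfl]

lemma swapLeft_μ {p q r pr qr t : M} (hpr : p + r = pr) (hqr : q + r = qr) (h : p + qr = t)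
    (h' : q + pr = t) :
    swapLeft (L.obj p) (L.obj q) (L.obj r) ≫ L.obj q ◁ L.μ hpr ≫ L.μ h' =
      L.obj p ◁ L.μ hqr ≫ L.μ h := by
  have e : q + p + r = t := by rw [add_assoc, hpr, h']
  have e1 := L.assoc (rfl : q + p = _) hpr e h'
  have e2 := L.assoc (add_comm p q) hqr e h
  simp only [swapLeft, Category.assoc]
  rw [← e1, ← comp_whiskerRight_assoc, L.symm (add_comm p q), e2, Iso.inv_hom_id_assoc]

/-- The interchange law. -/
lemma tensorμ_μ {p q r s pq rs pr qs t : M} (hpq : p + q = pq) (hrs : r + s = rs)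
    (hpr : p + r = pr) (hqs : q + s = qs) (h : pq + rs = t) (h' : pr + qs = t) :
    tensorμ (L.obj p) (L.obj q) (L.obj r) (L.obj s) ≫ (L.μ hpr ⊗ₘ L.μ hqs) ≫ L.μ h' =
      (L.μ hpq ⊗ₘ L.μ hrs) ≫ L.μ h := by
  have e : p + (q + rs) = t := by rw [← add_assoc, hpq, h]
  have e2 : r + qs = q + rs := by rw [← hqs, ← hrs]; abel
  have h1 := L.assoc hpq rfl h e
  have h2 := L.assoc hpr e2 h' e
  have h3 := L.swapLeft_μ hqs hrs (rfl : q + rs = _) e2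
  rw [tensorHom_def', tensorHom_def']
  simp only [Category.assoc]
  rw [h1, h2]
  simp only [swapLeft, Category.assoc] at h3
  simp only [tensorμ, Category.assoc]
  have h4 := congrArg (fun k => (α_ _ _ _).hom ≫ L.obj p ◁ k ≫ L.μ e) h3
  simp only [MonoidalCategory.whiskerLeft_comp, Category.assoc] at h4
  simpa using h4

/-- The morphism `L(p) ⊗ (L(q) ⊗ X) ⟶ L(p + q) ⊗ X`. -/
def act {p q r : M} (h : p + q = r) (X : C) : L.obj p ⊗ (L.obj q ⊗ X) ⟶ L.obj r ⊗ X :=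
  (α_ _ _ _).inv ≫ L.μ h ▷ X

lemma act_natural {p q r : M} (h : p + q = r) {X Y : C} (f : X ⟶ Y) :
    L.obj p ◁ L.obj q ◁ f ≫ L.act h Y = L.act h X ≫ L.obj r ◁ f := by
  simp [act, ← whisker_exchange]

lemma act_act {p q r pq qr t : M} (hpq : p + q = pq) (hqr : q + r = qr) (h : pq + r = t)
    (h' : p + qr = t) (X : C) :
    L.obj p ◁ L.act hqr X ≫ L.act h' X = L.act hpq (L.obj r ⊗ X) ≫ L.act h X := by
  have := L.assoc hpq hqr h h'
  simp only [act, MonoidalCategory.whiskerLeft_comp, Category.assoc]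
  rw [associator_inv_naturality_middle_assoc, ← comp_whiskerRight,
    associator_inv_naturality_left_assoc, ← comp_whiskerRight, this]
  simp

/-- Acting by the degree `s = b + a` obtained by a multiplication is the same as first acting by `a` on
the value of `k` and then by `b`. -/
lemma tensorHom_act {b a s c d t : M} (e : b + a = s) (ht : s + c = t) (hd : a + c = d)
    (h : b + d = t) {X W Z : C} (m : X ⟶ L.obj b) (k : W ⟶ L.obj c ⊗ Z) :
    (α_ X (L.obj a) W).inv ≫ ((m ▷ L.obj a ≫ L.μ e) ⊗ₘ k) ≫ L.act ht Z =
      (m ⊗ₘ (L.obj a ◁ k ≫ L.act hd Z)) ≫ L.act h Z := by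
  rw [MonoidalCategory.tensorHom_def m, MonoidalCategory.whiskerLeft_comp, Category.assoc,
    Category.assoc, L.act_act e hd ht h, act.eq_1 L e, MonoidalCategory.tensorHom_def,
    comp_whiskerRight]
  simp only [Category.assoc]
  rw [associator_inv_naturality_right_assoc, whisker_exchange_assoc,
    associator_inv_naturality_left_assoc]

/-- The morphism `X ≅ 𝟙 ⊗ X ⟶ L(0) ⊗ X`. -/
def unitAt {p : M} (h : 0 = p) (X : C) : X ⟶ L.obj p ⊗ X := (λ_ X).inv ≫ L.unit h ▷ X

lemma unitAt_natural {p : M} (h : 0 = p) {X Y : C} (f : X ⟶ Y) :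
    L.unitAt h X ≫ L.obj p ◁ f = f ≫ L.unitAt h Y := by
  simp [unitAt, ← whisker_exchange]

lemma unitAt_act_right {p q : M} (h : 0 = q) (h' : p + q = p) (X : C) :
    L.obj p ◁ L.unitAt h X ≫ L.act h' X = 𝟙 _ := by
  have := L.μ_unit h h'
  simp only [unitAt, act, MonoidalCategory.whiskerLeft_comp, Category.assoc,
    associator_inv_naturality_middle_assoc, ← comp_whiskerRight, this]
  simp

lemma unitAt_act_left {p q : M} (h : 0 = p) (h' : p + q = q) (X : C) :
    L.unitAt h (L.obj q ⊗ X) ≫ L.act h' X = 𝟙 _ := by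
  have := L.unit_μ h h'
  simp only [unitAt, act, Category.assoc, associator_inv_naturality_left_assoc,
    ← comp_whiskerRight, this]
  simp

end GradedCommMon

/-! ### Multiplications twisted by a 2-cocycle -/

section Twisted

variable {P A : Type u} [AddCommMonoid P] [AddCommGroup A] {c : A → A → P}
  {C : Type u₁} [Category.{v₁} C] [MonoidalCategory C] [SymmetricCategory C]

/-- A family of objects `Z(x)`, graded by the group `A`, with a commutative multiplication
`Z(x) ⊗ Z(y) ⟶ L(c(x,y)) ⊗ Z(x+y)` twisted by the 2-cocycle `c`. -/
structure TwistedCommMon (L : GradedCommMon P C) (c : A → A → P) where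
  obj : A → C
  one : 𝟙_ C ⟶ obj 0
  mul (x y : A) {xy : A} (h : x + y = xy) : obj x ⊗ obj y ⟶ L.obj (c x y) ⊗ obj xy
  one_mul (x : A) (h : 0 = c 0 x) :
    one ▷ obj x ≫ mul 0 x (zero_add x) = (λ_ _).hom ≫ L.unitAt h (obj x)
  mul_comm (x y : A) {xy : A} (h : x + y = xy) (h' : y + x = xy) (hc : c x y = c y x) :
    mul x y h ≫ L.cast hc ▷ obj xy = (β_ _ _).hom ≫ mul y x h'
  mul_assoc (x y z : A) {xy yz xyz : A} (hxy : x + y = xy) (hyz : y + z = yz) (h : xy + z = xyz)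
    (h' : x + yz = xyz) {e : P} (he : c x y + c xy z = e) (he' : c y z + c x yz = e) :
    mul x y hxy ▷ obj z ≫ (α_ _ _ _).hom ≫ L.obj (c x y) ◁ mul xy z h ≫ L.act he (obj xyz) =
      (α_ _ _ _).hom ≫ obj x ◁ mul y z hyz ≫ swapLeft _ _ _ ≫
        L.obj (c y z) ◁ mul x yz h' ≫ L.act he' (obj xyz)

namespace TwistedCommMon

variable {L : GradedCommMon P C} (Z : TwistedCommMon L c)

/-- The multiplication `(L(p) ⊗ Z(x)) ⊗ (L(q) ⊗ Z(y)) ⟶ L(p + q + c(x,y)) ⊗ Z(x + y)`. -/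
def extMul {p q r t : P} {x y z : A} (hr : p + q = r) (ht : r + c x y = t) (hz : x + y = z) :
    (L.obj p ⊗ Z.obj x) ⊗ (L.obj q ⊗ Z.obj y) ⟶ L.obj t ⊗ Z.obj z :=
  tensorμ (L.obj p) (Z.obj x) (L.obj q) (Z.obj y) ≫
    (L.μ hr ⊗ₘ Z.mul x y hz) ≫ L.act ht (Z.obj z)

lemma extMul_natural {Z Z' : TwistedCommMon L c} (η : ∀ x, Z.obj x ⟶ Z'.obj x)
    {p q r t : P} {x y z : A}
    (hr : p + q = r) (ht : r + c x y = t) (hz : x + y = z)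
    (h : Z.mul x y hz ≫ L.obj (c x y) ◁ η z = (η x ⊗ₘ η y) ≫ Z'.mul x y hz) :
    Z.extMul hr ht hz ≫ L.obj t ◁ η z =
      (L.obj p ◁ η x ⊗ₘ L.obj q ◁ η y) ≫ Z'.extMul hr ht hz := by
  have h₁ := tensorμ_natural (𝟙 (L.obj p)) (η x) (𝟙 (L.obj q)) (η y)
  rw [id_tensorHom, id_tensorHom, id_tensorHom_id] at h₁
  unfold extMul
  rw [reassoc_of% h₁, MonoidalCategory.tensorHom_comp_tensorHom_assoc, Category.id_comp, ← h,
    Category.assoc, Category.assoc, ← L.act_natural, ← id_tensorHom (L.obj r),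
    MonoidalCategory.tensorHom_comp_tensorHom_assoc, Category.comp_id]

lemma extMul_comm [IsTwoCocycle c] {p q r r' t : P} {x y z : A} (hr : p + q = r)
    (ht : r + c x y = t) (hz : x + y = z) (hr' : q + p = r') (ht' : r' + c y x = t)
    (hz' : y + x = z) :
    (β_ _ _).hom ≫ Z.extMul hr' ht' hz' = Z.extMul hr ht hz := by
  obtain rfl : r = r' := by rw [← hr, ← hr', add_comm]
  have hc : c x y = c y x := IsTwoCocycle.symm x y
  have hcast : L.obj r ◁ L.cast hc ▷ Z.obj z ≫ L.act ht' (Z.obj z) = L.act ht (Z.obj z) := by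
    have : ∀ {e : P} (he : c x y = e) (h : r + e = t),
        L.obj r ◁ L.cast he ▷ Z.obj z ≫ L.act h (Z.obj z) = L.act ht (Z.obj z) := by
      rintro _ rfl h
      simp
    exact this hc ht'
  unfold extMul
  rw [← Category.assoc, tensorμ_braiding]
  simp only [Category.assoc, MonoidalCategory.tensorHom_comp_tensorHom_assoc]
  rw [L.symm hr, ← Z.mul_comm x y hz hz' hc, ← hcast, ← MonoidalCategory.id_tensorHom (L.obj r)]
  simp only [MonoidalCategory.tensorHom_comp_tensorHom_assoc, Category.comp_id]

/-- The left hand side of the associativity law for `extMul`, collected into a single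
multiplication of the coefficients and of the sections. -/
lemma act_extMul_left {p a q r s b d t : P} {x y z : A} (hr : p + a = r) (hs : r + q = s)
    (ht : s + c x y = t) (hz : x + y = z) (hb : p + q = b) (hd : a + c x y = d) (h : b + d = t) :
    L.act hr (Z.obj x) ▷ (L.obj q ⊗ Z.obj y) ≫ Z.extMul hs ht hz =
      tensorμ (L.obj p) (L.obj a ⊗ Z.obj x) (L.obj q) (Z.obj y) ≫
        (L.μ hb ⊗ₘ ((α_ _ _ _).hom ≫ L.obj a ◁ Z.mul x y hz ≫ L.act hd (Z.obj z))) ≫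
          L.act h (Z.obj z) := by
  have e : b + a = s := by rw [← hs, ← hr, ← hb]; abel
  have h1 := L.swapRight_μ hb hr e hs
  have h2 := tensorμ_natural_left (L.μ hr) (𝟙 (Z.obj x)) (L.obj q) (Z.obj y)
  have h3 := tensorμ_assoc_left (L.obj p) (L.obj a) (Z.obj x) (L.obj q) (Z.obj y)
  have h4 := L.tensorHom_act e ht hd h (L.μ hb) (Z.mul x y hz)
  rw [tensorHom_id, id_whiskerRight] at h2
  unfold extMul
  rw [GradedCommMon.act, comp_whiskerRight_assoc, reassoc_of% h2, reassoc_of% h3]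
  congr 1
  rw [MonoidalCategory.tensorHom_comp_tensorHom_assoc, Category.id_comp, ← tensorHom_id,
    MonoidalCategory.tensorHom_comp_tensorHom_assoc, h1,
    Category.id_comp, h4, ← id_tensorHom, MonoidalCategory.tensorHom_comp_tensorHom_assoc,
    Category.id_comp]

/-- The right hand side of the associativity law for `extMul`, in the same form. -/
lemma act_extMul_right {p q a r s b d t : P} {x y z : A} (hr : q + a = r) (hs : p + r = s)
    (ht : s + c x y = t) (hz : x + y = z) (hb : p + q = b) (hd : a + c x y = d) (h : b + d = t) :
    (L.obj p ⊗ Z.obj x) ◁ L.act hr (Z.obj y) ≫ Z.extMul hs ht hz =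
      tensorμ (L.obj p) (Z.obj x) (L.obj q) (L.obj a ⊗ Z.obj y) ≫
        (L.μ hb ⊗ₘ (swapLeft _ _ _ ≫ L.obj a ◁ Z.mul x y hz ≫ L.act hd (Z.obj z))) ≫
          L.act h (Z.obj z) := by
  have e : b + a = s := by rw [← hs, ← hr, ← hb]; abel
  have h1 := L.assoc hb hr e hs
  have h2 := tensorμ_natural_right (L.obj p) (Z.obj x) (L.μ hr) (𝟙 (Z.obj y))
  have h3 := tensorμ_assoc_right (L.obj p) (Z.obj x) (L.obj q) (L.obj a) (Z.obj y)
  have h4 := L.tensorHom_act e ht hd h (L.μ hb) (Z.mul x y hz)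
  rw [tensorHom_id, whiskerLeft_id] at h2
  unfold extMul
  rw [GradedCommMon.act, MonoidalCategory.whiskerLeft_comp_assoc, reassoc_of% h2, reassoc_of% h3]
  congr 1
  rw [MonoidalCategory.tensorHom_comp_tensorHom_assoc, Category.id_comp,
    ← tensorHom_id, MonoidalCategory.tensorHom_comp_tensorHom_assoc, ← h1,
    Category.id_comp, h4, ← id_tensorHom, MonoidalCategory.tensorHom_comp_tensorHom_assoc,
    Category.id_comp]

/-- The unit `𝟙 ⟶ L(0) ⊗ Z(0)`. -/
def extOne : 𝟙_ C ⟶ L.obj 0 ⊗ Z.obj 0 := Z.one ≫ L.unitAt rfl (Z.obj 0)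

lemma extOne_extMul [IsTwoCocycle c] {p r : P} (x : A) (h : 0 + p = r) (ht : r + c 0 x = p)
    (hx : 0 + x = x) :
    Z.extOne ▷ (L.obj p ⊗ Z.obj x) ≫ Z.extMul h ht hx = (λ_ _).hom := by
  obtain rfl : p = r := by rw [← h, zero_add]
  have hc : 0 = c 0 x := (IsTwoCocycle.zero x).symm
  have h1 := tensorμ_natural_left L.ε Z.one (L.obj p) (Z.obj x)
  have h2 : Z.extOne = (λ_ _).inv ≫ (L.ε ⊗ₘ Z.one) := by
    rw [extOne, GradedCommMon.unitAt, GradedCommMon.unit, L.cast_rfl, Category.comp_id,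
      tensorHom_def', leftUnitor_inv_naturality_assoc]
  rw [h2, extMul, comp_whiskerRight_assoc, reassoc_of% h1,
    MonoidalCategory.tensorHom_comp_tensorHom_assoc, L.left_unit, Z.one_mul x hc,
    tensor_left_unitality, ← Category.comp_id (λ_ (L.obj p)).hom,
    ← MonoidalCategory.tensorHom_comp_tensorHom_assoc, id_tensorHom,
    L.unitAt_act_right hc, Category.comp_id, Category.comp_id]

/-- The commutative monoid `(p, x) ↦ L(p) ⊗ Z(x)`, graded by the extension defined by `c`. -/
@[reducible] def ext [IsTwoCocycle c] : GradedCommMon (Extension c) C where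
  obj q := L.obj q.fst ⊗ Z.obj q.snd
  ε := Z.extOne
  μ h := Z.extMul rfl (congrArg Extension.fst h) (congrArg Extension.snd h)
  assoc := by
    rintro ⟨p, x⟩ ⟨q, y⟩ ⟨r, z⟩ _ _ ⟨t, w⟩ rfl rfl h h'
    change Z.extMul rfl rfl rfl ▷ _ ≫ Z.extMul rfl _ _ =
      _ ≫ _ ◁ Z.extMul rfl rfl rfl ≫ Z.extMul rfl _ _
    have hp : p + (q + r) = p + q + r := (add_assoc _ _ _).symm
    have ha : c x y + c (x + y) z = c y z + c x (y + z) := IsTwoCocycle.assoc x y z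
    have ht : p + q + r + (c x y + c (x + y) z) = t := by
      have : p + q + c x y + r + c (x + y) z = t := congrArg Extension.fst h
      rw [← this]
      abel
    have h1 := Z.mul_assoc x y z rfl rfl (congrArg Extension.snd h)
      (congrArg Extension.snd h') rfl ha.symm
    have h2 := tensorμ_natural_left (L.μ (rfl : p + q = _)) (Z.mul x y rfl) (L.obj r) (Z.obj z)
    have h3 := tensorμ_natural_right (L.obj p) (Z.obj x) (L.μ (rfl : q + r = _)) (Z.mul y z rfl)
    have h4 := tensor_associativity (L.obj p) (Z.obj x) (L.obj q) (Z.obj y) (L.obj r) (Z.obj z)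
    conv_lhs => rw [extMul]
    conv_rhs => enter [2]; rw [extMul]
    simp only [comp_whiskerRight, MonoidalCategory.whiskerLeft_comp, Category.assoc]
    rw [Z.act_extMul_left rfl rfl _ _ rfl rfl ht, Z.act_extMul_right rfl rfl _ _ hp ha.symm ht,
      reassoc_of% h2, reassoc_of% h3]
    simp only [MonoidalCategory.tensorHom_comp_tensorHom_assoc]
    rw [h1, L.assoc rfl rfl rfl hp, ← reassoc_of% h4,
      MonoidalCategory.tensorHom_comp_tensorHom_assoc]
  left_unit p := Z.extOne_extMul p.snd _ _ _
  symm {p q r} h h' := by exact Z.extMul_comm _ _ _ _ _ _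

end TwistedCommMon
end Twisted

/-! ### Monoids graded by an extension -/

section Coefficients

variable {P A : Type u} [AddCommMonoid P] [AddCommGroup A] {c : A → A → P} [IsTwoCocycle c]
  {C : Type u₁} [Category.{v₁} C] [MonoidalCategory C] [SymmetricCategory C]

lemma Extension.incl_add (p : P) (q : Extension c) :
    (⟨p, 0⟩ : Extension c) + q = ⟨p + q.fst, q.snd⟩ := by
  rw [Extension.add_def, IsTwoCocycle.zero (c := c), add_zero, zero_add]

lemma Extension.incl_mk_zero (p : P) (x : A) :
    (⟨p, 0⟩ : Extension c) + ⟨0, x⟩ = ⟨p, x⟩ := by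
  rw [Extension.incl_add, add_zero]

omit [IsTwoCocycle c] in
lemma Extension.mk_zero_add {x y z : A} (h : x + y = z) :
    (⟨0, x⟩ + ⟨0, y⟩ : Extension c) = ⟨c x y, z⟩ :=
  Extension.ext (by simp [Extension.add_def]) h

/-- A morphism of graded commutative monoids `L(p) ⟶ E(p, 0)` over the inclusion of `P` into the
extension of `A` by `P` defined by `c`. -/
structure CoeffHom (L : GradedCommMon P C) (E : GradedCommMon (Extension c) C) where
  app (p : P) : L.obj p ⟶ E.obj ⟨p, 0⟩
  app_ε : L.ε ≫ app 0 = E.ε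
  app_μ {p q r : P} (h : p + q = r) (h' : (⟨p, 0⟩ : Extension c) + ⟨q, 0⟩ = ⟨r, 0⟩) :
    L.μ h ≫ app r = (app p ⊗ₘ app q) ≫ E.μ h'

namespace CoeffHom

variable {L : GradedCommMon P C} {E : GradedCommMon (Extension c) C} (a : CoeffHom L E)

/-- The action `L(p) ⊗ E(q) ⟶ E((p, 0) + q)`. -/
def scal {p : P} {q r : Extension c} (h : (⟨p, 0⟩ : Extension c) + q = r) :
    L.obj p ⊗ E.obj q ⟶ E.obj r :=
  a.app p ▷ E.obj q ≫ E.μ h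

/-- The action of `L` on `E` is associative. -/
lemma act_scal {p q r : P} {x y z : Extension c} (h : p + q = r)
    (h₁ : (⟨r, 0⟩ : Extension c) + x = z) (h₂ : (⟨q, 0⟩ : Extension c) + x = y)
    (h₃ : (⟨p, 0⟩ : Extension c) + y = z) :
    L.act h (E.obj x) ≫ a.scal h₁ = L.obj p ◁ a.scal h₂ ≫ a.scal h₃ := by
  have e : (⟨p, 0⟩ : Extension c) + ⟨q, 0⟩ = ⟨r, 0⟩ := by rw [Extension.incl_add, h]
  have := E.assoc e h₂ h₁ h₃
  unfold scal GradedCommMon.act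
  rw [Category.assoc, ← comp_whiskerRight_assoc, a.app_μ h e, comp_whiskerRight_assoc, this,
    MonoidalCategory.tensorHom_def, comp_whiskerRight_assoc, associator_naturality_middle_assoc,
    associator_naturality_left_assoc, Iso.inv_hom_id_assoc, MonoidalCategory.whiskerLeft_comp,
    Category.assoc, whisker_exchange_assoc, whisker_exchange_assoc]

lemma cast_scal {p q : P} {x y : Extension c} (h : p = q) (h₁ : (⟨p, 0⟩ : Extension c) + x = y)
    (h₂ : (⟨q, 0⟩ : Extension c) + x = y) :
    L.cast h ▷ E.obj x ≫ a.scal h₂ = a.scal h₁ := by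
  subst h
  simp

lemma unitAt_scal {p : P} {x : Extension c} (h : 0 = p) (h' : (⟨p, 0⟩ : Extension c) + x = x) :
    L.unitAt h (E.obj x) ≫ a.scal h' = 𝟙 _ := by
  subst h
  have : E.ε ▷ E.obj x ≫ E.μ h' = (λ_ _).hom := E.left_unit x
  rw [← a.app_ε] at this
  simp only [GradedCommMon.unitAt, GradedCommMon.unit, GradedCommMon.cast_rfl, Category.comp_id,
    scal, Category.assoc]
  rw [← comp_whiskerRight_assoc, this, Iso.inv_hom_id]

lemma scal_μ {p : P} {q r s x t : Extension c} (h : (⟨p, 0⟩ : Extension c) + q = r) (h' : r + s = t)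
    (h₁ : q + s = x) (h₂ : (⟨p, 0⟩ : Extension c) + x = t) :
    a.scal h ▷ E.obj s ≫ E.μ h' = (α_ _ _ _).hom ≫ L.obj p ◁ E.μ h₁ ≫ a.scal h₂ := by
  have := E.assoc h h₁ h' h₂
  unfold scal
  rw [comp_whiskerRight_assoc, this]
  simp [whisker_exchange_assoc]

lemma μ_scal {p : P} {q r s x t : Extension c} (h : (⟨p, 0⟩ : Extension c) + q = r) (h' : s + r = t)
    (h₁ : s + q = x) (h₂ : (⟨p, 0⟩ : Extension c) + x = t) :
    E.obj s ◁ a.scal h ≫ E.μ h' = swapLeft _ _ _ ≫ L.obj p ◁ E.μ h₁ ≫ a.scal h₂ := by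
  have h3 := E.swapLeft_μ h₁ h h' h₂
  unfold scal
  rw [MonoidalCategory.whiskerLeft_comp_assoc, ← h3, reassoc_of% swapLeft_natural_middle (C := C),
    whisker_exchange_assoc]

section Groupoid

variable [IsGroupoid C]

/-- The multiplication `E(0, x) ⊗ E(0, y) ⟶ L(c(x,y)) ⊗ E(0, x + y)`. -/
noncomputable def twistedMul (x y : A) {xy : A} (h : x + y = xy) :
    E.obj ⟨0, x⟩ ⊗ E.obj ⟨0, y⟩ ⟶ L.obj (c x y) ⊗ E.obj ⟨0, xy⟩ :=
  E.μ (r := ⟨c x y, xy⟩) (Extension.mk_zero_add h) ≫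
    inv (a.scal (p := c x y) (Extension.incl_mk_zero _ _))

/-- The characterization of `twistedMul`: acting by its coefficient gives back the multiplication. -/
lemma twistedMul_scal (x y : A) {xy : A} (h : x + y = xy) {t : Extension c}
    (h₁ : (⟨c x y, 0⟩ : Extension c) + ⟨0, xy⟩ = t)
    (h₂ : (⟨0, x⟩ + ⟨0, y⟩ : Extension c) = t) :
    a.twistedMul x y h ≫ a.scal h₁ = E.μ h₂ := by
  obtain rfl : ⟨c x y, xy⟩ = t := by rw [← h₁, Extension.incl_add, add_zero]
  simp [twistedMul]

/-- For `E` graded by the extension, the objects `E(0, x)` form a twisted commutative monoid. -/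
noncomputable abbrev twisted : TwistedCommMon L c where
  obj x := E.obj ⟨0, x⟩
  one := E.ε
  mul x y xy h := a.twistedMul x y h
  one_mul x h := by
    have e : (⟨c 0 x, 0⟩ : Extension c) + ⟨0, x⟩ = ⟨0, x⟩ := by
      rw [Extension.incl_add, add_zero, ← h]
    rw [← cancel_mono (a.scal e), Category.assoc, Category.assoc, a.unitAt_scal h e,
      Category.comp_id, a.twistedMul_scal 0 x (zero_add x) e (zero_add _)]
    exact E.left_unit _
  mul_comm x y xy h h' hc := by
    have e : (⟨c x y, 0⟩ : Extension c) + ⟨0, xy⟩ = ⟨c x y, xy⟩ := Extension.incl_mk_zero _ _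
    have e' : (⟨c y x, 0⟩ : Extension c) + ⟨0, xy⟩ = ⟨c x y, xy⟩ := hc ▸ e
    have hx : (⟨0, x⟩ + ⟨0, y⟩ : Extension c) = ⟨c x y, xy⟩ := Extension.mk_zero_add h
    have hy : (⟨0, y⟩ + ⟨0, x⟩ : Extension c) = ⟨c x y, xy⟩ := by rw [add_comm, hx]
    rw [← cancel_mono (a.scal e'), Category.assoc, Category.assoc, a.cast_scal hc e e',
      a.twistedMul_scal x y h e hx, a.twistedMul_scal y x h' e' hy, E.symm hx hy]
  mul_assoc x y z xy yz xyz hxy hyz h h' e he he' := by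
    have incl := Extension.incl_mk_zero (c := c)
    have add (x y : A) {z : A} (h : x + y = z) := Extension.mk_zero_add (c := c) h
    have i₁ : (⟨c x y, 0⟩ : Extension c) + ⟨c xy z, xyz⟩ = ⟨e, xyz⟩ := by
      rw [Extension.incl_add, he]
    have i₂ : (⟨c y z, 0⟩ : Extension c) + ⟨c x yz, xyz⟩ = ⟨e, xyz⟩ := by
      rw [Extension.incl_add, he']
    have j₁ : (⟨c x y, xy⟩ : Extension c) + ⟨0, z⟩ = ⟨e, xyz⟩ := by
      rw [← incl, add_assoc, add xy z h, i₁]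
    have j₂ : (⟨0, x⟩ : Extension c) + ⟨c y z, yz⟩ = ⟨e, xyz⟩ := by
      rw [← incl (c y z) yz, add_left_comm, add x yz h', i₂]
    rw [← cancel_mono (a.scal (incl e xyz))]
    simp only [Category.assoc]
    rw [a.act_scal he _ (incl _ _) i₁, a.act_scal he' _ (incl _ _) i₂,
      ← MonoidalCategory.whiskerLeft_comp_assoc, ← MonoidalCategory.whiskerLeft_comp_assoc,
      a.twistedMul_scal xy z h _ (add _ _ h), a.twistedMul_scal x yz h' _ (add _ _ h'),
      ← a.scal_μ (incl (c x y) xy) j₁, ← a.μ_scal (incl (c y z) yz) j₂,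
      ← comp_whiskerRight_assoc, ← MonoidalCategory.whiskerLeft_comp_assoc,
      a.twistedMul_scal x y hxy _ (add _ _ hxy), a.twistedMul_scal y z hyz _ (add _ _ hyz),
      E.assoc]

/-- The comparison `L(p) ⊗ E(0, x) ⟶ E(p, x)`. -/
def counit (p : P) (x : A) : L.obj p ⊗ E.obj ⟨0, x⟩ ⟶ E.obj ⟨p, x⟩ :=
  a.scal (Extension.incl_mk_zero p x)

/-- The comparison `L(p) ⊗ E(0, x) ⟶ E(p, x)` is multiplicative. -/
lemma counit_μ {p q r t : P} {x y z : A} (hr : p + q = r) (ht : r + c x y = t) (hz : x + y = z)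
    (h : (⟨p, x⟩ + ⟨q, y⟩ : Extension c) = ⟨t, z⟩) :
    (a.counit p x ⊗ₘ a.counit q y) ≫ E.μ h = a.twisted.extMul hr ht hz ≫ a.counit t z := by
  have h₀ := Extension.mk_zero_add (c := c) hz
  have incl := Extension.incl_mk_zero (c := c)
  have h₁ := incl (c x y) z
  have h₂ : (⟨r, 0⟩ : Extension c) + ⟨c x y, z⟩ = ⟨t, z⟩ := by rw [Extension.incl_add, ht]
  have h₃ : (⟨p, 0⟩ : Extension c) + ⟨q, 0⟩ = ⟨r, 0⟩ := by rw [Extension.incl_add, hr]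
  have h₄ : a.twisted.mul x y hz ≫ a.scal h₁ = E.μ h₀ := a.twistedMul_scal x y hz h₁ h₀
  have h₅ := tensorμ_natural (a.app p) (𝟙 (E.obj ⟨0, x⟩)) (a.app q) (𝟙 (E.obj ⟨0, y⟩))
  rw [id_tensorHom_id] at h₅
  unfold counit
  conv_rhs =>
    rw [TwistedCommMon.extMul, Category.assoc, Category.assoc]
    enter [2, 2]
    exact a.act_scal ht _ h₁ h₂
  rw [← id_tensorHom, MonoidalCategory.tensorHom_comp_tensorHom_assoc, Category.comp_id, h₄]
  calc
    _ = ((a.app p ⊗ₘ 𝟙 _) ⊗ₘ (a.app q ⊗ₘ 𝟙 _)) ≫ (E.μ (incl p x) ⊗ₘ E.μ (incl q y)) ≫ E.μ h := by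
      rw [scal, scal, tensorHom_id, tensorHom_id,
        MonoidalCategory.tensorHom_comp_tensorHom_assoc]
    _ = tensorμ _ _ _ _ ≫ ((a.app p ⊗ₘ a.app q) ≫ E.μ h₃ ⊗ₘ E.μ h₀) ≫ E.μ h₂ := by
      rw [← E.tensorμ_μ (incl p x) (incl q y) h₃ h₀ h h₂, reassoc_of% h₅,
        MonoidalCategory.tensorHom_comp_tensorHom_assoc, Category.id_comp]
    _ = _ := by
      rw [← a.app_μ hr h₃, scal, ← tensorHom_id, MonoidalCategory.tensorHom_comp_tensorHom_assoc,
        Category.comp_id]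

/-- The comparison `L(p) ⊗ E(0, x) ⟶ E(p, x)` preserves the units. -/
lemma extOne_counit : a.twisted.extOne ≫ a.counit 0 0 = E.ε := by
  rw [TwistedCommMon.extOne, Category.assoc]
  exact (congrArg (E.ε ≫ ·) (a.unitAt_scal rfl _)).trans (Category.comp_id _)

/-- The comparison `L(p) ⊗ E(0, x) ⟶ E(p, x)` is compatible with the coefficients. -/
lemma counit_app (p : P) : (ρ_ _).inv ≫ L.obj p ◁ a.twisted.one ≫ a.counit p 0 = a.app p := by
  have h := E.right_unit ⟨p, 0⟩
  change _ ≫ _ ◁ E.ε ≫ a.app p ▷ _ ≫ E.μ (add_zero (⟨p, 0⟩ : Extension c)) = _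
  rw [whisker_exchange_assoc, h, rightUnitor_naturality, Iso.inv_hom_id_assoc]

end Groupoid

end CoeffHom

namespace TwistedCommMon

variable {L : GradedCommMon P C} (Z : TwistedCommMon L c)

/-- The morphism `L(p) ≅ L(p) ⊗ 𝟙 ⟶ L(p) ⊗ Z(0)`. -/
def coeff (p : P) : L.obj p ⟶ L.obj p ⊗ Z.obj 0 := (ρ_ _).inv ≫ L.obj p ◁ Z.one

omit [IsTwoCocycle c] in
lemma coeff_act {p q r : P} (h : p + q = r) :
    L.obj p ◁ Z.coeff q ≫ L.act h (Z.obj 0) = L.μ h ≫ Z.coeff r := by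
  unfold coeff
  rw [MonoidalCategory.whiskerLeft_comp, Category.assoc, L.act_natural, GradedCommMon.act]
  simp

/-- Multiplication by coefficients is the action of `L`. -/
lemma coeff_extMul {p q r s : P} {x : A} (hr : p + q = r) (hs : r + c 0 x = s) (hs' : p + q = s)
    (hx : 0 + x = x) :
    Z.coeff p ▷ (L.obj q ⊗ Z.obj x) ≫ Z.extMul hr hs hx = L.act hs' (Z.obj x) := by
  obtain rfl : r = s := by rw [← hr, hs']
  have hc : 0 = c 0 x := (IsTwoCocycle.zero x).symm
  have h1 := tensorμ_natural_left (𝟙 (L.obj p)) Z.one (L.obj q) (Z.obj x)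
  have h2 := tensorμ_unit_second (L.obj p) (L.obj q) (Z.obj x)
  rw [id_tensorHom, id_whiskerRight] at h1
  rw [coeff, extMul, comp_whiskerRight_assoc, reassoc_of% h1,
    MonoidalCategory.tensorHom_comp_tensorHom_assoc, Z.one_mul x hc, Category.id_comp,
    MonoidalCategory.tensorHom_def', MonoidalCategory.whiskerLeft_comp, Category.assoc,
    Category.assoc, reassoc_of% h2, whisker_exchange_assoc, L.unitAt_act_right hc,
    Category.comp_id, GradedCommMon.act]

omit [IsTwoCocycle c] in
/-- The original multiplication is the restriction of `extMul` to `p = q = 0`. -/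
lemma unitAt_extMul {x y z : A} (hr : (0 : P) + 0 = 0) (ht : 0 + c x y = c x y) (hz : x + y = z) :
    (L.unitAt rfl (Z.obj x) ⊗ₘ L.unitAt rfl (Z.obj y)) ≫ Z.extMul hr ht hz = Z.mul x y hz := by
  have h1 := tensorμ_natural L.ε (𝟙 (Z.obj x)) L.ε (𝟙 (Z.obj y))
  have h2 := tensorμ_unit_first_third (Z.obj x) (Z.obj y)
  have h3 : (L.ε ⊗ₘ L.ε) ≫ L.μ hr = (λ_ _).hom ≫ L.ε := by
    rw [MonoidalCategory.tensorHom_def', Category.assoc, L.left_unit, leftUnitor_naturality]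
  simp only [GradedCommMon.unitAt, GradedCommMon.unit, GradedCommMon.cast_rfl, Category.comp_id]
  rw [tensorHom_id, tensorHom_id, id_tensorHom_id] at h1
  rw [← MonoidalCategory.tensorHom_comp_tensorHom, extMul, Category.assoc, reassoc_of% h1,
    MonoidalCategory.tensorHom_comp_tensorHom_assoc, h3, Category.id_comp,
    MonoidalCategory.tensorHom_def (_ ≫ _), Category.assoc, comp_whiskerRight_assoc, reassoc_of% h2,
    ← whisker_exchange_assoc, ← leftUnitor_inv_naturality_assoc]
  have := L.unitAt_act_left rfl ht (Z.obj z)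
  rw [GradedCommMon.unitAt, GradedCommMon.unit, L.cast_rfl, Category.comp_id,
    Category.assoc] at this
  rw [this, Category.comp_id]

/-- The inclusion of the coefficients, as a morphism of graded commutative monoids. -/
def coeffHom : CoeffHom L Z.ext where
  app := Z.coeff
  app_ε := by
    change L.ε ≫ (ρ_ _).inv ≫ _ = Z.one ≫ L.unitAt rfl _
    rw [GradedCommMon.unitAt, GradedCommMon.unit, L.cast_rfl, Category.comp_id,
      rightUnitor_inv_naturality_assoc, leftUnitor_inv_naturality_assoc, ← whisker_exchange,
      unitors_inv_equal]
  app_μ {p q r} h h' := by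
    have := Z.coeff_extMul rfl (congrArg Extension.fst h') h (congrArg Extension.snd h')
    change L.μ h ≫ Z.coeff r = (Z.coeff p ⊗ₘ Z.coeff q) ≫
      Z.extMul rfl (congrArg Extension.fst h') (congrArg Extension.snd h')
    rw [MonoidalCategory.tensorHom_def', Category.assoc, ← Z.coeff_act h, ← this]

variable {Z} {Z' : TwistedCommMon L c}
  (θ : ∀ (p : P) (x : A), L.obj p ⊗ Z.obj x ⟶ L.obj p ⊗ Z'.obj x)

/-- A family `θ` which is multiplicative and compatible with the coefficients is `L`-linear. -/
lemma act_comp_of_coeff_comp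
    (hμ : ∀ {p q r t : P} {x y z : A} (hr : p + q = r) (ht : r + c x y = t) (hz : x + y = z),
      Z.extMul hr ht hz ≫ θ t z = (θ p x ⊗ₘ θ q y) ≫ Z'.extMul hr ht hz)
    (ha : ∀ p : P, Z.coeff p ≫ θ p 0 = Z'.coeff p) {p q r : P} (x : A) (h : p + q = r) :
    L.act h (Z.obj x) ≫ θ (r) x = L.obj p ◁ θ (q) x ≫ L.act h (Z'.obj x) := by
  have e : r + c 0 x = r := by rw [IsTwoCocycle.zero (c := c), add_zero]
  rw [← Z.coeff_extMul h e h (zero_add x), ← Z'.coeff_extMul h e h (zero_add x), Category.assoc,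
    hμ, MonoidalCategory.tensorHom_def, Category.assoc, ← comp_whiskerRight_assoc, ha,
    whisker_exchange_assoc]

/-- The morphism `Z(x) ⟶ Z'(x)` defined by a morphism `L(0) ⊗ Z(x) ⟶ L(0) ⊗ Z'(x)`. -/
noncomputable def descend [IsGroupoid C] (x : A) : Z.obj x ⟶ Z'.obj x :=
  L.unitAt (rfl : 0 = (0 : P)) (Z.obj x) ≫ θ (0) x ≫ inv (L.unitAt (rfl : 0 = (0 : P)) (Z'.obj x))

/-- An `L`-linear family `θ(p, x)` is determined by its values at `p = 0`: because `p + 0 = p`, it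
is `id ⊗ θ'` for the morphism `θ'` which corresponds to `θ(0, x)`. -/
lemma eq_whiskerLeft_descend [IsGroupoid C]
    (hμ : ∀ {p q r t : P} {x y z : A} (hr : p + q = r) (ht : r + c x y = t) (hz : x + y = z),
      Z.extMul hr ht hz ≫ θ t z = (θ p x ⊗ₘ θ q y) ≫ Z'.extMul hr ht hz)
    (ha : ∀ p : P, Z.coeff p ≫ θ p 0 = Z'.coeff p) (p : P) (x : A) :
    θ (p) x = L.obj p ◁ descend θ x := by
  have h := act_comp_of_coeff_comp θ hμ ha x (add_zero p)
  have h₁ : descend θ x ≫ L.unitAt (rfl : 0 = (0 : P)) (Z'.obj x) =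
    L.unitAt (rfl : 0 = (0 : P)) (Z.obj x) ≫ θ (0) x := by simp [descend]
  have h₂ := L.unitAt_act_right rfl (add_zero p) (Z'.obj x)
  have h₃ := L.unitAt_act_right rfl (add_zero p) (Z.obj x)
  rw [← Category.id_comp (θ p x), ← h₃, Category.assoc, h,
    ← MonoidalCategory.whiskerLeft_comp_assoc, ← h₁, MonoidalCategory.whiskerLeft_comp_assoc, h₂,
    Category.comp_id]

/-- The morphisms obtained from a multiplicative family respect the twisted multiplications. -/
lemma descend_mul [IsGroupoid C]
    (hμ : ∀ {p q r t : P} {x y z : A} (hr : p + q = r) (ht : r + c x y = t) (hz : x + y = z),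
      Z.extMul hr ht hz ≫ θ t z = (θ p x ⊗ₘ θ q y) ≫ Z'.extMul hr ht hz)
    (ha : ∀ p : P, Z.coeff p ≫ θ p 0 = Z'.coeff p) (x y : A) {z : A} (h : x + y = z) :
    Z.mul x y h ≫ L.obj (c x y) ◁ descend θ z =
      (descend θ x ⊗ₘ descend θ y) ≫ Z'.mul x y h := by
  have h₁ (x : A) : descend θ x ≫ L.unitAt (rfl : 0 = (0 : P)) (Z'.obj x) =
    L.unitAt (rfl : 0 = (0 : P)) (Z.obj x) ≫ θ (0) x := by simp [descend]
  rw [← eq_whiskerLeft_descend θ hμ ha, ← Z.unitAt_extMul (add_zero 0) (zero_add _) h,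
    ← Z'.unitAt_extMul (add_zero 0) (zero_add _) h, Category.assoc, hμ,
    MonoidalCategory.tensorHom_comp_tensorHom_assoc,
    MonoidalCategory.tensorHom_comp_tensorHom_assoc, h₁, h₁]

end TwistedCommMon

end Coefficients

/-! ### Twisting by a cochain and its coherence conditions -/

section Transport

variable {P : Type u} [AddCommMonoid P] {C : Type u₁} [Category.{v₁} C] [MonoidalCategory C]
  [SymmetricCategory C] [IsGroupoid C] (L : GradedCommMon P C)

/-- If `F` and its trivialization `u` are identified by `ψ` with `L(0)` and the inverse of the unit
of `L`, then a morphism `κ : X₀ ⊗ X ⟶ F ⊗ X` is compatible with `u` exactly when the induced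
multiplication `m` with values in `L(0) ⊗ X` satisfies the unit law. -/
lemma GradedCommMon.one_mul_iff {p : P} (h : 0 = p) {X X₀ F : C} (zero : X₀ ⟶ 𝟙_ C)
    (κ : X₀ ⊗ X ⟶ F ⊗ X) (ψ : F ⟶ L.obj p) (u : F ⟶ 𝟙_ C)
    (hu : ψ ≫ L.cast h.symm ≫ inv L.ε = u) {one : 𝟙_ C ⟶ X₀} {m : X₀ ⊗ X ⟶ L.obj p ⊗ X}
    (hone : inv zero = one) (hm : κ ≫ ψ ▷ X = m) :
    κ ≫ u ▷ X = zero ▷ X ↔ one ▷ X ≫ m = (λ_ X).hom ≫ L.unitAt h X := by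
  subst h hu hone hm
  rw [← cancel_epi (inv zero ▷ X), ← comp_whiskerRight (inv zero), IsIso.inv_hom_id,
    ← cancel_mono (L.ε ▷ X)]
  simp [GradedCommMon.unitAt, GradedCommMon.unit, ← comp_whiskerRight]

/-- The analogue of `GradedCommMon.one_mul_iff` for the symmetry isomorphism `s`. -/
lemma GradedCommMon.mul_comm_iff {p q : P} (h : p = q) {X Y W F F' : C}
    (κ : X ⊗ Y ⟶ F ⊗ W) (κ' : Y ⊗ X ⟶ F' ⊗ W) (ψ : F ⟶ L.obj p) (ψ' : F' ⟶ L.obj q) (s : F ⟶ F')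
    (hs : ψ ≫ L.cast h = s ≫ ψ') {m : X ⊗ Y ⟶ L.obj p ⊗ W} {m' : Y ⊗ X ⟶ L.obj q ⊗ W}
    (hm : κ ≫ ψ ▷ W = m) (hm' : κ' ≫ ψ' ▷ W = m') :
    κ ≫ s ▷ W = (β_ X Y).hom ≫ κ' ↔ m ≫ L.cast h ▷ W = (β_ X Y).hom ≫ m' := by
  rw [← hm, ← hm', Category.assoc, ← comp_whiskerRight, hs, comp_whiskerRight,
    ← cancel_mono (ψ' ▷ W), Category.assoc, Category.assoc]

/-- The analogue of `GradedCommMon.one_mul_iff` for the associativity isomorphism `a`. -/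
lemma GradedCommMon.mul_assoc_iff {p₁ p₂ p₃ p₄ e : P} (he : p₁ + p₂ = e) (he' : p₃ + p₄ = e)
    {X Y Z XY YZ W F₁ F₂ F₃ F₄ : C} (κ₁ : X ⊗ Y ⟶ F₁ ⊗ XY) (κ₂ : XY ⊗ Z ⟶ F₂ ⊗ W)
    (κ₃ : Y ⊗ Z ⟶ F₃ ⊗ YZ) (κ₄ : X ⊗ YZ ⟶ F₄ ⊗ W) (ψ₁ : F₁ ⟶ L.obj p₁) (ψ₂ : F₂ ⟶ L.obj p₂)
    (ψ₃ : F₃ ⟶ L.obj p₃) (ψ₄ : F₄ ⟶ L.obj p₄) (a : F₃ ⊗ F₄ ⟶ F₁ ⊗ F₂)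
    (ha : (ψ₃ ⊗ₘ ψ₄) ≫ L.μ he' ≫ inv (L.μ he) = a ≫ (ψ₁ ⊗ₘ ψ₂))
    {m₁ : X ⊗ Y ⟶ L.obj p₁ ⊗ XY} {m₂ : XY ⊗ Z ⟶ L.obj p₂ ⊗ W} {m₃ : Y ⊗ Z ⟶ L.obj p₃ ⊗ YZ}
    {m₄ : X ⊗ YZ ⟶ L.obj p₄ ⊗ W} (hm₁ : κ₁ ≫ ψ₁ ▷ XY = m₁) (hm₂ : κ₂ ≫ ψ₂ ▷ W = m₂)
    (hm₃ : κ₃ ≫ ψ₃ ▷ YZ = m₃) (hm₄ : κ₄ ≫ ψ₄ ▷ W = m₄) :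
    κ₁ ▷ Z ≫ (α_ _ _ _).hom ≫ F₁ ◁ κ₂ ≫ (α_ _ _ _).inv =
        (α_ _ _ _).hom ≫ X ◁ κ₃ ≫ (α_ _ _ _).inv ≫ (β_ _ _).hom ▷ YZ ≫ (α_ _ _ _).hom ≫
          F₃ ◁ κ₄ ≫ (α_ _ _ _).inv ≫ a ▷ W ↔
      m₁ ▷ Z ≫ (α_ _ _ _).hom ≫ L.obj p₁ ◁ m₂ ≫ L.act he W =
        (α_ _ _ _).hom ≫ X ◁ m₃ ≫ swapLeft _ _ _ ≫ L.obj p₃ ◁ m₄ ≫ L.act he' W := by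
  subst hm₁ hm₂ hm₃ hm₄
  have ha' : (ψ₃ ⊗ₘ ψ₄) ≫ L.μ he' = a ≫ (ψ₁ ⊗ₘ ψ₂) ≫ L.μ he := by
    rw [← reassoc_of% ha, IsIso.inv_hom_id, Category.comp_id]
  have h₁ : (κ₁ ≫ ψ₁ ▷ XY) ▷ Z ≫ (α_ _ _ _).hom ≫ L.obj p₁ ◁ (κ₂ ≫ ψ₂ ▷ W) ≫ L.act he W =
      (κ₁ ▷ Z ≫ (α_ _ _ _).hom ≫ F₁ ◁ κ₂ ≫ (α_ _ _ _).inv) ≫ ((ψ₁ ⊗ₘ ψ₂) ≫ L.μ he) ▷ W := by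
    simp only [GradedCommMon.act, MonoidalCategory.tensorHom_def, comp_whiskerRight,
      MonoidalCategory.whiskerLeft_comp, Category.assoc, associator_naturality_left_assoc,
      ← whisker_exchange_assoc, associator_inv_naturality_left_assoc,
      associator_inv_naturality_middle_assoc]
    rw [← comp_whiskerRight_assoc (_ ▷ _), ← whisker_exchange, comp_whiskerRight_assoc]
  have h₂ : (α_ _ _ _).hom ≫ X ◁ (κ₃ ≫ ψ₃ ▷ YZ) ≫ swapLeft _ _ _ ≫
        L.obj p₃ ◁ (κ₄ ≫ ψ₄ ▷ W) ≫ L.act he' W =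
      ((α_ _ _ _).hom ≫ X ◁ κ₃ ≫ (α_ _ _ _).inv ≫ (β_ _ _).hom ▷ YZ ≫ (α_ _ _ _).hom ≫
        F₃ ◁ κ₄ ≫ (α_ _ _ _).inv ≫ a ▷ W) ≫ ((ψ₁ ⊗ₘ ψ₂) ≫ L.μ he) ▷ W := by
    simp only [Category.assoc, ← comp_whiskerRight, ← ha']
    rw [MonoidalCategory.whiskerLeft_comp, Category.assoc,
      reassoc_of% swapLeft_natural_middle (C := C)]
    simp only [swapLeft, GradedCommMon.act, MonoidalCategory.tensorHom_def, comp_whiskerRight,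
      MonoidalCategory.whiskerLeft_comp, Category.assoc, ← whisker_exchange_assoc,
      associator_inv_naturality_left_assoc, associator_inv_naturality_middle_assoc]
    rw [← comp_whiskerRight_assoc (_ ▷ _), ← whisker_exchange, comp_whiskerRight_assoc]
  rw [h₁, h₂, cancel_mono]

end Transport

/-! ### Restriction maps over a monoidal functor -/

section Squares

open Functor.LaxMonoidal Functor.OplaxMonoidal

variable {C : Type u₁} [Category.{v₁} C] {D : Type u₂} [Category.{v₂} D] (G : C ⥤ D)

/-- For morphisms `r : G(X) ⟶ X'` and `s : G(Y) ⟶ Y'`, regarded as morphisms `X' ⟶ X` and `Y' ⟶ Y`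
over `G`, the condition that `f : X ⟶ Y` and `f' : X' ⟶ Y'` form a commutative square with them. -/
def ResSquare {X Y : C} {X' Y' : D} (r : G.obj X ⟶ X') (s : G.obj Y ⟶ Y') (f : X ⟶ Y)
    (f' : X' ⟶ Y') : Prop :=
  G.map f ≫ s = r ≫ f'

variable {G}

namespace ResSquare

variable {X Y Z W X₁ X₂ Y₁ Y₂ : C} {X' Y' Z' W' X₁' X₂' Y₁' Y₂' : D}

lemma id (r : G.obj X ⟶ X') : ResSquare G r r (𝟙 X) (𝟙 X') := by
  simp [ResSquare]

lemma comp {r : G.obj X ⟶ X'} {s : G.obj Y ⟶ Y'} {t : G.obj Z ⟶ Z'} {f : X ⟶ Y} {f' : X' ⟶ Y'}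
    {g : Y ⟶ Z} {g' : Y' ⟶ Z'} (h : ResSquare G r s f f') (h' : ResSquare G s t g g') :
    ResSquare G r t (f ≫ g) (f' ≫ g') := by
  unfold ResSquare at *
  rw [G.map_comp, Category.assoc, h', reassoc_of% h]

lemma inv {r : G.obj X ⟶ X'} {s : G.obj Y ⟶ Y'} {f : X ⟶ Y} {f' : X' ⟶ Y'} [IsIso f] [IsIso f']
    (h : ResSquare G r s f f') :
    ResSquare G s r (CategoryTheory.inv f) (CategoryTheory.inv f') := by
  unfold ResSquare at *
  rw [Functor.map_inv, IsIso.inv_comp_eq, ← Category.assoc, IsIso.eq_comp_inv, h]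

variable [MonoidalCategory C] [MonoidalCategory D] [G.Monoidal]

variable (G) in
/-- The tensor product of morphisms `G(X) ⟶ X'` and `G(Y) ⟶ Y'`. -/
def resTensor (r : G.obj X ⟶ X') (s : G.obj Y ⟶ Y') : G.obj (X ⊗ Y) ⟶ X' ⊗ Y' :=
  δ G X Y ≫ (r ⊗ₘ s)

lemma tensor {r₁ : G.obj X₁ ⟶ X₁'} {r₂ : G.obj X₂ ⟶ X₂'} {s₁ : G.obj Y₁ ⟶ Y₁'}
    {s₂ : G.obj Y₂ ⟶ Y₂'} {f : X₁ ⟶ Y₁} {f' : X₁' ⟶ Y₁'} {g : X₂ ⟶ Y₂} {g' : X₂' ⟶ Y₂'}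
    (h : ResSquare G r₁ s₁ f f') (h' : ResSquare G r₂ s₂ g g') :
    ResSquare G (resTensor G r₁ r₂) (resTensor G s₁ s₂) (f ⊗ₘ g) (f' ⊗ₘ g') := by
  unfold ResSquare resTensor at *
  rw [← δ_natural_assoc, Category.assoc, MonoidalCategory.tensorHom_comp_tensorHom,
    MonoidalCategory.tensorHom_comp_tensorHom, h, h']

lemma whiskerLeft (r₁ : G.obj X₁ ⟶ X₁') {r₂ : G.obj X₂ ⟶ X₂'} {s₂ : G.obj Y₂ ⟶ Y₂'}
    {g : X₂ ⟶ Y₂} {g' : X₂' ⟶ Y₂'} (h : ResSquare G r₂ s₂ g g') :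
    ResSquare G (resTensor G r₁ r₂) (resTensor G r₁ s₂) (X₁ ◁ g) (X₁' ◁ g') := by
  rw [← id_tensorHom, ← id_tensorHom]
  exact (id r₁).tensor h

lemma whiskerRight {r₁ : G.obj X₁ ⟶ X₁'} {s₁ : G.obj Y₁ ⟶ Y₁'} {f : X₁ ⟶ Y₁} {f' : X₁' ⟶ Y₁'}
    (h : ResSquare G r₁ s₁ f f') (r₂ : G.obj X₂ ⟶ X₂') :
    ResSquare G (resTensor G r₁ r₂) (resTensor G s₁ r₂) (f ▷ X₂) (f' ▷ X₂') := by
  rw [← tensorHom_id, ← tensorHom_id]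
  exact h.tensor (id r₂)

lemma associator (r : G.obj X ⟶ X') (s : G.obj Y ⟶ Y') (t : G.obj Z ⟶ Z') :
    ResSquare G (resTensor G (resTensor G r s) t) (resTensor G r (resTensor G s t))
      (α_ X Y Z).hom (α_ X' Y' Z').hom := by
  have h := Functor.OplaxMonoidal.associativity G X Y Z
  unfold ResSquare resTensor
  have h₁ : (r ⊗ₘ δ G Y Z ≫ (s ⊗ₘ t)) = G.obj X ◁ δ G Y Z ≫ (r ⊗ₘ (s ⊗ₘ t)) := by
    rw [← id_tensorHom, MonoidalCategory.tensorHom_comp_tensorHom, Category.id_comp]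
  have h₂ : (δ G X Y ≫ (r ⊗ₘ s) ⊗ₘ t) = δ G X Y ▷ G.obj Z ≫ ((r ⊗ₘ s) ⊗ₘ t) := by
    rw [← tensorHom_id, MonoidalCategory.tensorHom_comp_tensorHom, Category.id_comp]
  rw [h₁, ← reassoc_of% h, ← MonoidalCategory.associator_naturality, h₂]
  simp only [Category.assoc]

lemma associator_inv (r : G.obj X ⟶ X') (s : G.obj Y ⟶ Y') (t : G.obj Z ⟶ Z') :
    ResSquare G (resTensor G r (resTensor G s t)) (resTensor G (resTensor G r s) t)
      (α_ X Y Z).inv (α_ X' Y' Z').inv := by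
  rw [← IsIso.Iso.inv_hom (α_ X Y Z), ← IsIso.Iso.inv_hom (α_ X' Y' Z')]
  exact (associator r s t).inv

lemma leftUnitor_inv (r : G.obj X ⟶ X') :
    ResSquare G r (resTensor G (η G) r) (λ_ X).inv (λ_ X').inv := by
  have h := Functor.OplaxMonoidal.left_unitality G X
  unfold ResSquare resTensor
  rw [MonoidalCategory.leftUnitor_inv_naturality, h, MonoidalCategory.tensorHom_def]
  simp only [Category.assoc]

lemma rightUnitor_inv (r : G.obj X ⟶ X') :
    ResSquare G r (resTensor G r (η G)) (ρ_ X).inv (ρ_ X').inv := by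
  have h := Functor.OplaxMonoidal.right_unitality G X
  unfold ResSquare resTensor
  rw [MonoidalCategory.rightUnitor_inv_naturality, h, MonoidalCategory.tensorHom_def']
  simp only [Category.assoc]

end ResSquare

open ResSquare

section Braided

variable [MonoidalCategory C] [MonoidalCategory D] [SymmetricCategory C] [SymmetricCategory D]
  [G.Braided]
  {X Y Z W : C} {X' Y' Z' W' : D}

lemma ResSquare.braiding (r : G.obj X ⟶ X') (s : G.obj Y ⟶ Y') :
    ResSquare G (resTensor G r s) (resTensor G s r) (β_ X Y).hom (β_ X' Y').hom := by
  unfold ResSquare resTensor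
  rw [G.map_braiding]
  simp

lemma ResSquare.tensorμ (r : G.obj X ⟶ X') (s : G.obj Y ⟶ Y') (t : G.obj Z ⟶ Z')
    (w : G.obj W ⟶ W') :
    ResSquare G (resTensor G (resTensor G r s) (resTensor G t w))
      (resTensor G (resTensor G r t) (resTensor G s w)) (MonoidalCategory.tensorμ X Y Z W)
      (MonoidalCategory.tensorμ X' Y' Z' W') :=
  (associator _ _ _).comp <| ((associator_inv _ _ _).whiskerLeft _).comp <|
    (((braiding _ _).whiskerRight _).whiskerLeft _).comp <|
    ((associator _ _ _).whiskerLeft _).comp <| associator_inv _ _ _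

variable {M : Type*} {M' : Type*} [AddCommMonoid M] [AddCommMonoid M']
  {L : GradedCommMon M C} {L' : GradedCommMon M' D}

lemma ResSquare.act {p q r : M} {p' q' r' : M'} {h : p + q = r} {h' : p' + q' = r'}
    {a : G.obj (L.obj p) ⟶ L'.obj p'} {b : G.obj (L.obj q) ⟶ L'.obj q'}
    {c : G.obj (L.obj r) ⟶ L'.obj r'} (hμ : ResSquare G (resTensor G a b) c (L.μ h) (L'.μ h'))
    (d : G.obj X ⟶ X') :
    ResSquare G (resTensor G a (resTensor G b d)) (resTensor G c d) (L.act h X) (L'.act h' X') :=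
  (associator_inv _ _ _).comp (hμ.whiskerRight _)

lemma ResSquare.unitAt {a : G.obj (L.obj 0) ⟶ L'.obj 0} (hε : ResSquare G (η G) a L.ε L'.ε)
    (d : G.obj X ⟶ X') :
    ResSquare G d (resTensor G a d) (L.unitAt rfl X) (L'.unitAt rfl X') := by
  simp only [GradedCommMon.unitAt, GradedCommMon.unit, GradedCommMon.cast_rfl, Category.comp_id]
  exact (leftUnitor_inv _).comp (hε.whiskerRight _)

end Braided

end Squares

/-! ### Pullback of line bundles with a section -/

section Pullback

open Functor.LaxMonoidal Functor.OplaxMonoidal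

/-- Tensor products and pullbacks of `O`-modules are computed at each affine scheme over `V`, so that
this and the next two identities hold by definition on elementary tensors. -/
lemma OMod.pull_braided {V' V : Scheme.{u}} (g : V' ⟶ V) (M N : OMod V) :
    (β_ _ _).hom ≫ μ (OMod.pull g) N M =
      μ (OMod.pull g) M N ≫ (OMod.pull g).map (β_ M N).hom := by
  ext1
  exact ModuleCat.MonoidalCategory.tensor_ext fun _ _ => rfl

lemma OMod.pullId_tensor (V : Scheme.{u}) (M N : OMod V) :
    μ (OMod.pull (𝟙 V)) M N ≫ (OMod.pullId V).hom.app (M ⊗ N) =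
      (OMod.pullId V).hom.app M ⊗ₘ (OMod.pullId V).hom.app N := by
  ext1
  exact ModuleCat.MonoidalCategory.tensor_ext fun _ _ => rfl

lemma OMod.pullComp_tensor {V'' V' V : Scheme.{u}} (g' : V'' ⟶ V') (g : V' ⟶ V) (M N : OMod V) :
    μ (OMod.pull (g' ≫ g)) M N ≫ (OMod.pullComp g' g).hom.app (M ⊗ N) =
      ((OMod.pullComp g' g).hom.app M ⊗ₘ (OMod.pullComp g' g).hom.app N) ≫
        μ (OMod.pull g') _ _ ≫ (OMod.pull g').map (μ (OMod.pull g) M N) := by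
  ext1
  exact ModuleCat.MonoidalCategory.tensor_ext fun _ _ => rfl

noncomputable instance {V' V : Scheme.{u}} (g : V' ⟶ V) : (DivCat.pull g).Braided where
  braided M N := PointedInvertible.hom_ext (OMod.pull_braided g M.obj N.obj).symm

lemma DivCat.pullId_tensor (V : Scheme.{u}) (M N : DivCat V) :
    tensorRes ((DivCat.pullId V).hom.app M) ((DivCat.pullId V).hom.app N) =
      (DivCat.pullId V).hom.app (M ⊗ N) := by
  have h : μ (DivCat.pull (𝟙 V)) M N ≫ (DivCat.pullId V).hom.app (M ⊗ N) =
      (DivCat.pullId V).hom.app M ⊗ₘ (DivCat.pullId V).hom.app N :=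
    PointedInvertible.hom_ext (OMod.pullId_tensor V M.obj N.obj)
  rw [tensorRes, ← h]
  exact Functor.Monoidal.δ_μ_assoc ..

lemma DivCat.pullComp_tensor {V'' V' V : Scheme.{u}} (g' : V'' ⟶ V') (g : V' ⟶ V) {M N : DivCat V}
    {M' N' : DivCat V'} {M'' N'' : DivCat V''} (a : (DivCat.pull g).obj M ⟶ M')
    (b : (DivCat.pull g).obj N ⟶ N') (a' : (DivCat.pull g').obj M' ⟶ M'')
    (b' : (DivCat.pull g').obj N' ⟶ N'') :
    tensorRes ((DivCat.pullComp g' g).hom.app M ≫ (DivCat.pull g').map a ≫ a')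
        ((DivCat.pullComp g' g).hom.app N ≫ (DivCat.pull g').map b ≫ b') =
      (DivCat.pullComp g' g).hom.app (M ⊗ N) ≫ (DivCat.pull g').map (tensorRes a b) ≫
        tensorRes a' b' := by
  have h : μ (DivCat.pull (g' ≫ g)) M N ≫ (DivCat.pullComp g' g).hom.app (M ⊗ N) =
      ((DivCat.pullComp g' g).hom.app M ⊗ₘ (DivCat.pullComp g' g).hom.app N) ≫
        μ (DivCat.pull g') _ _ ≫ (DivCat.pull g').map (μ (DivCat.pull g) M N) :=
    PointedInvertible.hom_ext (OMod.pullComp_tensor g' g M.obj N.obj)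
  rw [← cancel_epi (μ (DivCat.pull (g' ≫ g)) M N), reassoc_of% h]
  simp only [tensorRes, Functor.map_comp, Category.assoc, Functor.Monoidal.μ_δ_assoc]
  rw [← Functor.map_comp_assoc (DivCat.pull g') (μ _ _ _), Functor.Monoidal.μ_δ,
    CategoryTheory.Functor.map_id, Category.id_comp, ← δ_natural_assoc, Functor.Monoidal.μ_δ_assoc,
    MonoidalCategory.tensorHom_comp_tensorHom, MonoidalCategory.tensorHom_comp_tensorHom]

end Pullback

/-! ### Fibered categories and their equivalences -/

section Fibered

variable {𝒮 : Type u₁} [Category.{v₁} 𝒮] {𝒳 : Type u₂} [Category.{v₂} 𝒳]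

/-- A criterion for a morphism to be strongly cartesian in which all morphisms of the base are
images under `p`. -/
lemma isStronglyCartesian_map (p : 𝒳 ⥤ 𝒮) {a b : 𝒳} (φ : a ⟶ b)
    (h : ∀ {c : 𝒳} (g : p.obj c ⟶ p.obj a) (φ' : c ⟶ b), g ≫ p.map φ = p.map φ' →
      ∃! χ : c ⟶ a, p.map χ = g ∧ χ ≫ φ = φ') : p.IsStronglyCartesian (p.map φ) φ where
  universal_property' {c} g φ' hφ' := by
    obtain ⟨χ, ⟨h₁, h₂⟩, h₃⟩ := h g φ' (IsHomLift.eq_of_isHomLift p _ φ')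
    exact ⟨χ, ⟨h₁ ▸ inferInstance, h₂⟩,
      fun χ' h' => h₃ χ' ⟨(@IsHomLift.eq_of_isHomLift _ _ _ _ p _ _ g χ' h'.1).symm, h'.2⟩⟩

/-- A functor is fibered in groupoids if every morphism of the base lifts to the total category and
every morphism of the total category is strongly cartesian. -/
lemma isFibered_of_lift (p : 𝒳 ⥤ 𝒮)
    (h : ∀ {a b : 𝒳} (φ : a ⟶ b), p.IsStronglyCartesian (p.map φ) φ)
    (h' : ∀ (a : 𝒳) (R : 𝒮) (f : R ⟶ p.obj a), ∃ (b : 𝒳) (φ : b ⟶ a), p.IsHomLift f φ) :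
    p.IsFibered :=
  Functor.IsFibered.of_exists_isStronglyCartesian fun a R f => by
    obtain ⟨b, φ, hφ⟩ := h' a R f
    have e := IsHomLift.domain_eq p f φ
    subst e
    obtain rfl := IsHomLift.eq_of_isHomLift p f φ
    exact ⟨b, φ, h φ⟩

end Fibered

section BasedEquivalence

lemma preimage_conj_unit {𝒳 : Type u₁} [Category.{v₁} 𝒳] {𝒴 : Type u₂} [Category.{v₂} 𝒴]
    {F : 𝒳 ⥤ 𝒴} (hF : F.FullyFaithful) {x y x' y' : 𝒳} (e : F.obj x' ≅ F.obj x)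
    (e' : F.obj y' ≅ F.obj y) (f : x ⟶ y) :
    f ≫ hF.preimage e'.inv = hF.preimage e.inv ≫ hF.preimage (e.hom ≫ F.map f ≫ e'.inv) :=
  hF.map_injective (by simp)

lemma map_preimage_conj_comp {𝒳 : Type u₁} [Category.{v₁} 𝒳] {𝒴 : Type u₂} [Category.{v₂} 𝒴]
    {F : 𝒳 ⥤ 𝒴} (hF : F.FullyFaithful) {x y : 𝒳} {z w : 𝒴} (e : F.obj x ≅ z) (e' : F.obj y ≅ w)
    (f : z ⟶ w) : F.map (hF.preimage (e.hom ≫ f ≫ e'.inv)) ≫ e'.hom = e.hom ≫ f := by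
  simp

variable {𝒮 : Type u₁} [Category.{v₁} 𝒮] {𝒳 𝒴 : BasedCategory.{v₂, u₂} 𝒮} (F : 𝒳 ⟶ 𝒴)

/-- An inverse of a fully faithful based functor which is essentially surjective on fibers. -/
noncomputable def basedInverse (hF : (BasedFunctor.toFunctor F).FullyFaithful) (o : 𝒴.obj → 𝒳.obj)
    (ho : ∀ y, 𝒳.p.obj (o y) = 𝒴.p.obj y) (e : ∀ y, (BasedFunctor.toFunctor F).obj (o y) ≅ y)
    (he : ∀ y, 𝒴.p.IsHomLift (𝟙 (𝒴.p.obj y)) (e y).hom) : 𝒴 ⟶ 𝒳 where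
  obj := o
  map f := hF.preimage ((e _).hom ≫ f ≫ (e _).inv)
  map_id y := hF.map_injective (by simp)
  map_comp f g := hF.map_injective (by simp)
  w := by
    refine CategoryTheory.Functor.ext ho fun y y' f => ?_
    have := he y
    have := he y'
    have : 𝒴.p.IsHomLift (𝟙 (𝒴.p.obj y')) (e y').inv := IsHomLift.lift_id_inv ..
    have h₁ : 𝒴.p.IsHomLift (𝟙 _ ≫ 𝒴.p.map f ≫ 𝟙 _) ((e y).hom ≫ f ≫ (e y').inv) := inferInstance
    rw [Category.id_comp, Category.comp_id,
      ← hF.map_preimage ((e y).hom ≫ f ≫ (e y').inv)] at h₁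
    have h₂ := BasedFunctor.isHomLift_map F (𝒴.p.map f) (hF.preimage ((e y).hom ≫ f ≫ (e y').inv))
    exact IsHomLift.fac' 𝒳.p (𝒴.p.map f) _

/-- A fully faithful based functor which is essentially surjective on fibers is an equivalence. -/
lemma exists_equivalence_hom_eq (hF : (BasedFunctor.toFunctor F).FullyFaithful)
    (h : ∀ y : 𝒴.obj, ∃ (x : 𝒳.obj) (_ : 𝒳.p.obj x = 𝒴.p.obj y)
      (e : (BasedFunctor.toFunctor F).obj x ≅ y), 𝒴.p.IsHomLift (𝟙 (𝒴.p.obj y)) e.hom) :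
    ∃ Φ : Bicategory.Equivalence 𝒳 𝒴, Φ.hom = F := by
  choose o ho e he using h
  let G := basedInverse F hF o ho e he
  have hinv (y) : 𝒴.p.IsHomLift (𝟙 (𝒴.p.obj y)) (e y).inv :=
    have := he y
    IsHomLift.lift_id_inv ..
  let η : 𝟙 𝒳 ≅ F ≫ G := BasedNatIso.mkNatIso
    (NatIso.ofComponents (fun x => hF.preimageIso (e (F.obj x)).symm)
      (fun f => preimage_conj_unit hF _ _ f))
    (fun x => by
      have h₁ := hinv (F.obj x)
      rw [BasedFunctor.w_obj F x] at h₁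
      have h₂ : (e (F.obj x)).inv = F.map (hF.preimage (e (F.obj x)).inv) :=
        (hF.map_preimage _).symm
      rw [h₂] at h₁
      exact BasedFunctor.isHomLift_map F (𝟙 (𝒳.p.obj x)) (hF.preimage (e (F.obj x)).inv))
  let ε : G ≫ F ≅ 𝟙 𝒴 := BasedNatIso.mkNatIso
    (NatIso.ofComponents (fun y => e y) (fun f => map_preimage_conj_comp hF _ _ f)) he
  exact ⟨Bicategory.Equivalence.mkOfAdjointifyCounit η ε, rfl⟩

end BasedEquivalence

/-! ### The two categories are fibered -/

section Families

variable {S : Scheme.{u}}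

namespace Family

variable {X : (Over S)ᵒᵖ ⥤ Type (u + 1)}

/-- The pullback `φ^* E`. -/
noncomputable def pullback {T' T : Over S} (φ : T' ⟶ T) (E : Family T X) : Family T' X where
  obj v x := E.obj (v ≫ φ) x
  res g _ _ hv _ _ hx := E.res g (by rw [← Category.assoc, hv]) hx
  res_id v x hx := E.res_id (v ≫ φ) x hx
  res_comp g' g _ _ _ hv hv' hv'' _ _ _ hx hx' hx'' := E.res_comp g' g _ _ _ hx hx' hx''

/-- The canonical morphism `φ^* E ⟶ E` over `φ`. -/
noncomputable def pullbackHom {T' T : Over S} (φ : T' ⟶ T) (E : Family T X) :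
    Hom φ E (E.pullback φ) where
  app h x := eqToHom (by rw [← h]; rfl)
  naturality g v w v' w' h h' hv hw x x' hx := by
    subst h h'
    change (DivCat.pull g.left).map (𝟙 (E.obj _ _)) ≫ E.res g _ hx = E.res g _ hx ≫ 𝟙 (E.obj _ _)
    rw [CategoryTheory.Functor.map_id, Category.id_comp, Category.comp_id]

namespace Hom

variable {T'' T' T : Over S} {φ : T' ⟶ T} {ψ : T'' ⟶ T'} {χ : T'' ⟶ T} {E : Family T X}
  {E' : Family T' X} {E'' : Family T'' X}

/-- The factorization of a morphism over `ψ ≫ φ` through a morphism over `φ`. -/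
noncomputable def lift (a : Hom φ E E') (b : Hom χ E E'') (h : ψ ≫ φ = χ) : Hom ψ E' E'' where
  app {V v w} hv x := inv (a.app (rfl : w ≫ φ = w ≫ φ) x) ≫
    b.app (by rw [← h, ← Category.assoc, hv]) x
  naturality g v w v' w' hw hw' hv hww x x' hx := by
    have h₁ : ResSquare _ _ _ _ _ := a.naturality g rfl rfl hww (by rw [← Category.assoc, hww]) hx
    have h₂ : ResSquare _ _ _ _ _ := b.naturality g
      (show v ≫ χ = w ≫ φ by rw [← h, ← Category.assoc, hw])
      (show v' ≫ χ = w' ≫ φ by rw [← h, ← Category.assoc, hw']) hv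
      (by rw [← Category.assoc, hww]) hx
    exact h₁.inv.comp h₂

lemma app_lift_app (a : Hom φ E E') (b : Hom χ E E'') (h : ψ ≫ φ = χ) {V : Over S} {v : V ⟶ T''}
    {w : V ⟶ T'} {t : V ⟶ T} (hv : v ≫ ψ = w) (hw : w ≫ φ = t) (hvt : v ≫ χ = t)
    (x : X.obj (op V)) :
    a.app hw x ≫ (a.lift b h).app hv x = b.app hvt x := by
  subst hw
  simp [lift]

end Hom

end Family

end Families

namespace CochainWithBoundary

variable {S : Scheme.{u}} {A : AbPresheaf S} {f : TwoCocycle (base S) A}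

/-- The pullback `φ^*(ζ, κ)`. -/
noncomputable def pullback (X : CochainWithBoundary f) {T' : Over S} (φ : T' ⟶ X.T) :
    CochainWithBoundary f where
  T := T'
  ζ :=
    { toFamily := X.ζ.toFamily.pullback φ
      zero := fun v => X.ζ.zero (v ≫ φ)
      zero_res := fun g _ _ hv => X.ζ.zero_res g (by rw [← Category.assoc, hv]) }
  κ v := X.κ (v ≫ φ)
  κ_res g _ _ hv := X.κ_res g (by rw [← Category.assoc, hv])
  κ_u v := X.κ_u (v ≫ φ)
  κ_s v := X.κ_s (v ≫ φ)
  κ_a v := X.κ_a (v ≫ φ)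

/-- The canonical morphism from the pullback. -/
noncomputable def pullbackHom (X : CochainWithBoundary f) {T' : Over S} (φ : T' ⟶ X.T) :
    X.pullback φ ⟶ X where
  φ := φ
  η := X.ζ.toFamily.pullbackHom φ
  κ_η h x y xy hxy := by
    subst h
    change X.κ _ _ _ hxy ≫ _ ◁ 𝟙 (X.ζ.obj _ _) =
      (𝟙 (X.ζ.obj _ _) ⊗ₘ 𝟙 (X.ζ.obj _ _)) ≫ X.κ _ _ _ hxy
    rw [whiskerLeft_id, id_tensorHom_id, Category.id_comp, Category.comp_id]

/-- Every morphism is cartesian, because the morphisms of `Div` are isomorphisms. -/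
lemma existsUnique_lift {X'' X' X : CochainWithBoundary f} (a : X' ⟶ X) (b : X'' ⟶ X)
    (ψ : X''.T ⟶ X'.T) (h : ψ ≫ Hom.φ a = Hom.φ b) :
    ∃! c : X'' ⟶ X', Hom.φ c = ψ ∧ c ≫ a = b := by
  have key {V : Over S} {v : V ⟶ X''.T} {w : V ⟶ X'.T} (hv : v ≫ ψ = w) (x : A.obj (op V)) :
      (Hom.η a).app rfl x ≫ ((Hom.η a).lift (Hom.η b) h).app hv x =
        (Hom.η b).app (by rw [← h, ← Category.assoc, hv]) x :=
    (Hom.η a).app_lift_app _ h hv rfl _ x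
  refine ⟨⟨ψ, (Hom.η a).lift (Hom.η b) h, ?_⟩, ⟨rfl, ?_⟩, ?_⟩
  · intro V v w hv x y xy hxy
    have h₁ := Hom.κ_η a (rfl : w ≫ Hom.φ a = _) x y hxy
    have h₂ := Hom.κ_η b (show v ≫ Hom.φ b = w ≫ Hom.φ a by rw [← h, ← Category.assoc, hv]) x y hxy
    rw [← cancel_epi ((Hom.η a).app rfl x ⊗ₘ (Hom.η a).app rfl y), ← reassoc_of% h₁,
      ← MonoidalCategory.whiskerLeft_comp, key,
      MonoidalCategory.tensorHom_comp_tensorHom_assoc, key, key, h₂]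
  · refine Hom.ext_app (a := Hom.comp _ a) (b := b) h ?_
    intro V v w hv hw x
    exact (Hom.η a).app_lift_app (Hom.η b) h rfl _ hw x
  · rintro c ⟨rfl, rfl⟩
    refine Hom.ext_app rfl ?_
    intro V v w hv hw x
    subst hv
    rw [← cancel_epi ((Hom.η a).app rfl x)]
    exact (key hw x).symm

lemma isFibered : (basedCategory f).p.IsFibered :=
  isFibered_of_lift _
    (fun a => isStronglyCartesian_map _ a fun ψ b h => existsUnique_lift a b ψ h)
    (fun X _ φ =>
      ⟨X.pullback φ, X.pullbackHom φ, .map (p := (basedCategory f).p) (X.pullbackHom φ)⟩)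

end CochainWithBoundary

namespace RootObject

variable {S : Scheme.{u}} {P Q : MonPresheaf S} {j : P ⟶ Q} {L : SymMonFunctor (base S) P}

/-- The pullback `φ^*(E, α)`. -/
noncomputable def pullback (X : RootObject j L) {T' : Over S} (φ : T' ⟶ X.T) :
    RootObject j L where
  T := T'
  E :=
    { toFamily := X.E.toFamily.pullback φ
      ε := fun v => X.E.ε (v ≫ φ)
      μ := fun v => X.E.μ (v ≫ φ)
      ε_res := fun g _ _ hv => X.E.ε_res g (by rw [← Category.assoc, hv])
      μ_res := fun g _ _ hv => X.E.μ_res g (by rw [← Category.assoc, hv])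
      assoc := fun v => X.E.assoc (v ≫ φ)
      left_unit := fun v => X.E.left_unit (v ≫ φ)
      right_unit := fun v => X.E.right_unit (v ≫ φ)
      symm := fun v => X.E.symm (v ≫ φ) }
  α v := X.α (v ≫ φ)
  α_res g _ _ hv := X.α_res g (by rw [← Category.assoc, hv])
  α_ε v := X.α_ε (v ≫ φ)
  α_μ v := X.α_μ (v ≫ φ)

/-- The canonical morphism from the pullback. -/
noncomputable def pullbackHom (X : RootObject j L) {T' : Over S} (φ : T' ⟶ X.T) :
    X.pullback φ ⟶ X where
  φ := φ
  θ := X.E.toFamily.pullbackHom φ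
  θ_ε h := by
    subst h
    exact Category.comp_id _
  θ_μ h p q r hr := by
    subst h
    change X.E.μ _ hr ≫ 𝟙 (X.E.obj _ _) = (𝟙 (X.E.obj _ _) ⊗ₘ 𝟙 (X.E.obj _ _)) ≫ X.E.μ _ hr
    rw [id_tensorHom_id, Category.id_comp, Category.comp_id]
  θ_α h p := by
    subst h
    exact Category.comp_id _

/-- Every morphism is cartesian, because the morphisms of `Div` are isomorphisms. -/
lemma existsUnique_lift {X'' X' X : RootObject j L} (a : X' ⟶ X) (b : X'' ⟶ X)
    (ψ : X''.T ⟶ X'.T) (h : ψ ≫ Hom.φ a = Hom.φ b) :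
    ∃! c : X'' ⟶ X', Hom.φ c = ψ ∧ c ≫ a = b := by
  have key {V : Over S} {v : V ⟶ X''.T} {w : V ⟶ X'.T} (hv : v ≫ ψ = w) (x : Q.obj (op V)) :
      (Hom.θ a).app rfl x ≫ ((Hom.θ a).lift (Hom.θ b) h).app hv x =
        (Hom.θ b).app (by rw [← h, ← Category.assoc, hv]) x :=
    (Hom.θ a).app_lift_app _ h hv rfl _ x
  have hb {V : Over S} {v : V ⟶ X''.T} {w : V ⟶ X'.T} (hv : v ≫ ψ = w) :
      v ≫ Hom.φ b = w ≫ Hom.φ a := by rw [← h, ← Category.assoc, hv]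
  refine ⟨⟨ψ, (Hom.θ a).lift (Hom.θ b) h, ?_, ?_, ?_⟩, ⟨rfl, ?_⟩, ?_⟩
  · intro V v w hv
    rw [← Hom.θ_ε a rfl, Category.assoc, key, Hom.θ_ε b (hb hv)]
  · intro V v w hv p q r hr
    have h₁ := Hom.θ_μ a (rfl : w ≫ Hom.φ a = _) hr
    rw [← cancel_epi ((Hom.θ a).app rfl p ⊗ₘ (Hom.θ a).app rfl q), ← reassoc_of% h₁, key,
      MonoidalCategory.tensorHom_comp_tensorHom_assoc, key, key, Hom.θ_μ b (hb hv) hr]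
  · intro V v w hv p
    rw [← Hom.θ_α a rfl, Category.assoc, key, Hom.θ_α b (hb hv)]
  · refine Hom.ext_app (a := Hom.comp _ a) (b := b) h ?_
    intro V v w hv hw x
    exact (Hom.θ a).app_lift_app (Hom.θ b) h rfl _ hw x
  · rintro c ⟨rfl, rfl⟩
    refine Hom.ext_app rfl ?_
    intro V v w hv hw x
    subst hv
    rw [← cancel_epi ((Hom.θ a).app rfl x)]
    exact (key hw x).symm

lemma isFibered : (basedCategory j L).p.IsFibered :=
  isFibered_of_lift _
    (fun a => isStronglyCartesian_map _ a fun ψ b h => existsUnique_lift a b ψ h)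
    (fun X _ φ =>
      ⟨X.pullback φ, X.pullbackHom φ, .map (p := (basedCategory j L).p) (X.pullbackHom φ)⟩)

end RootObject

/-! ### The comparison functor -/

section Fibers

variable {S : Scheme.{u}}

instance (V : Scheme.{u}) : IsGroupoid (DivCat V) where
  all_isIso f := ⟨Groupoid.inv f, Groupoid.comp_inv f, Groupoid.inv_comp f⟩

/-- The value of a symmetric monoidal functor `P|_T ⟶ Div|_T` at `v : V ⟶ T`. -/
@[reducible] def SymMonFunctor.fiber {T : Over S} {P : MonPresheaf S} (E : SymMonFunctor T P)
    {V : Over S} (v : V ⟶ T) : GradedCommMon (P.obj (op V)) (DivCat V.left) where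
  obj p := E.obj v p
  ε := E.ε v
  μ h := E.μ v h
  assoc := E.assoc v
  left_unit := E.left_unit v
  symm := E.symm v

namespace CochainWithBoundary

variable {A : AbPresheaf S} {f : TwoCocycle (base S) A}
  {L : SymMonFunctor (base S) (universalSheaf A)}

/-- The compatibility of `κ` with `u` is the unit law for `(ψ ⊗ id) ∘ κ`. -/
lemma one_mul_iff (ψ : CocycleData.Hom f.toCocycleData L.toCocycleData) {V : Over S}
    (x : A.obj (op V)) (h : 0 = universalCocycle A 0 x) {X X₀ : DivCat V.left} (zero : X₀ ⟶ 𝟙_ _)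
    (κ : X₀ ⊗ X ⟶ f.obj (toBase V) (0, x) ⊗ X) {one : 𝟙_ (DivCat V.left) ⟶ X₀}
    {m : X₀ ⊗ X ⟶ L.obj (toBase V) (universalCocycle A 0 x) ⊗ X} (hone : inv zero = one)
    (hm : κ ≫ ψ.app (toBase V) 0 x ▷ X = m) :
    κ ≫ f.u (toBase V) x ▷ X = zero ▷ X ↔
      one ▷ X ≫ m = (λ_ X).hom ≫ (L.fiber (toBase V)).unitAt h X :=
  (L.fiber (toBase V)).one_mul_iff h zero κ _ _ (ψ.u (toBase V) x) hone hm

/-- The compatibility of `κ` with `s` is the commutative law for `(ψ ⊗ id) ∘ κ`. -/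
lemma mul_comm_iff (ψ : CocycleData.Hom f.toCocycleData L.toCocycleData) {V : Over S}
    (x y : A.obj (op V)) (h : universalCocycle A x y = universalCocycle A y x)
    {X Y W : DivCat V.left} (κ : X ⊗ Y ⟶ f.obj (toBase V) (x, y) ⊗ W)
    (κ' : Y ⊗ X ⟶ f.obj (toBase V) (y, x) ⊗ W)
    {m : X ⊗ Y ⟶ L.obj (toBase V) (universalCocycle A x y) ⊗ W}
    {m' : Y ⊗ X ⟶ L.obj (toBase V) (universalCocycle A y x) ⊗ W}
    (hm : κ ≫ ψ.app (toBase V) x y ▷ W = m) (hm' : κ' ≫ ψ.app (toBase V) y x ▷ W = m') :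
    κ ≫ f.s (toBase V) x y ▷ W = (β_ X Y).hom ≫ κ' ↔
      m ≫ (L.fiber (toBase V)).cast h ▷ W = (β_ X Y).hom ≫ m' :=
  (L.fiber (toBase V)).mul_comm_iff h κ κ' _ _ _ (ψ.s (toBase V) x y) hm hm'

/-- The compatibility of `κ` with `a` is the associative law for `(ψ ⊗ id) ∘ κ`. -/
lemma mul_assoc_iff (ψ : CocycleData.Hom f.toCocycleData L.toCocycleData) {V : Over S}
    (x y z : A.obj (op V)) {xy yz : A.obj (op V)} (hxy : x + y = xy) (hyz : y + z = yz)
    {e : (universalSheaf A).obj (op V)}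
    (he : universalCocycle A x y + universalCocycle A xy z = e)
    (he' : universalCocycle A y z + universalCocycle A x yz = e)
    {X Y Z XY YZ W : DivCat V.left} (κ₁ : X ⊗ Y ⟶ f.obj (toBase V) (x, y) ⊗ XY)
    (κ₂ : XY ⊗ Z ⟶ f.obj (toBase V) (xy, z) ⊗ W) (κ₃ : Y ⊗ Z ⟶ f.obj (toBase V) (y, z) ⊗ YZ)
    (κ₄ : X ⊗ YZ ⟶ f.obj (toBase V) (x, yz) ⊗ W)
    {m₁ : X ⊗ Y ⟶ L.obj (toBase V) (universalCocycle A x y) ⊗ XY}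
    {m₂ : XY ⊗ Z ⟶ L.obj (toBase V) (universalCocycle A xy z) ⊗ W}
    {m₃ : Y ⊗ Z ⟶ L.obj (toBase V) (universalCocycle A y z) ⊗ YZ}
    {m₄ : X ⊗ YZ ⟶ L.obj (toBase V) (universalCocycle A x yz) ⊗ W}
    (hm₁ : κ₁ ≫ ψ.app (toBase V) x y ▷ XY = m₁) (hm₂ : κ₂ ≫ ψ.app (toBase V) xy z ▷ W = m₂)
    (hm₃ : κ₃ ≫ ψ.app (toBase V) y z ▷ YZ = m₃) (hm₄ : κ₄ ≫ ψ.app (toBase V) x yz ▷ W = m₄) :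
    κ₁ ▷ Z ≫ (α_ _ _ _).hom ≫ _ ◁ κ₂ ≫ (α_ _ _ _).inv =
        (α_ _ _ _).hom ≫ X ◁ κ₃ ≫ (α_ _ _ _).inv ≫ (β_ _ _).hom ▷ YZ ≫ (α_ _ _ _).hom ≫
          _ ◁ κ₄ ≫ (α_ _ _ _).inv ≫ f.a (toBase V) x y z hxy hyz ▷ W ↔
      m₁ ▷ Z ≫ (α_ _ _ _).hom ≫ _ ◁ m₂ ≫ (L.fiber (toBase V)).act he W =
        (α_ _ _ _).hom ≫ X ◁ m₃ ≫ swapLeft _ _ _ ≫ _ ◁ m₄ ≫ (L.fiber (toBase V)).act he' W := by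
  subst he'
  exact (L.fiber (toBase V)).mul_assoc_iff he rfl κ₁ κ₂ κ₃ κ₄ _ _ _ _ _
    (ψ.a (toBase V) x y z hxy hyz) hm₁ hm₂ hm₃ hm₄

/-- The cochain `ζ` at `v : V ⟶ T`, with the multiplication
`ζ(x) ⊗ ζ(y) ≅ f(x,y) ⊗ ζ(x+y) ≅ L(e(x,y)) ⊗ ζ(x+y)`. -/
@[reducible] noncomputable def twist (X : CochainWithBoundary f)
    (ψ : CocycleData.Hom f.toCocycleData L.toCocycleData) {V : Over S} (v : V ⟶ X.T) :
    TwistedCommMon (L.fiber (toBase V)) (universalCocycle A (V := V)) where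
  obj x := X.ζ.obj v x
  one := inv (X.ζ.zero v)
  mul x y xy h := X.κ v x y h ≫ ψ.app (toBase V) x y ▷ X.ζ.obj v xy
  one_mul x h := (one_mul_iff ψ x h _ _ rfl rfl).1 (X.κ_u v x)
  mul_comm x y _ h h' hc := (mul_comm_iff ψ x y hc _ _ rfl rfl).1 (X.κ_s v x y h h')
  mul_assoc x y z _ _ _ hxy hyz h h' _ he he' :=
    (mul_assoc_iff ψ x y z hxy hyz he he' _ _ _ _ rfl rfl rfl rfl).1 (X.κ_a v x y z hxy hyz h h')

end CochainWithBoundary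

end Fibers

namespace CochainWithBoundary

variable {S : Scheme.{u}} {A : AbPresheaf S} {f : TwoCocycle (base S) A}
  {L : SymMonFunctor (base S) (universalSheaf A)} (X : CochainWithBoundary f)
  (ψ : CocycleData.Hom f.toCocycleData L.toCocycleData)

lemma twist_one_res {V' V : Over S} (g : V' ⟶ V) {v : V ⟶ X.T} {v' : V' ⟶ X.T}
    (hv : g ≫ v = v') :
    ResSquare (DivCat.pull g.left) (unitRes g.left) (X.ζ.res g hv (map_zero_eq A g.op))
      (X.twist ψ v).one (X.twist ψ v').one :=
  (show ResSquare _ _ _ _ _ from X.ζ.zero_res g hv).inv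

lemma twist_mul_res {V' V : Over S} (g : V' ⟶ V) {v : V ⟶ X.T} {v' : V' ⟶ X.T}
    (hv : g ≫ v = v') {x y z : A.obj (op V)} {x' y' z' : A.obj (op V')} (hx : A.map g.op x = x')
    (hy : A.map g.op y = y') (hz : A.map g.op z = z') (h : x + y = z) (h' : x' + y' = z') :
    ResSquare (DivCat.pull g.left) (tensorRes (X.ζ.res g hv hx) (X.ζ.res g hv hy))
      (tensorRes (L.res g (comp_toBase g) (universalCocycle_map A g hx hy)) (X.ζ.res g hv hz))
      ((X.twist ψ v).mul x y h) ((X.twist ψ v').mul x' y' h') :=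
  (show ResSquare _ _ _ _ _ from X.κ_res g hv hx hy hz h h').comp
    ((show ResSquare _ _ _ _ _ from ψ.naturality g (comp_toBase g) hx hy).whiskerRight _)

lemma twist_extMul_res {V' V : Over S} (g : V' ⟶ V) {v : V ⟶ X.T} {v' : V' ⟶ X.T}
    (hv : g ≫ v = v') {x y z : A.obj (op V)} {x' y' z' : A.obj (op V')} (hx : A.map g.op x = x')
    (hy : A.map g.op y = y') (hz : A.map g.op z = z')
    {p q r t : (universalSheaf A).obj (op V)} {p' q' r' t' : (universalSheaf A).obj (op V')}
    (hp : (universalSheaf A).map g.op p = p') (hq : (universalSheaf A).map g.op q = q')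
    (ht : (universalSheaf A).map g.op t = t') (h₁ : p + q = r)
    (h₂ : r + universalCocycle A x y = t) (h₃ : x + y = z) (h₁' : p' + q' = r')
    (h₂' : r' + universalCocycle A x' y' = t') (h₃' : x' + y' = z') :
    ResSquare (DivCat.pull g.left)
      (tensorRes (tensorRes (L.res g (comp_toBase g) hp) (X.ζ.res g hv hx))
        (tensorRes (L.res g (comp_toBase g) hq) (X.ζ.res g hv hy)))
      (tensorRes (L.res g (comp_toBase g) ht) (X.ζ.res g hv hz))
      ((X.twist ψ v).extMul h₁ h₂ h₃) ((X.twist ψ v').extMul h₁' h₂' h₃') := by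
  have hr : (universalSheaf A).map g.op r = r' := by
    rw [← h₁, ← h₁', ← hp, ← hq]
    exact map_add ((universalSheaf A).map g.op).hom p q
  have hc := universalCocycle_map A g hx hy
  have m₁ : ResSquare _ _ _ _ _ := L.μ_res g (comp_toBase g) hp hq hr h₁ h₁'
  have m₂ : ResSquare _ _ _ _ _ := L.μ_res g (comp_toBase g) hr hc ht h₂ h₂'
  exact (ResSquare.tensorμ _ _ _ _).comp
    ((m₁.tensor (X.twist_mul_res ψ g hv hx hy hz h₃ h₃')).comp
      (ResSquare.act (L := L.fiber (toBase V)) (L' := L.fiber (toBase V')) m₂ (X.ζ.res g hv hz)))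

lemma twist_extOne_res {V' V : Over S} (g : V' ⟶ V) {v : V ⟶ X.T} {v' : V' ⟶ X.T}
    (hv : g ≫ v = v') (h0 : (universalSheaf A).map g.op 0 = 0) :
    ResSquare (DivCat.pull g.left) (unitRes g.left)
      (tensorRes (L.res g (comp_toBase g) h0) (X.ζ.res g hv (map_zero_eq A g.op)))
      (X.twist ψ v).extOne (X.twist ψ v').extOne :=
  (X.twist_one_res ψ g hv).comp
    (ResSquare.unitAt (L := L.fiber (toBase V)) (L' := L.fiber (toBase V'))
      (show ResSquare _ _ _ _ _ from L.ε_res g (comp_toBase g)) _)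

lemma twist_coeff_res {V' V : Over S} (g : V' ⟶ V) {v : V ⟶ X.T} {v' : V' ⟶ X.T}
    (hv : g ≫ v = v') {p : (universalSheaf A).obj (op V)} {p' : (universalSheaf A).obj (op V')}
    (hp : (universalSheaf A).map g.op p = p') :
    ResSquare (DivCat.pull g.left) (L.res g (comp_toBase g) hp)
      (tensorRes (L.res g (comp_toBase g) hp) (X.ζ.res g hv (map_zero_eq A g.op)))
      ((X.twist ψ v).coeff p) ((X.twist ψ v').coeff p') :=
  (ResSquare.rightUnitor_inv _).comp ((X.twist_one_res ψ g hv).whiskerLeft _)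

/-- The symmetric monoidal functor `(p, x) ↦ L(p) ⊗ ζ(x)`. -/
noncomputable def extension : SymMonFunctor X.T (universalExtension A) where
  obj {V} v q := L.obj (toBase V) (Extension.fst (c := universalCocycle A (V := V)) q) ⊗
    X.ζ.obj v (Extension.snd (c := universalCocycle A (V := V)) q)
  res {V' V} g v v' hv q q' hq :=
    tensorRes (L.res g (comp_toBase g)
        (congrArg (Extension.fst (c := universalCocycle A (V := V'))) hq))
      (X.ζ.res g hv (congrArg (Extension.snd (c := universalCocycle A (V := V'))) hq))
  res_id {V} v q hq := (congrArg₂ tensorRes (L.res_id _ _ _) (X.ζ.res_id _ _ _)).trans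
    (DivCat.pullId_tensor V.left _ _)
  res_comp g' g v v' v'' hv hv' hv'' q q' q'' hq hq' hq'' :=
    (congrArg₂ tensorRes (L.res_comp g' g (comp_toBase g) (comp_toBase g') _ _ _ _)
      (X.ζ.res_comp g' g hv hv' _ _ _ _)).trans (DivCat.pullComp_tensor g'.left g.left _ _ _ _)
  ε v := (X.twist ψ v).ext.ε
  μ v _ _ _ h := (X.twist ψ v).ext.μ h
  ε_res g _ _ hv := X.twist_extOne_res ψ g hv _
  μ_res g _ _ hv _ _ _ _ _ _ hp hq hr h h' := X.twist_extMul_res ψ g hv _ _ _ _ _ _ _ _ _ _ _ _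
  assoc v := (X.twist ψ v).ext.assoc
  left_unit v := (X.twist ψ v).ext.left_unit
  right_unit v := (X.twist ψ v).ext.right_unit
  symm v := (X.twist ψ v).ext.symm

/-- The object of the root stack defined by `(p, x) ↦ L(p) ⊗ ζ(x)`. -/
noncomputable def toRootObject : RootObject (universalInclusion A) L where
  T := X.T
  E := X.extension ψ
  α v p := (X.twist ψ v).coeff p
  α_res g _ _ hv _ _ hp hq := X.twist_coeff_res ψ g hv hp
  α_ε v := ((X.twist ψ v).coeffHom.app_ε).trans (Category.comp_id _).symm
  α_μ v _ _ _ h h' := (X.twist ψ v).coeffHom.app_μ h h'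

/-- Compatibility with the isomorphisms `ζ(0) ≅ 𝟙` is a consequence of compatibility with `κ`,
because tensoring with `ζ(0)` is faithful. -/
lemma Hom.η_zero {X' X : CochainWithBoundary f} (m : Hom X' X) {V : Over S} {v : V ⟶ X'.T}
    {w : V ⟶ X.T} (h : v ≫ m.φ = w) : m.η.app h (0 : A.obj (op V)) ≫ X'.ζ.zero v = X.ζ.zero w := by
  have h₁ := m.κ_η h (0 : A.obj (op V)) 0 (zero_add 0)
  have h₂ := X.κ_u w (0 : A.obj (op V))
  have h₃ := X'.κ_u v (0 : A.obj (op V))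
  -- After tensoring with `ζ(0)`, both sides are expressed by `κ` and `u` at `(0, 0)`.
  refine PointedInvertible.eq_of_whiskerRight_eq (X.ζ.obj w (0 : A.obj (op V))) ?_
  rw [← cancel_mono (_ ◁ m.η.app h (0 : A.obj (op V))), comp_whiskerRight, Category.assoc,
    ← whisker_exchange, ← h₂, Category.assoc, ← whisker_exchange, reassoc_of% h₁, h₃,
    MonoidalCategory.tensorHom_def, Category.assoc]

lemma Hom.one_η {X' X : CochainWithBoundary f} (m : Hom X' X) {V : Over S} {v : V ⟶ X'.T}
    {w : V ⟶ X.T} (h : v ≫ m.φ = w) :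
    (X.twist ψ w).one ≫ m.η.app h (0 : A.obj (op V)) = (X'.twist ψ v).one := by
  change inv (X.ζ.zero w) ≫ _ = inv (X'.ζ.zero v)
  rw [IsIso.inv_comp_eq, IsIso.eq_comp_inv, m.η_zero]

/-- The compatibility of `η` with `κ` and `κ'`, in terms of the twisted multiplications. -/
lemma Hom.mul_η {X' X : CochainWithBoundary f} (m : Hom X' X) {V : Over S} {v : V ⟶ X'.T}
    {w : V ⟶ X.T} (h : v ≫ m.φ = w) {x y z : A.obj (op V)} (hz : x + y = z) :
    (X.twist ψ w).mul x y hz ≫ _ ◁ m.η.app h z =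
      (m.η.app h x ⊗ₘ m.η.app h y) ≫ (X'.twist ψ v).mul x y hz := by
  have h₁ := m.κ_η h x y hz
  change (X.κ w x y hz ≫ ψ.app (toBase V) x y ▷ _) ≫ _ =
    _ ≫ X'.κ v x y hz ≫ ψ.app (toBase V) x y ▷ _
  refine ((Category.assoc _ _ _).trans ?_).trans ((reassoc_of% h₁) _)
  exact congrArg (_ ≫ ·) (whisker_exchange _ _).symm

/-- The morphism `(φ, id ⊗ η)` of the root stack defined by `(φ, η)`. -/
noncomputable def Hom.toRootHom {X' X : CochainWithBoundary f} (m : Hom X' X) :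
    RootObject.Hom (X'.toRootObject ψ) (X.toRootObject ψ) where
  φ := m.φ
  θ :=
    { app := fun {V} _ _ h q =>
        L.obj (toBase V) (Extension.fst (c := universalCocycle A (V := V)) q) ◁
          m.η.app h (Extension.snd (c := universalCocycle A (V := V)) q)
      naturality := fun g _ _ _ _ h h' hv hw _ _ hx =>
        ResSquare.whiskerLeft _ (show ResSquare _ _ _ _ _ from m.η.naturality g h h' hv hw
          (congrArg (Extension.snd (c := universalCocycle A)) hx)) }
  θ_ε {V v w} h := by
    have h₁ := (L.fiber (toBase V)).unitAt_natural
      (rfl : (0 : (universalSheaf A).obj (op V)) = 0) (m.η.app h (0 : A.obj (op V)))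
    have h₂ := m.one_η ψ h
    refine (Category.assoc _ _ _).trans ((congrArg (_ ≫ ·) h₁).trans ?_)
    exact (reassoc_of% h₂) _
  θ_μ {V v w} h p q r hr :=
    TwistedCommMon.extMul_natural (Z := X.twist ψ w) (Z' := X'.twist ψ v)
      (fun x => m.η.app h x) rfl (congrArg (Extension.fst (c := universalCocycle A (V := V))) hr)
      (congrArg (Extension.snd (c := universalCocycle A (V := V))) hr) (m.mul_η ψ h _)
  θ_α {V v w} h p := by
    have h₂ := m.one_η ψ h
    refine (Category.assoc _ _ _).trans (congrArg (_ ≫ ·) ?_)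
    exact (MonoidalCategory.whiskerLeft_comp _ _ _).symm.trans (congrArg (_ ◁ ·) h₂)

variable (f L)

/-- The functor `(T, ζ, κ) ↦ (T, (p, x) ↦ L(p) ⊗ ζ(x))`. -/
noncomputable def comparison : BasedFunctor (basedCategory f) (universalRootStack A L) where
  obj X := X.toRootObject ψ
  map m := Hom.toRootHom ψ m
  map_id X := by
    refine RootObject.Hom.ext_app rfl ?_
    intro V v w ha hb q
    obtain rfl : v = w := by rw [← ha]; exact (Category.comp_id v).symm
    exact whiskerLeft_id _ _
  map_comp b a := by
    refine RootObject.Hom.ext_app rfl ?_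
    intro V v w ha hb q
    exact MonoidalCategory.whiskerLeft_comp _ _ _
  w := rfl

end CochainWithBoundary

/-! ### Full faithfulness -/

namespace CochainWithBoundary

variable {S : Scheme.{u}} {A : AbPresheaf S} {f : TwoCocycle (base S) A}
  {L : SymMonFunctor (base S) (universalSheaf A)}
  (ψ : CocycleData.Hom f.toCocycleData L.toCocycleData)

section Full

variable {X' X : CochainWithBoundary f}
  (m : RootObject.Hom (X'.toRootObject ψ) (X.toRootObject ψ))

/-- The morphisms `L(p) ⊗ ζ(x) ⟶ L(p) ⊗ ζ'(x)` which make up a morphism of the root stack. -/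
noncomputable def rootHomApp {V : Over S} {v : V ⟶ X'.T} {w : V ⟶ X.T} (h : v ≫ m.φ = w)
    (p : (universalSheaf A).obj (op V)) (x : A.obj (op V)) :
    L.obj (toBase V) p ⊗ X.ζ.obj w x ⟶ L.obj (toBase V) p ⊗ X'.ζ.obj v x :=
  m.θ.app h (⟨p, x⟩ : Extension (universalCocycle A (V := V)))

lemma extMul_rootHomApp {V : Over S} {v : V ⟶ X'.T} {w : V ⟶ X.T} (h : v ≫ m.φ = w)
    {p q r t : (universalSheaf A).obj (op V)} {x y z : A.obj (op V)} (hr : p + q = r)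
    (ht : r + universalCocycle A x y = t) (hz : x + y = z) :
    (X.twist ψ w).extMul hr ht hz ≫ rootHomApp ψ m h t z =
      (rootHomApp ψ m h p x ⊗ₘ rootHomApp ψ m h q y) ≫ (X'.twist ψ v).extMul hr ht hz := by
  subst hr
  exact m.θ_μ h (universalExtension_add A rfl ht hz)

lemma coeff_rootHomApp {V : Over S} {v : V ⟶ X'.T} {w : V ⟶ X.T} (h : v ≫ m.φ = w)
    (p : (universalSheaf A).obj (op V)) :
    (X.twist ψ w).coeff p ≫ rootHomApp ψ m h p 0 = (X'.twist ψ v).coeff p :=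
  m.θ_α h p

/-- The morphism of cochains defined by a morphism of the root stack. -/
noncomputable def ofRootHom : Hom X' X where
  φ := m.φ
  η :=
    { app := fun h x => TwistedCommMon.descend
        (Z := X.twist ψ _) (Z' := X'.twist ψ _) (rootHomApp ψ m h) x
      naturality := fun {V' V} g v w v' w' h h' hv hw x x' hx => by
        have hL : ResSquare _ _ _ _ _ := L.ε_res g (comp_toBase g)
        have h₁ := ResSquare.unitAt (L := L.fiber (toBase V)) (L' := L.fiber (toBase V')) hL
          (X.ζ.res g hw hx)
        have h₂ := ResSquare.unitAt (L := L.fiber (toBase V)) (L' := L.fiber (toBase V')) hL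
          (X'.ζ.res g hv hx)
        have h₃ : ResSquare _ _ _ _ _ := m.θ.naturality g h h' hv hw
          (universalExtension_map A g (map_zero ((universalSheaf A).map g.op).hom) hx)
        exact h₁.comp (h₃.comp h₂.inv) }
  κ_η {V v w} h x y z hz := by
    have h₁ := TwistedCommMon.descend_mul (Z := X.twist ψ w) (Z' := X'.twist ψ v)
      (rootHomApp ψ m h) (extMul_rootHomApp ψ m h) (coeff_rootHomApp ψ m h) x y hz
    rw [← cancel_mono (ψ.app (toBase V) x y ▷ _), Category.assoc, Category.assoc,
      whisker_exchange]
    exact (Category.assoc _ _ _).symm.trans h₁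

end Full

/-- The comparison functor is fully faithful. -/
noncomputable def comparisonFullyFaithful :
    (BasedFunctor.toFunctor (comparison f L ψ)).FullyFaithful where
  preimage m := ofRootHom ψ m
  map_preimage {X' X} m := by
    refine RootObject.Hom.ext_app (b := m) rfl ?_
    intro V v w ha hb q
    exact (TwistedCommMon.eq_whiskerLeft_descend (Z := X.twist ψ w) (Z' := X'.twist ψ v)
      (rootHomApp ψ m ha) (extMul_rootHomApp ψ m ha) (coeff_rootHomApp ψ m ha) _ _).symm
  preimage_map {X' X} m := by
    refine Hom.ext_app (b := m) rfl ?_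
    intro V v w ha hb x
    change (L.fiber (toBase V)).unitAt _ _ ≫ _ ◁ (Hom.η m).app hb x ≫ inv _ = _
    have h₁ := (L.fiber (toBase V)).unitAt_natural
      (rfl : (0 : (universalSheaf A).obj (op V)) = 0) ((Hom.η m).app hb x)
    refine ((reassoc_of% h₁) _).trans ?_
    exact (congrArg (_ ≫ ·) (IsIso.hom_inv_id _)).trans (Category.comp_id _)

end CochainWithBoundary

/-! ### Essential surjectivity on fibers -/

namespace RootObject

variable {S : Scheme.{u}} {A : AbPresheaf S} {f : TwoCocycle (base S) A}
  {L : SymMonFunctor (base S) (universalSheaf A)}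
  (ψ : CocycleData.Hom f.toCocycleData L.toCocycleData)
  (Y : RootObject (universalInclusion A) L)

/-- The isomorphism `α` at `v : V ⟶ T`. -/
@[reducible] noncomputable def coeffHom {V : Over S} (v : V ⟶ Y.T) :
    CoeffHom (c := universalCocycle A (V := V)) (L.fiber (toBase V)) (Y.E.fiber v) where
  app p := Y.α v p
  app_ε := (Y.α_ε v).trans (Category.comp_id _)
  app_μ h h' := Y.α_μ v h h'

lemma scal_res {V' V : Over S} (g : V' ⟶ V) {v : V ⟶ Y.T} {v' : V' ⟶ Y.T} (hv : g ≫ v = v')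
    {p : (universalSheaf A).obj (op V)} {p' : (universalSheaf A).obj (op V')}
    (hp : (universalSheaf A).map g.op p = p')
    {q r : Extension (universalCocycle A (V := V))}
    {q' r' : Extension (universalCocycle A (V := V'))}
    (hq : (universalExtension A).map g.op q = q') (hr : (universalExtension A).map g.op r = r')
    (h : ⟨p, 0⟩ + q = r) (h' : ⟨p', 0⟩ + q' = r') :
    ResSquare (DivCat.pull g.left) (tensorRes (L.res g (comp_toBase g) hp) (Y.E.res g hv hq))
      (Y.E.res g hv hr) ((Y.coeffHom v).scal h) ((Y.coeffHom v').scal h') := by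
  have hp' := universalExtension_map A g hp (map_zero_eq A g.op)
  have h₁ : ResSquare _ _ _ _ _ := Y.α_res g hv hp hp'
  have h₂ : ResSquare _ _ _ _ _ := Y.E.μ_res g hv hp' hq hr h h'
  exact (h₁.whiskerRight _).comp h₂

/-- Twisting the boundary of the cochain `x ↦ E(0, x)` back by `ψ` recovers its multiplication. -/
lemma κ_comp {V : Over S} (v : V ⟶ Y.T) (x y : A.obj (op V)) {z : A.obj (op V)} (h : x + y = z) :
    ((Y.coeffHom v).twistedMul x y h ≫ inv (ψ.app (toBase V) x y) ▷ _) ≫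
      ψ.app (toBase V) x y ▷ _ = (Y.coeffHom v).twistedMul x y h :=
  comp_inv_whiskerRight _ _

/-- The cochain `x ↦ E(0, x)`. -/
noncomputable def toCochain : CochainWithBoundary f where
  T := Y.T
  ζ :=
    { obj := fun {V} v x => Y.E.obj v (⟨0, x⟩ : Extension (universalCocycle A (V := V)))
      res := fun g _ _ hv _ _ hx => Y.E.res g hv
        (universalExtension_map A g (map_zero ((universalSheaf A).map g.op).hom) hx)
      res_id := fun v x hx => Y.E.res_id v _ _
      res_comp := fun g' g _ _ _ hv hv' hv'' _ _ _ hx hx' hx'' =>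
        Y.E.res_comp g' g hv hv' hv'' _ _ _
      zero := fun v => (inv (Y.E.ε v :) :)
      zero_res := fun g _ _ hv => (show ResSquare _ _ _ _ _ from Y.E.ε_res g hv).inv }
  κ v x y xy h := (Y.coeffHom v).twistedMul x y h ≫ inv (ψ.app (toBase _) x y) ▷ _
  κ_res {V' V} g v v' hv x y xy x' y' xy' hx hy hxy h h' := by
    have h0 := map_zero ((universalSheaf A).map g.op).hom
    have h₁ : ResSquare _ _ _ _ _ := ψ.naturality g (comp_toBase g) hx hy
    have h₂ : ResSquare _ _ _ _ _ := Y.E.μ_res g hv (universalExtension_map A g h0 hx)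
      (universalExtension_map A g h0 hy)
      (universalExtension_map A g (universalCocycle_map A g hx hy) hxy)
      (Extension.mk_zero_add h)
      (Extension.mk_zero_add h')
    have h₃ := Y.scal_res g hv (universalCocycle_map A g hx hy) (universalExtension_map A g h0 hxy)
      (universalExtension_map A g (universalCocycle_map A g hx hy) hxy)
      (Extension.incl_mk_zero _ _) (Extension.incl_mk_zero _ _)
    exact (h₂.comp h₃.inv).comp (h₁.inv.whiskerRight _)
  κ_u {V} v x := by
    have hc : 0 = universalCocycle A 0 x := (IsTwoCocycle.zero x).symm
    refine (CochainWithBoundary.one_mul_iff ψ x hc _ _ (IsIso.inv_inv (f := Y.E.ε v))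
      (Y.κ_comp ψ v 0 x (zero_add x))).2 ?_
    exact (Y.coeffHom v).twisted.one_mul x hc
  κ_s {V} v x y xy h h' := by
    have hc : universalCocycle A x y = universalCocycle A y x := IsTwoCocycle.symm x y
    refine (CochainWithBoundary.mul_comm_iff ψ x y hc _ _ (Y.κ_comp ψ v x y h)
      (Y.κ_comp ψ v y x h')).2 ?_
    exact (Y.coeffHom v).twisted.mul_comm x y h h' hc
  κ_a {V} v x y z xy yz xyz hxy hyz h h' := by
    have he : universalCocycle A x y + universalCocycle A xy z =
        universalCocycle A y z + universalCocycle A x yz := by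
      rw [← hxy, ← hyz]
      exact IsTwoCocycle.assoc (c := universalCocycle A) x y z
    refine (CochainWithBoundary.mul_assoc_iff ψ x y z hxy hyz he rfl _ _ _ _ (Y.κ_comp ψ v x y hxy)
      (Y.κ_comp ψ v xy z h) (Y.κ_comp ψ v y z hyz) (Y.κ_comp ψ v x yz h')).2 ?_
    exact (Y.coeffHom v).twisted.mul_assoc x y z hxy hyz h h' he rfl

lemma extMul_toCochain {V : Over S} (v : V ⟶ Y.T) {p q r t : (universalSheaf A).obj (op V)}
    {x y z : A.obj (op V)} (hr : p + q = r) (ht : r + universalCocycle A x y = t)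
    (hz : x + y = z) :
    ((Y.toCochain ψ).twist ψ v).extMul hr ht hz =
      (Y.coeffHom v).twisted.extMul hr ht hz :=
  congrArg (fun k => tensorμ _ _ _ _ ≫ ((L.fiber (toBase V)).μ hr ⊗ₘ k) ≫
    (L.fiber (toBase V)).act ht _) (Y.κ_comp ψ v x y hz)

lemma one_toCochain {V : Over S} (v : V ⟶ Y.T) :
    ((Y.toCochain ψ).twist ψ v).one = (Y.coeffHom v).twisted.one :=
  IsIso.inv_inv (f := Y.E.ε v)

/-- The morphism `L(p) ⊗ E(0, x) ⟶ E(p, x)`, from `(T, E, α)` to the object defined by the cochain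
`x ↦ E(0, x)`. -/
noncomputable def toComparison : Hom Y ((Y.toCochain ψ).toRootObject ψ) where
  φ := 𝟙 Y.T
  θ :=
    { app := fun {V} v w h q =>
        (Y.coeffHom w).counit (Extension.fst (c := universalCocycle A (V := V)) q)
            (Extension.snd (c := universalCocycle A (V := V)) q) ≫
          (Family.Hom.id Y.E.toFamily).app h q
      naturality := fun {V' V} g v w v' w' h h' hv hw x x' hx => by
        have h₁ := Y.scal_res g hw (congrArg (Extension.fst (c := universalCocycle A (V := V'))) hx)
          (universalExtension_map A g (map_zero ((universalSheaf A).map g.op).hom)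
            (congrArg (Extension.snd (c := universalCocycle A (V := V'))) hx)) hx
          (Extension.incl_mk_zero _ _) (Extension.incl_mk_zero _ _)
        have h₂ : ResSquare _ _ _ _ _ :=
          (Family.Hom.id Y.E.toFamily).naturality g h h' hv hw hx
        exact h₁.comp h₂ }
  θ_ε {V v w} h := by
    obtain rfl : v = w := (Category.comp_id v).symm.trans h
    have h₁ := (Y.coeffHom v).extOne_counit
    refine (congrArg (_ ≫ ·) (Category.comp_id _)).trans (Eq.trans ?_ h₁)
    exact congrArg (fun k => (k ≫ (L.fiber (toBase V)).unitAt rfl _) ≫ _) (Y.one_toCochain ψ v)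
  θ_μ {V v w} h p q r hr := by
    obtain rfl : v = w := (Category.comp_id v).symm.trans h
    have h₁ := (Y.coeffHom v).counit_μ (rfl : Extension.fst p + Extension.fst q = _)
      (congrArg (Extension.fst (c := universalCocycle A (V := V))) hr)
      (congrArg (Extension.snd (c := universalCocycle A (V := V))) hr) hr
    refine (congrArg (_ ≫ ·) (Category.comp_id _)).trans (Eq.trans ?_ (h₁.symm.trans ?_))
    · exact congrArg (· ≫ _) (Y.extMul_toCochain ψ v rfl _ _)
    · exact congrArg (· ≫ _)
        (congrArg₂ (· ⊗ₘ ·) (Category.comp_id _).symm (Category.comp_id _).symm)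
  θ_α {V v w} h p := by
    obtain rfl : v = w := (Category.comp_id v).symm.trans h
    have h₁ := (Y.coeffHom v).counit_app p
    refine (congrArg (_ ≫ ·) (Category.comp_id _)).trans (Eq.trans ?_ h₁)
    refine (Category.assoc _ _ _).trans ?_
    exact congrArg (fun k => (ρ_ _).inv ≫ _ ◁ k ≫ _) (Y.one_toCochain ψ v)

/-- Every object of the root stack is isomorphic, over the identity, to the image of the cochain
`x ↦ E(0, x)`. -/
lemma exists_comparison_iso : ∃ (X : CochainWithBoundary f)
    (_ : (CochainWithBoundary.basedCategory f).p.obj X = (universalRootStack A L).p.obj Y)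
    (e : (BasedFunctor.toFunctor (CochainWithBoundary.comparison f L ψ)).obj X ≅ Y),
    (universalRootStack A L).p.IsHomLift (𝟙 ((universalRootStack A L).p.obj Y)) e.hom := by
  -- A cartesian morphism over an identity is an isomorphism.
  let m : Y ⟶ (Y.toCochain ψ).toRootObject ψ := Y.toComparison ψ
  have h₁ : (universalRootStack A L).p.IsHomLift (𝟙 Y.T) m :=
    .map (p := (universalRootStack A L).p) m
  have h₂ : (universalRootStack A L).p.IsStronglyCartesian (𝟙 Y.T) m :=
    isStronglyCartesian_map _ m fun χ b h => existsUnique_lift m b χ h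
  have h₃ : IsIso m := Functor.IsStronglyCartesian.isIso_of_base_isIso
    (universalRootStack A L).p (𝟙 Y.T) m
  let e : Y ≅ (Y.toCochain ψ).toRootObject ψ := asIso m
  have h₄ : (universalRootStack A L).p.IsHomLift (𝟙 Y.T) e.hom := h₁
  exact ⟨Y.toCochain ψ, rfl, e.symm, IsHomLift.lift_id_inv (universalRootStack A L).p Y.T e⟩

end RootObject

/-! ### The equivalence -/

namespace CochainWithBoundary

variable {S : Scheme.{u}} {A : AbPresheaf S} {f : TwoCocycle (base S) A}
  {L : SymMonFunctor (base S) (universalSheaf A)}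
  (ψ : CocycleData.Hom f.toCocycleData L.toCocycleData)

variable (f L)

/-- The comparison functor is the canonical one. The morphisms `app` are identities, up to the
equality of the two morphisms `V ⟶ T`. -/
noncomputable def canonicalComparison : CanonicalComparison f L ψ (comparison f L ψ) where
  app X {V v w} h p x := L.obj (toBase V) p ◁
    eqToHom (congrArg (fun k => X.ζ.obj k x) (h.symm.trans (Category.comp_id w)))
  res X {V' V} g v v' w w' h h' hv hw p p' x x' hp hx := by
    obtain rfl : w = v := (Category.comp_id w).symm.trans h
    obtain rfl : w' = v' := (Category.comp_id w').symm.trans h'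
    exact ResSquare.whiskerLeft _ (.id _)
  μ X {V v w} h p q r t x y z hr ht hz := by
    obtain rfl : w = v := (Category.comp_id w).symm.trans h
    subst hr
    change (_ ◁ 𝟙 _ ⊗ₘ _ ◁ 𝟙 _) ≫ (X.twist ψ w).extMul rfl ht hz =
      tensorμ _ _ _ _ ≫ _ ≫ _ ≫ _ ≫ _ ◁ 𝟙 _
    simp only [whiskerLeft_id, id_tensorHom_id, Category.id_comp]
    rfl
  α X {V v w} h p := by
    obtain rfl : w = v := (Category.comp_id w).symm.trans h
    change _ ◁ 𝟙 _ = _ ≫ _ ≫ (ρ_ _).inv ≫ _ ◁ inv (X.ζ.zero w)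
    rw [Iso.hom_inv_id_assoc, ← MonoidalCategory.whiskerLeft_comp, IsIso.hom_inv_id]
  map {X' X} m {V v' v w' w} h' h hv hw p x := by
    obtain rfl : w = v := (Category.comp_id w).symm.trans h
    obtain rfl : w' = v' := (Category.comp_id w').symm.trans h'
    change _ ◁ 𝟙 _ ≫ _ ◁ (Hom.η m).app hv x = _ ◁ (Hom.η m).app hv x ≫ _ ◁ 𝟙 _
    rw [whiskerLeft_id, whiskerLeft_id, Category.comp_id, Category.id_comp]

end CochainWithBoundary

end StackyCover

theorem proposition6p13 (S : Scheme.{u}) (A : Sheaf (etaleTop S) AddCommGrpCat.{u + 1})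
    (f : TwoCocycle (base S) A.obj)
    (L : SymMonFunctor (base S) (universalSheaf A.obj))
    (ψ : CocycleData.Hom f.toCocycleData L.toCocycleData) :
    (CochainWithBoundary.basedCategory f).p.IsFibered ∧
    (universalRootStack A.obj L).p.IsFibered ∧
    ∃ Φ : Bicategory.Equivalence (CochainWithBoundary.basedCategory f)
        (universalRootStack A.obj L),
      Nonempty (CanonicalComparison f L ψ Φ.hom) := by
  refine ⟨CochainWithBoundary.isFibered, RootObject.isFibered, ?_⟩
  obtain ⟨Φ, hΦ⟩ := exists_equivalence_hom_eq (CochainWithBoundary.comparison f L ψ)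
    (CochainWithBoundary.comparisonFullyFaithful ψ) fun Y =>
      RootObject.exists_comparison_iso ψ Y
  exact ⟨Φ, ⟨hΦ ▸ CochainWithBoundary.canonicalComparison f L ψ⟩⟩
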